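/- For real parameters $c_0,\alpha,\gamma$ consider, for $U=(u,v)$ with $u(x,t),v(x,t)\in\mathbb R$, $x\in\mathbb R$, the system $$\partial_t u=\partial_x^2u+\tfrac12(u-c_0)(1-u^2)+v,\qquad \partial_t v=-(1+\partial_x^2)^2v+\alpha v-v^3-\gamma v(1-u^2),\tag{3}$$ and its homogeneous equilibria $U_\pm=(\pm1,0)$. Fix $c_0\in(0,1)$. There exist $\varepsilon_0,\gamma_0>0$, constants $C,\delta,\kappa>0$ and amplitudes $a^\pm=a^\pm(c_0,\gamma)$, where $\varepsilon_0,\gamma_0,C,\delta,\kappa$ depend only on $c_0$, such that for each choice of sign and every $\gamma\in(0,\gamma_0)$ the following holds. 1. (Periodic equilibria.) $|a^\pm-2/\sqrt3|\le C\gamma$, and for every $\varepsilon\in(0,\varepsilon_0)$ there is a smooth, even, $2\pi$-periodic function $U_{\rm per}^\pm:\mathbb R\to\mathbb R^2$ such that, for $\alpha=\varepsilon^2$, all translates $U_{\rm per}^\pm(\cdot-x_0)$, $x_0\in\mathbb R$, are equilibria of (3), and for all $x\in\mathbb R$ $$\Big\|U_{\rm per}^\pm(x)-\Big(\pm1+\frac{\varepsilon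 a^\pm}{2\mp c_0}\cos x,\ \varepsilon a^\pm\cos x\Big)\Big\|_\infty\le C\varepsilon^2 .$$ 2. (Supercritical pitchfork (Turing) bifurcation at $\alpha=0$, in the space of even $2\pi$-periodic functions.) (i) For $|\alpha|<\varepsilon_0^2$, the linearization of (3) at $U_\pm$ in that space has the algebraically simple eigenvalue $\alpha$, with eigenfunction $\big(\frac{\cos x}{2\mp c_0+\alpha},\cos x\big)$, and all its other eigenvalues have real part at most $-\kappa$. (ii) For $-\varepsilon_0^2<\alpha\le0$, the only even $2\pi$-periodic equilibrium $W$ of (3) with $\|W(x)-U_\pm\|_\infty<\delta$ for all $x\in\mathbb R$ is $U_\pm$. (iii) For $\alpha=\varepsilon^2$ with $\varepsilon\in(0,\varepsilon_0)$ there are exactly three such equilibria: $U_\pm$, $U_{\rm per}^\pm$ and $U_{\rm per}^\pm(\cdot+\pi)$, pairwise distinct. The last two are linearly stable: all eigenvalues of the linearization of (3) at either of them, in the space of even $2\pi$-periodic functions, have negative real part. Equilibria are time-independent solutions with $u\in C^2$, $v\in C^4$; eigenfunctions are complex-valued with the same regularity; $\|(p,q)\|_\infty=\max(|p|,|q|)$.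 -/

import Mathlib

open scoped ContDiff

noncomputable section

namespace TuringPattern

/-- The linear differential operator `L(∂ₓ)(u, v) = (∂ₓ² u, -(1 + ∂ₓ²)² v)`, with
`(1 + ∂ₓ²)² = 1 + 2 ∂ₓ² + ∂ₓ⁴`, for real (`K = ℝ`) or complex (`K = ℂ`) valued functions. -/
def diffOp {K : Type} [RCLike K] (U : ℝ → K × K) (x : ℝ) : K × K :=
  (iteratedDeriv 2 (fun y => (U y).1) x,
    -((U x).2 + 2 * iteratedDeriv 2 (fun y => (U y).2) x
      + iteratedDeriv 4 (fun y => (U y).2) x))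

/-- The nonlinearity
`N(u, v) = ((u - c₀)(1 - u²)/2 + v, α v - v³ - γ v (1 - u²))`. -/
def reaction (c₀ α γ : ℝ) (p : ℝ × ℝ) : ℝ × ℝ :=
  (1 / 2 * (p.1 - c₀) * (1 - p.1 ^ 2) + p.2,
    α * p.2 - p.2 ^ 3 - γ * p.2 * (1 - p.1 ^ 2))

/-- The (complexified) Jacobian `DN(u, v)` of the nonlinearity at `p = (u, v)`. -/
def reactionDeriv (c₀ α γ : ℝ) (p : ℝ × ℝ) (w : ℂ × ℂ) : ℂ × ℂ :=
  (((1 / 2 * (1 + 2 * c₀ * p.1 - 3 * p.1 ^ 2) : ℝ) : ℂ) * w.1 + w.2,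
    ((2 * γ * p.1 * p.2 : ℝ) : ℂ) * w.1
      + ((α - 3 * p.2 ^ 2 - γ * (1 - p.1 ^ 2) : ℝ) : ℂ) * w.2)

/-- The regularity needed to apply `L(∂ₓ)` classically: `u` is `C²` and `v` is `C⁴`. -/
def IsClassical {K : Type} [RCLike K] (U : ℝ → K × K) : Prop :=
  ContDiff ℝ 2 (fun x => (U x).1) ∧ ContDiff ℝ 4 (fun x => (U x).2)

/-- `U` is an equilibrium (a time-independent classical solution) of
`∂ₜ U = L(∂ₓ) U + N(U)` on the real line. -/
def IsEquilibrium (c₀ α γ : ℝ) (U : ℝ → ℝ × ℝ) : Prop :=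
  IsClassical U ∧ ∀ x, diffOp U x + reaction c₀ α γ (U x) = 0

/-- `2π`-periodic functions. -/
def IsPeriodic {E : Type} (U : ℝ → E) : Prop := ∀ x, U (x + 2 * Real.pi) = U x

/-- Even functions. -/
def IsEven {E : Type} (U : ℝ → E) : Prop := ∀ x, U (-x) = U x

/-- The linearization `L(∂ₓ) + DN(U)` of the right-hand side at `U`, applied to `W`. -/
def linearization (c₀ α γ : ℝ) (U : ℝ → ℝ × ℝ) (W : ℝ → ℂ × ℂ) (x : ℝ) : ℂ × ℂ :=
  diffOp W x + reactionDeriv c₀ α γ (U x) (W x)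

/-- `W` is an eigenfunction, for the eigenvalue `z`, of the linearization at `U` in the space of
even `2π`-periodic functions. -/
def IsEigenfunction (c₀ α γ : ℝ) (U : ℝ → ℝ × ℝ) (z : ℂ) (W : ℝ → ℂ × ℂ) : Prop :=
  IsClassical W ∧ IsPeriodic W ∧ IsEven W ∧ W ≠ 0 ∧
    ∀ x, linearization c₀ α γ U W x = z • W x

/-- `z` is an eigenvalue of the linearization at `U` in the space of even `2π`-periodic
functions. -/
def IsEigenvalue (c₀ α γ : ℝ) (U : ℝ → ℝ × ℝ) (z : ℂ) : Prop :=
  ∃ W : ℝ → ℂ × ℂ, IsEigenfunction c₀ α γ U z W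

/-- `z` is an algebraically simple eigenvalue, with eigenfunction `Φ`, of the linearization at `U`
in the space of even `2π`-periodic functions: the kernel of `linearization - z` is spanned by `Φ`,
and `Φ` is not in the range of `linearization - z`. -/
def IsSimpleEigenvalue (c₀ α γ : ℝ) (U : ℝ → ℝ × ℝ) (z : ℂ) (Φ : ℝ → ℂ × ℂ) : Prop :=
  IsEigenfunction c₀ α γ U z Φ ∧
    ∀ (W : ℝ → ℂ × ℂ) (s : ℂ), IsClassical W → IsPeriodic W → IsEven W →
      (∀ x, linearization c₀ α γ U W x - z • W x = s • Φ x) →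
      s = 0 ∧ ∃ t : ℂ, W = t • Φ

/-- Linear stability with respect to even `2π`-periodic perturbations: all eigenvalues lie in the
open left half-plane (the linearization has compact resolvent in this space, so its spectrum
consists of eigenvalues, and the eigenfunctions are classical). -/
def IsLinearlyStable (c₀ α γ : ℝ) (U : ℝ → ℝ × ℝ) : Prop :=
  ∀ z : ℂ, IsEigenvalue c₀ α γ U z → z.re < 0

/-- The homogeneous steady state `U_σ = (σ, 0)`, where `σ = 1` or `σ = -1`. -/
def homState (σ : ℝ) : ℝ → ℝ × ℝ := fun _ => (σ, 0)

/-- The critical eigenfunction at `U_σ`: `(cos x / (2 - σ c₀ + α), cos x)`. -/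
def criticalMode (c₀ α σ : ℝ) : ℝ → ℂ × ℂ := fun x =>
  (((Real.cos x / (2 - σ * c₀ + α) : ℝ) : ℂ), ((Real.cos x : ℝ) : ℂ))

/-- `W` is an even `2π`-periodic equilibrium in the `δ`-neighbourhood (for the sup norm) of the
homogeneous state `U_σ`. -/
def IsNearbyEvenEquilibrium (c₀ α γ σ δ : ℝ) (W : ℝ → ℝ × ℝ) : Prop :=
  IsEquilibrium c₀ α γ W ∧ IsPeriodic W ∧ IsEven W ∧ ∀ x, ‖W x - homState σ x‖ < δ

end TuringPattern

end

noncomputable section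

namespace TuringPattern

/-! ### The oscillator `y + y''`, its Duhamel formula and the first cosine coefficient. -/

section Calculus

variable {F : Type} [NormedAddCommGroup F] [NormedSpace ℝ F] {y y₁ y₂ g : ℝ → F}

/-! The proof is a Lyapunov-Schmidt reduction carried out in the sup norm. Write an equilibrium as
`(σ + p, v)` and put `m = 1 - σ c₀ > 0`. Then `m p - p'' = v + O(p²)`, and `(1 + ∂ₓ²)² v = α v - v³
+ γ v (2σp + p²)`. Among even `2π`-periodic functions, `m - ∂ₓ²` is invertible and the kernel of `1
+ ∂ₓ²` is spanned by `cos`, so both equations become equations with bounded inverses in a Banach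
algebra, together with one scalar condition: the cosine coefficient of the second right-hand side
vanishes.

With `A` the cosine coefficient of `v`, substitute `p = A (cos / (2 - σ c₀) + A q)` and `v = A (cos
+ A w)`. The terms linear in `A` cancel, and since `cos²` has no first cosine coefficient the scalar
condition is `α = A² Φ`, where `Φ = 3/4` (the coefficient of `cos³`) at `A = γ = 0`
(`isEquilibrium_scaled_iff`). For `α = ε²` and `A = ε b` the limit problem has the nondegenerate
solution `b = 2/√3`, and the implicit function theorem in `(ε, γ)` gives the branch, local
uniqueness and Lipschitz dependence (`exists_branch`).

That uniqueness concerns the rescaled unknowns `(b, q, w)`. A priori estimates show that every small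
equilibrium with `A ≠ 0` has `(|A|/√α, q, w)` near the base point and has `α > 0`, and that `A = 0`
forces the homogeneous state (`exists_smallness`). The case `A < 0` is the shift by `π` of the case
`A > 0`. This yields the count of equilibria on both sides of `α = 0` (`exists_hasBranch`).

At the homogeneous state the linearization is triangular; the cosine mode carries the eigenvalue
`α`, and an energy estimate with a maximum principle excludes other eigenvalues near the closed
right half-plane (`isSimpleEigenvalue_homState`, `re_le_of_isEigenvalue_homState`). On the branch,
an eigenvalue with nonnegative real part would have an eigenfunction close to the critical mode,
hence equal `ε² - (9/4) A²` up to `O((ε + γ) ε²)` (`exists_eigenvalue_expansion`); as `A² ≥ ε²`,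
this is negative (`exists_stability`). -/

lemma hasDerivAt_of_contDiff_two (hy : ContDiff ℝ 2 y) (x : ℝ) : HasDerivAt y (deriv y x) x :=
  (hy.differentiable (by norm_num) x).hasDerivAt

lemma hasDerivAt_deriv_of_contDiff_two (hy : ContDiff ℝ 2 y) (x : ℝ) :
    HasDerivAt (deriv y) (iteratedDeriv 2 y x) x := by
  have h : ContDiff ℝ 1 (deriv y) :=
    (contDiff_succ_iff_deriv.1 (show ContDiff ℝ (1 + 1) y by simpa [one_add_one_eq_two] using hy)).2.2
  rw [iteratedDeriv_succ, iteratedDeriv_one]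
  exact (h.differentiable (by norm_num) x).hasDerivAt

lemma continuous_iteratedDeriv_two (hy : ContDiff ℝ 2 y) : Continuous (iteratedDeriv 2 y) :=
  hy.continuous_iteratedDeriv 2 le_rfl

lemma iteratedDeriv_two_of_hasDerivAt (h₁ : ∀ x, HasDerivAt y (y₁ x) x)
    (h₂ : ∀ x, HasDerivAt y₁ (y₂ x) x) : iteratedDeriv 2 y = y₂ := by
  rw [iteratedDeriv_succ, iteratedDeriv_one, show deriv y = y₁ from funext fun x => (h₁ x).deriv]
  exact funext fun x => (h₂ x).deriv

lemma contDiff_add_two_of_hasDerivAt {n : ℕ} (h₁ : ∀ x, HasDerivAt y (y₁ x) x)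
    (h₂ : ∀ x, HasDerivAt y₁ (y₂ x) x) (hc : ContDiff ℝ n y₂) : ContDiff ℝ (n + 2 : ℕ) y := by
  have e₁ : deriv y = y₁ := funext fun x => (h₁ x).deriv
  have e₂ : deriv y₁ = y₂ := funext fun x => (h₂ x).deriv
  have h3 : ContDiff ℝ (n + 1) y₁ := contDiff_succ_iff_deriv.2
    ⟨fun x => (h₂ x).differentiableAt, by simp, by rwa [e₂]⟩
  have h4 : ContDiff ℝ ((n + 1 : ℕ) + 1) y := contDiff_succ_iff_deriv.2
    ⟨fun x => (h₁ x).differentiableAt, by simp, by rw [e₁]; exact_mod_cast h3⟩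
  exact_mod_cast h4

lemma contDiff_two_of_hasDerivAt (h₁ : ∀ x, HasDerivAt y (y₁ x) x)
    (h₂ : ∀ x, HasDerivAt y₁ (y₂ x) x) (hc : Continuous y₂) : ContDiff ℝ 2 y :=
  contDiff_add_two_of_hasDerivAt (n := 0) h₁ h₂ (by simpa using (contDiff_zero (𝕜 := ℝ)).2 hc)

lemma contDiff_add_two_of_iteratedDeriv {n : ℕ} (hy : ContDiff ℝ 2 y)
    (h : ContDiff ℝ n (iteratedDeriv 2 y)) : ContDiff ℝ (n + 2 : ℕ) y :=
  contDiff_add_two_of_hasDerivAt (hasDerivAt_of_contDiff_two hy)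
    (hasDerivAt_deriv_of_contDiff_two hy) h

lemma IsPeriodic.deriv (hy : IsPeriodic y) : IsPeriodic (deriv y) := fun x => by
  rw [← deriv_comp_add_const (f := y), show (fun x => y (x + 2 * Real.pi)) = y from funext hy]

lemma IsPeriodic.iteratedDeriv (hy : IsPeriodic y) (n : ℕ) : IsPeriodic (iteratedDeriv n y) := by
  induction n with
  | zero => simpa using hy
  | succ k ih => rw [iteratedDeriv_succ]; exact ih.deriv

lemma IsEven.deriv_zero (hy : IsEven y) : deriv y 0 = 0 := by
  have h := deriv_comp_neg (f := y) (x := 0)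
  rw [show (fun x => y (-x)) = y from funext hy, neg_zero] at h
  have h2 : (2 : ℝ) • deriv y 0 = 0 := by
    rw [two_smul]; nth_rewrite 1 [h]; simp
  simpa using h2

lemma IsEven.iteratedDeriv_two (hy : IsEven y) : IsEven (iteratedDeriv 2 y) := fun x => by
  have h := iteratedDeriv_comp_neg (𝕜 := ℝ) 2 y x
  rw [show (fun x => y (-x)) = y from funext hy] at h
  simpa using h.symm

/-- The function `v + v''`. -/
def oscillator (y : ℝ → F) (x : ℝ) : F := y x + iteratedDeriv 2 y x

lemma oscillator_contDiff_two (hy : ContDiff ℝ 4 y) : ContDiff ℝ 2 (oscillator y) := by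
  refine (hy.of_le (by norm_num)).add ?_
  exact hy.iterate_deriv' 2 2 |> fun h => by simpa [iteratedDeriv_eq_iterate] using h

lemma iteratedDeriv_iteratedDeriv_two (y : ℝ → F) :
    iteratedDeriv 2 (iteratedDeriv 2 y) = iteratedDeriv 4 y := by
  simp [iteratedDeriv_eq_iterate]

lemma contDiff_two_iteratedDeriv_two (hy : ContDiff ℝ 4 y) : ContDiff ℝ 2 (iteratedDeriv 2 y) :=
  hy.iterate_deriv' 2 2 |> fun h => by simpa [iteratedDeriv_eq_iterate] using h

lemma oscillator_oscillator (hy : ContDiff ℝ 4 y) (x : ℝ) : oscillator (oscillator y) x =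
    y x + (2 : ℝ) • iteratedDeriv 2 y x + iteratedDeriv 4 y x := by
  have h : iteratedDeriv 2 (oscillator y) x = iteratedDeriv 2 y x + iteratedDeriv 4 y x := by
    rw [← iteratedDeriv_iteratedDeriv_two]
    exact iteratedDeriv_fun_add (hy.of_le (by norm_num)).contDiffAt
      (contDiff_two_iteratedDeriv_two hy).contDiffAt
  rw [oscillator, h, oscillator]
  module

lemma contDiff_four_of_oscillator (hy : ContDiff ℝ 2 y) (h : ContDiff ℝ 2 (oscillator y)) :
    ContDiff ℝ 4 y := by
  refine contDiff_add_two_of_iteratedDeriv (n := 2) hy ?_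
  have : iteratedDeriv 2 y = fun x => oscillator y x - y x := by
    funext x; simp [oscillator]
  rw [this]; exact h.sub hy

lemma continuous_oscillator (hy : ContDiff ℝ 2 y) : Continuous (oscillator y) :=
  hy.continuous.add (continuous_iteratedDeriv_two hy)

lemma IsPeriodic.oscillator (hy : IsPeriodic y) : IsPeriodic (oscillator y) := fun x => by
  simp [TuringPattern.oscillator, hy x, hy.iteratedDeriv 2 x]

lemma IsEven.oscillator (hy : IsEven y) : IsEven (oscillator y) := fun x => by
  simp [TuringPattern.oscillator, hy x, hy.iteratedDeriv_two x]

/-- The first cosine Fourier coefficient. -/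
def cosCoeff (f : ℝ → F) : F := (1 / Real.pi) • ∫ x in (0 : ℝ)..2 * Real.pi, Real.cos x • f x

lemma continuous_cos_smul (hg : Continuous g) : Continuous fun s => Real.cos s • g s :=
  Real.continuous_cos.smul hg

lemma continuous_sin_smul (hg : Continuous g) : Continuous fun s => Real.sin s • g s :=
  Real.continuous_sin.smul hg

/-- The solution of `y'' + y = g` with vanishing Cauchy data at `0`. -/
def duhamel (g : ℝ → F) (x : ℝ) : F :=
  Real.sin x • (∫ s in (0 : ℝ)..x, Real.cos s • g s) -
    Real.cos x • ∫ s in (0 : ℝ)..x, Real.sin s • g s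

lemma integral_add_period {f : ℝ → F} (hf : IsPeriodic f) (t : ℝ) :
    ∫ s in t..t + 2 * Real.pi, f s = ∫ s in (0 : ℝ)..2 * Real.pi, f s := by
  simpa using Function.Periodic.intervalIntegral_add_eq hf t 0

lemma IsPeriodic.cos_smul (hg : IsPeriodic g) : IsPeriodic fun x => Real.cos x • g x := fun x => by
  simp [hg x]

lemma IsPeriodic.sin_smul (hg : IsPeriodic g) : IsPeriodic fun x => Real.sin x • g x := fun x => by
  simp [hg x]

lemma integral_sin_smul_eq_zero (hp : IsPeriodic g) (he : IsEven g) :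
    ∫ s in (0 : ℝ)..2 * Real.pi, Real.sin s • g s = 0 := by
  have h := integral_add_period hp.sin_smul (-Real.pi)
  rw [← h, show -Real.pi + 2 * Real.pi = Real.pi by ring]
  have h2 := intervalIntegral.integral_comp_neg (a := -Real.pi) (b := Real.pi)
    (fun s => Real.sin s • g s)
  simp only [Real.sin_neg, neg_neg, he _, neg_smul, intervalIntegral.integral_neg] at h2
  have h3 : (2 : ℝ) • ∫ s in -Real.pi..Real.pi, Real.sin s • g s = 0 := by
    rw [two_smul]; nth_rewrite 1 [← h2]; exact neg_add_cancel _
  simpa using h3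

lemma duhamel_even (he : IsEven g) : IsEven (duhamel g) := fun x => by
  have h1 := intervalIntegral.integral_comp_neg (a := 0) (b := x) (fun s => Real.sin s • g s)
  have h2 := intervalIntegral.integral_comp_neg (a := 0) (b := x) (fun s => Real.cos s • g s)
  simp only [Real.sin_neg, Real.cos_neg, neg_zero, he _, neg_smul,
    intervalIntegral.integral_neg] at h1 h2
  rw [intervalIntegral.integral_symm 0 (-x)] at h1 h2
  simp only [duhamel, Real.sin_neg, Real.cos_neg]
  rw [h2, neg_inj.1 h1]
  simp

/-- The Fredholm condition: over one period the two integrals in the Duhamel formula change by the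
cosine and sine moments of `g`. The first vanishes by hypothesis, the second by evenness. -/
lemma duhamel_periodic (hg : Continuous g) (hp : IsPeriodic g) (he : IsEven g)
    (h0 : cosCoeff g = 0) : IsPeriodic (duhamel g) := fun x => by
  have h0' : ∫ s in (0 : ℝ)..2 * Real.pi, Real.cos s • g s = 0 := by
    simpa [cosCoeff, Real.pi_ne_zero] using h0
  have key : ∀ {f : ℝ → F}, Continuous f → IsPeriodic f → ∫ s in (0 : ℝ)..2 * Real.pi, f s = 0 →
      ∫ s in (0 : ℝ)..x + 2 * Real.pi, f s = ∫ s in (0 : ℝ)..x, f s := by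
    intro f hf hfp hf0
    rw [← intervalIntegral.integral_add_adjacent_intervals (b := x)
      (hf.intervalIntegrable _ _) (hf.intervalIntegrable _ _), integral_add_period hfp, hf0, add_zero]
  rw [duhamel, key (continuous_cos_smul hg) hp.cos_smul h0',
    key (continuous_sin_smul hg) hp.sin_smul (integral_sin_smul_eq_zero hp he)]
  simp [duhamel]

lemma IsPeriodic.exists_mem_Icc {E : Type} {f : ℝ → E} (hf : IsPeriodic f) (x : ℝ) :
    ∃ t ∈ Set.Icc (0 : ℝ) (2 * Real.pi), f x = f t := by
  obtain ⟨t, ht, h⟩ := Function.Periodic.exists_mem_Ico₀ hf Real.two_pi_pos x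
  exact ⟨t, ⟨ht.1, ht.2.le⟩, h⟩

/-- The bound is by the `L¹` norm, so that it serves both sup-norm estimates and, after
Cauchy-Schwarz, `L²` energy estimates. -/
lemma norm_duhamel_le (hg : Continuous g) {x : ℝ} (hx : x ∈ Set.Icc (0 : ℝ) (2 * Real.pi)) :
    ‖duhamel g x‖ ≤ 2 * ∫ s in (0 : ℝ)..2 * Real.pi, ‖g s‖ := by
  have key : ∀ {k : ℝ → ℝ}, Continuous k → (∀ s, |k s| ≤ 1) →
      ‖∫ s in (0 : ℝ)..x, k s • g s‖ ≤ ∫ s in (0 : ℝ)..2 * Real.pi, ‖g s‖ := by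
    intro k hk hk1
    calc ‖∫ s in (0 : ℝ)..x, k s • g s‖ ≤ ∫ s in (0 : ℝ)..x, ‖k s • g s‖ :=
          intervalIntegral.norm_integral_le_integral_norm hx.1
      _ ≤ ∫ s in (0 : ℝ)..x, ‖g s‖ := by
          refine intervalIntegral.integral_mono_on hx.1 ((hk.smul hg).norm.intervalIntegrable _ _)
            (hg.norm.intervalIntegrable _ _) fun s _ => ?_
          rw [norm_smul]
          exact mul_le_of_le_one_left (norm_nonneg _) (hk1 s)
      _ ≤ _ := intervalIntegral.integral_mono_interval le_rfl hx.1 hx.2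
          (Filter.Eventually.of_forall fun s => norm_nonneg _) (hg.norm.intervalIntegrable _ _)
  have h1 := key Real.continuous_cos Real.abs_cos_le_one
  have h2 := key Real.continuous_sin Real.abs_sin_le_one
  rw [duhamel, two_mul]
  refine (norm_sub_le _ _).trans (add_le_add ?_ ?_)
  · rw [norm_smul]
    exact (mul_le_of_le_one_left (norm_nonneg _) (Real.abs_sin_le_one x)).trans h1
  · rw [norm_smul]
    exact (mul_le_of_le_one_left (norm_nonneg _) (Real.abs_cos_le_one x)).trans h2

lemma norm_cosCoeff_le {f : ℝ → F} {M : ℝ}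
    (hM : ∀ x ∈ Set.Icc (0 : ℝ) (2 * Real.pi), ‖f x‖ ≤ M) : ‖cosCoeff f‖ ≤ 2 * M := by
  have h := intervalIntegral.norm_integral_le_of_norm_le_const (a := 0) (b := 2 * Real.pi)
    (f := fun x => Real.cos x • f x) (C := M) fun x hx => by
      rw [Set.uIoc_of_le Real.two_pi_pos.le] at hx
      rw [norm_smul]
      exact (mul_le_of_le_one_left (norm_nonneg _) (Real.abs_cos_le_one x)).trans
        (hM x ⟨hx.1.le, hx.2⟩)
  have hp := Real.pi_pos
  rw [cosCoeff, norm_smul, Real.norm_of_nonneg (by positivity)]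
  rw [sub_zero, abs_of_pos Real.two_pi_pos] at h
  calc _ ≤ 1 / Real.pi * (M * (2 * Real.pi)) := by gcongr
    _ = _ := by field_simp

lemma cosCoeff_add {f g : ℝ → F} (hf : Continuous f) (hg : Continuous g) :
    cosCoeff (fun x => f x + g x) = cosCoeff f + cosCoeff g := by
  simp only [cosCoeff, smul_add]
  rw [intervalIntegral.integral_add, smul_add]
  exacts [(continuous_cos_smul hf).intervalIntegrable _ _,
    (continuous_cos_smul hg).intervalIntegrable _ _]

lemma cosCoeff_sub {f g : ℝ → F} (hf : Continuous f) (hg : Continuous g) :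
    cosCoeff (fun x => f x - g x) = cosCoeff f - cosCoeff g := by
  simp only [cosCoeff, smul_sub]
  rw [intervalIntegral.integral_sub, smul_sub]
  exacts [(continuous_cos_smul hf).intervalIntegrable _ _,
    (continuous_cos_smul hg).intervalIntegrable _ _]

lemma cosCoeff_smul {𝕜 : Type} [NontriviallyNormedField 𝕜] [NormedSpace 𝕜 F] [SMulCommClass ℝ 𝕜 F]
    (c : 𝕜) (f : ℝ → F) : cosCoeff (fun x => c • f x) = c • cosCoeff f := by
  simp only [cosCoeff, smul_comm _ c, intervalIntegral.integral_smul]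

lemma cosCoeff_shift {f : ℝ → F} (hp : IsPeriodic f) :
    cosCoeff (fun x => f (x + Real.pi)) = -cosCoeff f := by
  have h := intervalIntegral.integral_comp_add_right (a := 0) (b := 2 * Real.pi)
    (fun x => Real.cos x • f x) Real.pi
  simp only [Real.cos_add_pi, neg_smul, intervalIntegral.integral_neg, zero_add] at h
  rw [add_comm (2 * Real.pi), integral_add_period hp.cos_smul] at h
  rw [cosCoeff, cosCoeff, ← h]; simp

variable [CompleteSpace F]

/-- Variation of constants: both integrands are exact derivatives, and the `sin` term of the
homogeneous solution is absent because an even function has zero derivative at `0`. -/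
lemma eq_add_duhamel (hy : ContDiff ℝ 2 y) (he : IsEven y) (x : ℝ) :
    y x = Real.cos x • y 0 + duhamel (oscillator y) x := by
  have hd := hasDerivAt_of_contDiff_two hy
  have hdd := hasDerivAt_deriv_of_contDiff_two hy
  have hc := continuous_oscillator hy
  have h1 : ∫ s in (0 : ℝ)..x, Real.cos s • oscillator y s =
      (Real.cos x • deriv y x + Real.sin x • y x) -
        (Real.cos 0 • deriv y 0 + Real.sin 0 • y 0) := by
    refine intervalIntegral.integral_eq_sub_of_hasDerivAt
      (f := fun s => Real.cos s • deriv y s + Real.sin s • y s) (fun s _ => ?_)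
      ((continuous_cos_smul hc).intervalIntegrable _ _)
    refine (((Real.hasDerivAt_cos s).smul (hdd s)).add
      ((Real.hasDerivAt_sin s).smul (hd s))).congr_deriv ?_
    simp only [oscillator]; module
  have h2 : ∫ s in (0 : ℝ)..x, Real.sin s • oscillator y s =
      (Real.sin x • deriv y x - Real.cos x • y x) -
        (Real.sin 0 • deriv y 0 - Real.cos 0 • y 0) := by
    refine intervalIntegral.integral_eq_sub_of_hasDerivAt
      (f := fun s => Real.sin s • deriv y s - Real.cos s • y s) (fun s _ => ?_)
      ((continuous_sin_smul hc).intervalIntegrable _ _)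
    refine (((Real.hasDerivAt_sin s).smul (hdd s)).sub
      ((Real.hasDerivAt_cos s).smul (hd s))).congr_deriv ?_
    simp only [oscillator]; module
  rw [duhamel, h1, h2, he.deriv_zero, Real.sin_zero, Real.cos_zero]
  have := Real.sin_sq_add_cos_sq x
  have h3 : y x = (Real.sin x ^ 2 + Real.cos x ^ 2) • y x := by rw [this, one_smul]
  nth_rewrite 1 [h3]
  module

lemma hasDerivAt_integral_smul {k : ℝ → ℝ} (hk : Continuous k) (hg : Continuous g) (x : ℝ) :
    HasDerivAt (fun x => ∫ s in (0 : ℝ)..x, k s • g s) (k x • g x) x :=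
  (hk.smul hg).integral_hasStrictDerivAt 0 x |>.hasDerivAt

lemma hasDerivAt_duhamel (hg : Continuous g) (x : ℝ) : HasDerivAt (duhamel g)
    (Real.cos x • (∫ s in (0 : ℝ)..x, Real.cos s • g s) +
      Real.sin x • ∫ s in (0 : ℝ)..x, Real.sin s • g s) x := by
  have h1 := hasDerivAt_integral_smul Real.continuous_cos hg x
  have h2 := hasDerivAt_integral_smul Real.continuous_sin hg x
  refine (((Real.hasDerivAt_sin x).smul h1).sub ((Real.hasDerivAt_cos x).smul h2)).congr_deriv ?_
  module

lemma hasDerivAt_deriv_duhamel (hg : Continuous g) (x : ℝ) : HasDerivAt (fun x =>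
    (Real.cos x • (∫ s in (0 : ℝ)..x, Real.cos s • g s) +
      Real.sin x • ∫ s in (0 : ℝ)..x, Real.sin s • g s)) (g x - duhamel g x) x := by
  have h1 := hasDerivAt_integral_smul Real.continuous_cos hg x
  have h2 := hasDerivAt_integral_smul Real.continuous_sin hg x
  refine (((Real.hasDerivAt_cos x).smul h1).add ((Real.hasDerivAt_sin x).smul h2)).congr_deriv ?_
  have h3 : g x = (Real.sin x ^ 2 + Real.cos x ^ 2) • g x := by
    rw [Real.sin_sq_add_cos_sq, one_smul]
  nth_rewrite 3 [h3]
  simp only [duhamel]; module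

lemma continuous_duhamel (hg : Continuous g) : Continuous (duhamel g) :=
  continuous_iff_continuousAt.2 fun x => (hasDerivAt_duhamel hg x).continuousAt

lemma contDiff_two_duhamel (hg : Continuous g) : ContDiff ℝ 2 (duhamel g) :=
  contDiff_two_of_hasDerivAt (hasDerivAt_duhamel hg) (hasDerivAt_deriv_duhamel hg)
    (hg.sub (continuous_duhamel hg))

lemma oscillator_duhamel (hg : Continuous g) : oscillator (duhamel g) = g := by
  funext x
  rw [oscillator, iteratedDeriv_two_of_hasDerivAt (hasDerivAt_duhamel hg)
    (hasDerivAt_deriv_duhamel hg)]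
  simp

lemma cosCoeff_smul_const {k : ℝ → ℝ} (v : F) : cosCoeff (fun x => k x • v) = cosCoeff k • v := by
  simp only [cosCoeff, ← smul_assoc, smul_eq_mul]
  rw [intervalIntegral.integral_smul_const, smul_smul]

lemma cosCoeff_cos : cosCoeff Real.cos = 1 := by
  have := Real.pi_ne_zero
  simp only [cosCoeff, smul_eq_mul, ← pow_two]
  simp [integral_cos_sq]

lemma cosCoeff_cos_sq : cosCoeff (fun x => Real.cos x ^ 2) = 0 := by
  have h : ∫ x in (0 : ℝ)..2 * Real.pi, Real.cos x * Real.cos x ^ 2 = 0 := by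
    simp only [← pow_succ']
    simp [integral_cos_pow_three]
  simp [cosCoeff, h]

lemma cosCoeff_cos_cube : cosCoeff (fun x => Real.cos x ^ 3) = 3 / 4 := by
  have h : ∫ x in (0 : ℝ)..2 * Real.pi, Real.cos x * Real.cos x ^ 3 = 3 / 4 * Real.pi := by
    simp only [← pow_succ']
    rw [show 3 + 1 = 2 + 2 by norm_num, integral_cos_pow]
    simp [integral_cos_sq]; ring
  have := Real.pi_ne_zero
  simp only [cosCoeff, smul_eq_mul, h]; field_simp

/-- Only the multiple `y 0` of `cos` is not controlled by the Duhamel term. Vanishing of the cosine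
coefficient fixes it as minus the coefficient of the Duhamel term, at most `4 I`; adding the `2 I`
of the Duhamel term itself gives the factor `6`. -/
lemma norm_le_integral_norm_oscillator (hy : ContDiff ℝ 2 y) (hp : IsPeriodic y) (he : IsEven y)
    (h0 : cosCoeff y = 0) (x : ℝ) :
    ‖y x‖ ≤ 6 * ∫ s in (0 : ℝ)..2 * Real.pi, ‖oscillator y s‖ := by
  have hc := continuous_oscillator hy
  set I := ∫ s in (0 : ℝ)..2 * Real.pi, ‖oscillator y s‖
  have hr := fun x hx => norm_duhamel_le (g := oscillator y) (x := x) hc hx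
  have h1 : cosCoeff y = y 0 + cosCoeff (duhamel (oscillator y)) := by
    conv_lhs => rw [show y = fun x => Real.cos x • y 0 + duhamel (oscillator y) x from
      funext (eq_add_duhamel hy he)]
    rw [cosCoeff_add (by fun_prop) (continuous_duhamel hc), cosCoeff_smul_const, cosCoeff_cos,
      one_smul]
  have h2 : ‖y 0‖ ≤ 2 * (2 * I) := by
    rw [show y 0 = -cosCoeff (duhamel (oscillator y)) from
      eq_neg_of_add_eq_zero_left (h1.symm.trans h0), norm_neg]
    exact norm_cosCoeff_le hr
  obtain ⟨t, ht, hxt⟩ := hp.exists_mem_Icc x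
  rw [hxt, eq_add_duhamel hy he t]
  calc _ ≤ ‖Real.cos t • y 0‖ + ‖duhamel (oscillator y) t‖ := norm_add_le _ _
    _ ≤ ‖y 0‖ + 2 * I := by
        refine add_le_add ?_ (hr t ht)
        rw [norm_smul]
        exact mul_le_of_le_one_left (norm_nonneg _) (Real.abs_cos_le_one t)
    _ ≤ _ := by linarith

/-- The range of `1 + ∂ₓ²` is orthogonal to its kernel: `cos (y + y'')` is the derivative of the
periodic function `cos y' + sin y`. -/
lemma cosCoeff_oscillator (hy : ContDiff ℝ 2 y) (hp : IsPeriodic y) :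
    cosCoeff (oscillator y) = 0 := by
  have hd := hasDerivAt_of_contDiff_two hy
  have hdd := hasDerivAt_deriv_of_contDiff_two hy
  have : ∫ s in (0 : ℝ)..2 * Real.pi, Real.cos s • oscillator y s = 0 := by
    rw [intervalIntegral.integral_eq_sub_of_hasDerivAt
      (f := fun s => Real.cos s • deriv y s + Real.sin s • y s) (fun s _ => ?_)
      ((continuous_cos_smul (continuous_oscillator hy)).intervalIntegrable _ _)]
    · have h1 := hp.deriv 0
      rw [zero_add] at h1
      simp [h1]
    · refine (((Real.hasDerivAt_cos s).smul (hdd s)).add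
        ((Real.hasDerivAt_sin s).smul (hd s))).congr_deriv ?_
      simp only [oscillator]; module
  rw [cosCoeff, this, smul_zero]

end Calculus

/-! ### Self-adjointness of the oscillator and a maximum principle. -/

section InnerProduct

variable {F : Type} [NormedAddCommGroup F] [InnerProductSpace ℝ F] {y w : ℝ → F}

lemma integral_inner_oscillator (hy : ContDiff ℝ 2 y) (hw : ContDiff ℝ 2 w) (hyp : IsPeriodic y)
    (hwp : IsPeriodic w) : ∫ s in (0 : ℝ)..2 * Real.pi, inner ℝ (oscillator y s) (w s) =
      ∫ s in (0 : ℝ)..2 * Real.pi, inner ℝ (y s) (oscillator w s) := by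
  have c1 : Continuous fun s => inner ℝ (oscillator y s) (w s) :=
    (continuous_oscillator hy).inner hw.continuous
  have c2 : Continuous fun s => inner ℝ (y s) (oscillator w s) :=
    hy.continuous.inner (continuous_oscillator hw)
  rw [← sub_eq_zero, ← intervalIntegral.integral_sub (c1.intervalIntegrable _ _)
    (c2.intervalIntegrable _ _), intervalIntegral.integral_eq_sub_of_hasDerivAt
      (f := fun s => inner ℝ (deriv y s) (w s) - inner ℝ (y s) (deriv w s)) (fun s _ => ?_)
      ((show Continuous fun s => inner ℝ (oscillator y s) (w s) - inner ℝ (y s) (oscillator w s)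
      from c1.sub c2).intervalIntegrable _ _)]
  · have h1 := hyp 0
    have h2 := hwp 0
    have h3 := hyp.deriv 0
    have h4 := hwp.deriv 0
    rw [zero_add] at h1 h2 h3 h4
    simp [h1, h2, h3, h4]
  · refine ((((hasDerivAt_deriv_of_contDiff_two hy s).inner ℝ
      (hasDerivAt_of_contDiff_two hw s))).sub ((hasDerivAt_of_contDiff_two hy s).inner ℝ
      (hasDerivAt_deriv_of_contDiff_two hw s))).congr_deriv ?_
    simp only [oscillator, inner_add_left, inner_add_right]; ring

/-- A maximum principle for periodic solutions of `y'' = k y - f`. -/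
lemma norm_le_of_inner_iteratedDeriv_two {k M : ℝ} (hk : 0 < k) (hM : 0 ≤ M) (hy : ContDiff ℝ 2 y)
    (hyp : IsPeriodic y) (h : ∀ x, k * ‖y x‖ ^ 2 - M * ‖y x‖ ≤ inner ℝ (iteratedDeriv 2 y x) (y x))
    (x : ℝ) : ‖y x‖ ≤ M / k := by
  obtain ⟨x₀, -, hx₀⟩ := (isCompact_Icc (a := (0 : ℝ)) (b := 2 * Real.pi)).exists_isMaxOn
    (Set.nonempty_Icc.2 Real.two_pi_pos.le) hy.continuous.norm.continuousOn
  have hmax : ∀ x, ‖y x‖ ≤ ‖y x₀‖ := fun x => by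
    obtain ⟨t, ht, hxt⟩ := hyp.exists_mem_Icc x
    rw [hxt]; exact hx₀ ht
  refine (hmax x).trans ?_
  by_contra! hlt
  have hpos : 0 < ‖y x₀‖ := lt_of_le_of_lt (by positivity) hlt
  have hlt' : M < ‖y x₀‖ * k := (div_lt_iff₀ hk).1 hlt
  have hin : 0 < inner ℝ (iteratedDeriv 2 y x₀) (y x₀) :=
    lt_of_lt_of_le (by nlinarith) (h x₀)
  have hd1 : ∀ x, HasDerivAt (fun x => inner ℝ (y x) (y x)) (2 * inner ℝ (deriv y x) (y x)) x :=
    fun x => ((hasDerivAt_of_contDiff_two hy x).inner ℝ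
      (hasDerivAt_of_contDiff_two hy x)).congr_deriv (by rw [real_inner_comm]; ring)
  have hd2 : ∀ x, HasDerivAt (fun x => 2 * inner ℝ (deriv y x) (y x))
      (2 * (inner ℝ (iteratedDeriv 2 y x) (y x) + ‖deriv y x‖ ^ 2)) x := fun x =>
    (((hasDerivAt_deriv_of_contDiff_two hy x).inner ℝ
      (hasDerivAt_of_contDiff_two hy x)).const_mul 2).congr_deriv
        (by rw [← real_inner_self_eq_norm_sq]; ring)
  have e1 : deriv (fun x => inner ℝ (y x) (y x)) = fun x => 2 * inner ℝ (deriv y x) (y x) :=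
    funext fun x => (hd1 x).deriv
  have hlm : IsLocalMax (fun x => inner ℝ (y x) (y x)) x₀ := Filter.Eventually.of_forall fun x => by
    simp only [real_inner_self_eq_norm_sq]
    gcongr
    exact hmax x
  have hpos2 : 0 < 2 * (inner ℝ (iteratedDeriv 2 y x₀) (y x₀) + ‖deriv y x₀‖ ^ 2) := by positivity
  -- A maximum with positive second derivative is also a local minimum, so `‖y‖²` is locally
  -- constant there and its second derivative vanishes, a contradiction.
  have hlmin : IsLocalMin (fun x => inner ℝ (y x) (y x)) x₀ :=
    isLocalMin_of_deriv_deriv_pos (by rw [e1, (hd2 x₀).deriv]; exact hpos2) hlm.deriv_eq_zero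
      (hd1 x₀).continuousAt
  have hconst : (fun x => inner ℝ (y x) (y x)) =ᶠ[nhds x₀] fun _ => inner ℝ (y x₀) (y x₀) := by
    filter_upwards [hlm, hlmin] with x a b using le_antisymm a b
  have h2 := hconst.deriv.deriv_eq
  rw [e1, (hd2 x₀).deriv] at h2
  simp at h2
  linarith

end InnerProduct

/-! ### The Banach algebra of even periodic functions and the two inverse operators. -/

section Operators

/-- A linear relation that is total and bounded is the graph of a bounded operator; the bound
applied to a difference gives uniqueness. Both inverses are built this way, so that the differential
equation characterizes them in both directions. -/
lemma exists_clm_of_relation {E : Type} [NormedAddCommGroup E] [NormedSpace ℝ E]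
    (R : E → E → Prop) (hadd : ∀ g y g' y', R g y → R g' y' → R (g + g') (y + y'))
    (hsmul : ∀ (c : ℝ) g y, R g y → R (c • g) (c • y)) (hex : ∀ g, ∃ y, R g y) {C : ℝ}
    (hC : ∀ g y, R g y → ‖y‖ ≤ C * ‖g‖) :
    ∃ T : E →L[ℝ] E, ∀ g y, R g y ↔ y = T g := by
  have huniq : ∀ g y y', R g y → R g y' → y = y' := fun g y y' h h' => by
    have h2 := hC _ _ (hadd _ _ _ _ h (hsmul (-1) _ _ h'))
    rw [neg_one_smul, neg_one_smul, add_neg_cancel, norm_zero, mul_zero] at h2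
    rw [← sub_eq_zero, sub_eq_add_neg]
    exact norm_le_zero_iff.1 h2
  choose T hT using hex
  let L : E →ₗ[ℝ] E :=
    { toFun := T
      map_add' := fun a b => huniq _ _ _ (hT _) (hadd _ _ _ _ (hT a) (hT b))
      map_smul' := fun c a => huniq _ _ _ (hT _) (hsmul c _ _ (hT a)) }
  exact ⟨L.mkContinuous C fun g => hC _ _ (hT g), fun g y =>
    ⟨fun h => huniq _ _ _ h (hT g), fun h => h ▸ hT g⟩⟩

open BoundedContinuousFunction

/-- The even, `2π`-periodic functions among the bounded continuous ones. -/
def evenPeriodic : Subalgebra ℝ (ℝ →ᵇ ℝ) where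
  carrier := {f | IsPeriodic f ∧ IsEven f}
  mul_mem' := fun ha hb => ⟨fun x => by simp [ha.1 x, hb.1 x], fun x => by simp [ha.2 x, hb.2 x]⟩
  add_mem' := fun ha hb => ⟨fun x => by simp [ha.1 x, hb.1 x], fun x => by simp [ha.2 x, hb.2 x]⟩
  algebraMap_mem' := fun r => ⟨fun x => rfl, fun x => rfl⟩

/-- The Banach algebra of even, `2π`-periodic continuous functions. -/
def EvenPer : Type := evenPeriodic

instance : NormedCommRing EvenPer := inferInstanceAs (NormedCommRing evenPeriodic)

instance : NormedAlgebra ℝ EvenPer := inferInstanceAs (NormedAlgebra ℝ evenPeriodic)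

/-- The underlying bounded continuous function. -/
def EvenPer.toBounded (f : EvenPer) : ℝ →ᵇ ℝ := Subtype.val (p := (· ∈ evenPeriodic)) f

instance : CoeFun EvenPer fun _ => ℝ → ℝ := ⟨fun f => f.toBounded⟩

namespace EvenPer

lemma isClosed_evenPeriodic : IsClosed (evenPeriodic : Set (ℝ →ᵇ ℝ)) := by
  have : (evenPeriodic : Set (ℝ →ᵇ ℝ)) =
      (⋂ x : ℝ, {f | f (x + 2 * Real.pi) = f x}) ∩ ⋂ x : ℝ, {f | f (-x) = f x} := by
    ext f; simp [evenPeriodic, IsPeriodic, IsEven]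
  rw [this]
  exact (isClosed_iInter fun x => isClosed_eq (continuous_eval_const _) (continuous_eval_const _)).inter
    (isClosed_iInter fun x => isClosed_eq (continuous_eval_const _) (continuous_eval_const _))

instance : CompleteSpace EvenPer :=
  isClosed_evenPeriodic.completeSpace_coe (s := (evenPeriodic : Set (ℝ →ᵇ ℝ)))

variable (f g : EvenPer)

lemma continuous : Continuous f := f.toBounded.continuous
lemma periodic : IsPeriodic f := f.2.1
lemma even : IsEven f := f.2.2

@[ext] lemma ext {f g : EvenPer} (h : ∀ x, f x = g x) : f = g :=
  Subtype.ext (BoundedContinuousFunction.ext h)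

@[simp] lemma add_apply (x : ℝ) : (f + g) x = f x + g x := rfl
@[simp] lemma sub_apply (x : ℝ) : (f - g) x = f x - g x := rfl
@[simp] lemma mul_apply (x : ℝ) : (f * g) x = f x * g x := rfl
@[simp] lemma zero_apply (x : ℝ) : (0 : EvenPer) x = 0 := rfl
@[simp] lemma smul_apply (c x : ℝ) : (c • f) x = c * f x := rfl
@[simp] lemma pow_apply (n : ℕ) (x : ℝ) : (f ^ n) x = f x ^ n := rfl

lemma abs_apply_le (x : ℝ) : |f x| ≤ ‖f‖ := f.toBounded.norm_coe_le_norm x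

lemma norm_le_of_forall {f : EvenPer} {C : ℝ} (hC : 0 ≤ C) (h : ∀ x, |f x| ≤ C) : ‖f‖ ≤ C :=
  (BoundedContinuousFunction.norm_le hC).2 h

lemma exists_eq {f : ℝ → ℝ} (hc : Continuous f) (hp : IsPeriodic f) (he : IsEven f) :
    ∃ F : EvenPer, (F : ℝ → ℝ) = f := by
  obtain ⟨C, hC⟩ := (isCompact_Icc (a := (0 : ℝ)) (b := 2 * Real.pi)).exists_bound_of_continuousOn
    hc.continuousOn
  refine ⟨⟨ofNormedAddCommGroup f hc C fun x => ?_, hp, he⟩, rfl⟩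
  obtain ⟨t, ht, h⟩ := hp.exists_mem_Icc x
  rw [h]; exact hC t ht

/-- The cosine as an element of the algebra. -/
def cosine : EvenPer :=
  ⟨ofNormedAddCommGroup Real.cos Real.continuous_cos 1 Real.abs_cos_le_one,
    Real.cos_add_two_pi, Real.cos_neg⟩

@[simp] lemma cosine_apply (x : ℝ) : cosine x = Real.cos x := rfl

lemma norm_cosine_le : ‖cosine‖ ≤ 1 := norm_le_of_forall zero_le_one Real.abs_cos_le_one

/-- The first cosine coefficient as a bounded functional. -/
def coeff : EvenPer →L[ℝ] ℝ :=
  LinearMap.mkContinuous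
    { toFun := fun f : EvenPer => cosCoeff (f : ℝ → ℝ)
      map_add' := fun f g => cosCoeff_add f.continuous g.continuous
      map_smul' := fun c f => cosCoeff_smul (𝕜 := ℝ) c (f : ℝ → ℝ) } 2
    fun f => norm_cosCoeff_le fun x _ => f.abs_apply_le x

lemma coeff_apply : coeff f = cosCoeff f := rfl

lemma abs_coeff_le : |coeff f| ≤ 2 * ‖f‖ :=
  norm_cosCoeff_le (f := f) fun x _ => f.abs_apply_le x

lemma coeff_cosine : coeff cosine = 1 := cosCoeff_cos

lemma coeff_cosine_sq : coeff (cosine ^ 2) = 0 := cosCoeff_cos_sq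

lemma coeff_cosine_cube : coeff (cosine ^ 3) = 3 / 4 := cosCoeff_cos_cube

end EvenPer

open EvenPer

lemma oscillator_cos : oscillator Real.cos = 0 := by
  funext x; simp [oscillator]

lemma oscillator_add {F : Type} [NormedAddCommGroup F] [NormedSpace ℝ F] {y w : ℝ → F}
    (hy : ContDiff ℝ 2 y) (hw : ContDiff ℝ 2 w) :
    oscillator (fun x => y x + w x) = fun x => oscillator y x + oscillator w x := by
  funext x
  simp only [oscillator]
  rw [iteratedDeriv_fun_add hy.contDiffAt hw.contDiffAt]; abel

lemma oscillator_sub {F : Type} [NormedAddCommGroup F] [NormedSpace ℝ F] {y w : ℝ → F}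
    (hy : ContDiff ℝ 2 y) (hw : ContDiff ℝ 2 w) :
    oscillator (fun x => y x - w x) = fun x => oscillator y x - oscillator w x := by
  funext x
  simp only [oscillator]
  rw [iteratedDeriv_fun_sub hy.contDiffAt hw.contDiffAt]; abel

lemma iteratedDeriv_two_const_mul {y : ℝ → ℝ} (hy : ContDiff ℝ 2 y) (c : ℝ) :
    iteratedDeriv 2 (fun x => c * y x) = fun x => c * iteratedDeriv 2 y x :=
  iteratedDeriv_two_of_hasDerivAt (fun x => (hasDerivAt_of_contDiff_two hy x).const_mul c)
    fun x => (hasDerivAt_deriv_of_contDiff_two hy x).const_mul c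

lemma oscillator_const_mul {y : ℝ → ℝ} (hy : ContDiff ℝ 2 y) (c : ℝ) :
    oscillator (fun x => c * y x) = fun x => c * oscillator y x := by
  funext x
  simp only [oscillator]
  rw [iteratedDeriv_two_const_mul hy]; ring

/-- Project `g` off the cosine, solve by Duhamel, and remove the cosine part of the solution. The
constant is the `6` of `norm_le_integral_norm_oscillator`, times the period, times `3` from `|g -
coeff g cos| ≤ ‖g‖ + 2‖g‖`. -/
lemma exists_oscillator_inverse : ∃ S : EvenPer →L[ℝ] EvenPer, ∀ g y : EvenPer,
    (ContDiff ℝ 2 y ∧ (∀ x, oscillator y x = g x - coeff g * Real.cos x) ∧ coeff y = 0) ↔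
      y = S g := by
  refine exists_clm_of_relation (fun g y : EvenPer => ContDiff ℝ 2 y ∧
    (∀ x, oscillator y x = g x - coeff g * Real.cos x) ∧ coeff y = 0)
    ?_ ?_ (fun g => ?_) (C := 6 * (2 * Real.pi) * 3) fun g y h => ?_
  · rintro g y g' y' ⟨h1, h2, h3⟩ ⟨h1', h2', h3'⟩
    refine ⟨h1.add h1', fun x => ?_, by simp_all⟩
    refine (congr_fun (oscillator_add h1 h1') x).trans ?_
    simp only [h2, h2', map_add, EvenPer.add_apply]; ring
  · rintro c g y ⟨h1, h2, h3⟩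
    refine ⟨contDiff_const.mul h1, fun x => ?_, by simp_all⟩
    refine (congr_fun (oscillator_const_mul h1 c) x).trans ?_
    simp only [h2, map_smul, EvenPer.smul_apply, smul_eq_mul]; ring
  · obtain ⟨h, hh⟩ : ∃ h : EvenPer, h = g - coeff g • cosine := ⟨_, rfl⟩
    have h0 : cosCoeff h = 0 := by
      rw [← coeff_apply, hh]; simp [coeff_cosine]
    obtain ⟨r, hr⟩ := EvenPer.exists_eq (continuous_duhamel h.continuous)
      (duhamel_periodic h.continuous h.periodic h.even h0) (duhamel_even h.even)
    have hr2 : ContDiff ℝ 2 r := hr ▸ contDiff_two_duhamel h.continuous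
    have hcos : ContDiff ℝ 2 fun x => coeff r * Real.cos x := contDiff_const.mul Real.contDiff_cos
    refine ⟨r - coeff r • cosine, hr2.sub hcos, fun x => ?_, by simp [coeff_cosine]⟩
    refine (congr_fun (oscillator_sub hr2 hcos) x).trans ?_
    rw [oscillator_const_mul Real.contDiff_cos, oscillator_cos, hr,
      oscillator_duhamel h.continuous, hh]
    simp
  · obtain ⟨h1, h2, h3⟩ := h
    refine norm_le_of_forall (by positivity) fun x =>
      (norm_le_integral_norm_oscillator h1 y.periodic y.even h3 x).trans ?_
    have h4 : ∫ s in (0 : ℝ)..2 * Real.pi, ‖oscillator y s‖ ≤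
        ∫ s in (0 : ℝ)..2 * Real.pi, 3 * ‖g‖ := by
      refine intervalIntegral.integral_mono_on Real.two_pi_pos.le
        ((continuous_oscillator h1).norm.intervalIntegrable _ _)
        (continuous_const.intervalIntegrable _ _) fun s _ => ?_
      rw [h2 s, Real.norm_eq_abs]
      have := abs_sub (g s) (coeff g * Real.cos s)
      have h5 : |coeff g * Real.cos s| ≤ 2 * ‖g‖ := by
        rw [abs_mul]
        exact (mul_le_of_le_one_right (abs_nonneg _) (Real.abs_cos_le_one s)).trans
          (abs_coeff_le g)
      have := g.abs_apply_le s
      linarith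
    rw [intervalIntegral.integral_const, smul_eq_mul, sub_zero] at h4
    linarith

lemma exists_periodic_first_order {μ : ℝ} (hμ : 0 < μ) {f : ℝ → ℝ} (hf : Continuous f)
    (hp : IsPeriodic f) :
    ∃ y : ℝ → ℝ, (∀ x, HasDerivAt y (f x - μ * y x) x) ∧ IsPeriodic y := by
  have hk : Continuous fun s => Real.exp (μ * s) * f s := by fun_prop
  set I : ℝ → ℝ := fun x => ∫ s in (0 : ℝ)..x, Real.exp (μ * s) * f s
  have hI : ∀ x, HasDerivAt I (Real.exp (μ * x) * f x) x := fun x =>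
    (hk.integral_hasStrictDerivAt 0 x).hasDerivAt
  set T := 2 * Real.pi with hT
  have hT0 : 0 < T := Real.two_pi_pos
  have hE : 1 - Real.exp (-(μ * T)) ≠ 0 := by
    have : Real.exp (-(μ * T)) < 1 := Real.exp_lt_one_iff.2 (by nlinarith)
    linarith
  -- The initial value is the fixed point of the period map, which exists because `exp (-μT) < 1`.
  obtain ⟨c, hc⟩ : ∃ c, Real.exp (-(μ * T)) * (c + I T) = c :=
    ⟨Real.exp (-(μ * T)) * I T / (1 - Real.exp (-(μ * T))), by field_simp; ring⟩
  refine ⟨fun x => Real.exp (-(μ * x)) * (c + I x), fun x => ?_, fun x => ?_⟩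
  · have h1 : HasDerivAt (fun x => Real.exp (-(μ * x))) (Real.exp (-(μ * x)) * -(μ * 1)) x :=
      (((hasDerivAt_id x).const_mul μ).neg).exp
    refine (h1.mul ((hI x).const_add c)).congr_deriv ?_
    have : Real.exp (-(μ * x)) * Real.exp (μ * x) = 1 := by rw [← Real.exp_add]; simp
    linear_combination f x * this
  · have h1 : I (x + T) = I T + Real.exp (μ * T) * I x := by
      have h2 := intervalIntegral.integral_comp_add_right (a := 0) (b := x)
        (fun s => Real.exp (μ * s) * f s) T
      have h3 : ∀ s, Real.exp (μ * (s + T)) * f (s + T) =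
          Real.exp (μ * T) * (Real.exp (μ * s) * f s) := fun s => by
        rw [hp s, mul_add, Real.exp_add]; ring
      simp only [h3, intervalIntegral.integral_const_mul, zero_add] at h2
      simp only [I, h2]
      rw [intervalIntegral.integral_add_adjacent_intervals] <;>
        exact hk.intervalIntegrable _ _
    have h2 : Real.exp (-(μ * T)) * Real.exp (μ * T) = 1 := by rw [← Real.exp_add]; simp
    simp only
    rw [← hT, h1, mul_add μ, neg_add, Real.exp_add]
    linear_combination Real.exp (-(μ * x)) * hc + Real.exp (-(μ * x)) * I x * h2

/-- With `μ = √m`, factor `m - ∂ₓ² = (μ + ∂ₓ)(μ - ∂ₓ)`. If `y' + μ y = f` with `f` even, then `(y(x)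
+ y(-x)) / (2μ)` is an even solution of the second-order equation. The bound `1/m` is the maximum
principle. -/
lemma exists_screened_inverse {m : ℝ} (hm : 0 < m) :
    ∃ K : EvenPer →L[ℝ] EvenPer, ∀ f p : EvenPer,
      (ContDiff ℝ 2 p ∧ ∀ x, iteratedDeriv 2 p x = m * p x - f x) ↔ p = K f := by
  refine exists_clm_of_relation (fun f p : EvenPer => ContDiff ℝ 2 p ∧
    ∀ x, iteratedDeriv 2 p x = m * p x - f x) ?_ ?_ (fun f => ?_) (C := 1 / m) fun f p h => ?_
  · rintro g y g' y' ⟨h1, h2⟩ ⟨h1', h2'⟩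
    refine ⟨h1.add h1', fun x => ?_⟩
    refine (iteratedDeriv_fun_add h1.contDiffAt h1'.contDiffAt).trans ?_
    simp only [h2, h2', EvenPer.add_apply]; ring
  · rintro c g y ⟨h1, h2⟩
    refine ⟨contDiff_const.mul h1, fun x => ?_⟩
    refine (congr_fun (iteratedDeriv_two_const_mul h1 c) x).trans ?_
    simp only [h2, EvenPer.smul_apply]; ring
  · obtain ⟨y, hy, hyp⟩ := exists_periodic_first_order (Real.sqrt_pos.2 hm) f.continuous f.periodic
    set μ := Real.sqrt m
    have hμ : 0 < μ := Real.sqrt_pos.2 hm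
    have hμ2 : μ * μ = m := Real.mul_self_sqrt hm.le
    have hyn : ∀ x, HasDerivAt (fun x => y (-x)) (-(f x - μ * y (-x))) x := fun x => by
      have := (hy (-x)).comp x (hasDerivAt_neg x)
      rw [f.even x] at this
      exact this.congr_deriv (by ring)
    have hyc : Continuous y := continuous_iff_continuousAt.2 fun x => (hy x).continuousAt
    have hd1 : ∀ x, HasDerivAt (fun x => (y x + y (-x)) / (2 * μ)) ((-y x + y (-x)) / 2) x :=
      fun x => (((hy x).add (hyn x)).div_const (2 * μ)).congr_deriv (by field_simp; ring)
    have hd2 : ∀ x, HasDerivAt (fun x => (-y x + y (-x)) / 2)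
        (m * ((y x + y (-x)) / (2 * μ)) - f x) x :=
      fun x => (((hy x).neg.add (hyn x)).div_const 2).congr_deriv (by
        rw [← hμ2]; field_simp; ring)
    have hcont : Continuous fun x => (y x + y (-x)) / (2 * μ) := by fun_prop
    obtain ⟨p, hp⟩ := EvenPer.exists_eq hcont
      (fun x => by
        have h1 := hyp x
        have h2 := hyp (-(x + 2 * Real.pi))
        rw [show -(x + 2 * Real.pi) + 2 * Real.pi = -x by ring] at h2
        simp only [h1, h2])
      (fun x => by simp only [neg_neg]; rw [add_comm])
    refine ⟨p, ?_, fun x => ?_⟩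
    · simp only [hp]
      exact contDiff_two_of_hasDerivAt hd1 hd2 ((continuous_const.mul hcont).sub f.continuous)
    · simp only [hp]
      rw [iteratedDeriv_two_of_hasDerivAt hd1 hd2]
  · obtain ⟨h1, h2⟩ := h
    refine norm_le_of_forall (by positivity) fun x => ?_
    refine (norm_le_of_inner_iteratedDeriv_two hm (norm_nonneg f) h1 p.periodic (fun x => ?_)
      x).trans_eq (by ring)
    have h3 := f.abs_apply_le x
    have h4 : f x * p x ≤ ‖f‖ * |p x| := (le_abs_self _).trans (by
      rw [abs_mul]; gcongr)
    rw [h2, show inner ℝ (m * p x - f x) (p x) = p x * (m * p x - f x) from rfl,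
      Real.norm_eq_abs, sq_abs]
    linarith

end Operators

/-! ### Lyapunov-Schmidt reduction and rescaling by the amplitude. -/

section Reduction

open EvenPer

/-- The inverse of `∂ₓ² + 1` on even periodic functions orthogonal to `cos`, composed with the
projection onto these functions. -/
def oscInv : EvenPer →L[ℝ] EvenPer := exists_oscillator_inverse.choose

lemma eq_oscInv_iff {g y : EvenPer} : y = oscInv g ↔ ContDiff ℝ 2 y ∧
    (∀ x, oscillator y x = g x - coeff g * Real.cos x) ∧ coeff y = 0 :=
  (exists_oscillator_inverse.choose_spec g y).symm

/-- The inverse of `m - ∂ₓ²` on even periodic functions, for `m > 0`. -/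
def screenedInv (m : ℝ) : EvenPer →L[ℝ] EvenPer :=
  if hm : 0 < m then (exists_screened_inverse hm).choose else 0

lemma eq_screenedInv_iff {m : ℝ} (hm : 0 < m) {f p : EvenPer} : p = screenedInv m f ↔
    ContDiff ℝ 2 p ∧ ∀ x, iteratedDeriv 2 p x = m * p x - f x := by
  rw [screenedInv, dif_pos hm]
  exact ((exists_screened_inverse hm).choose_spec f p).symm

lemma coeff_oscInv (g : EvenPer) : coeff (oscInv g) = 0 := (eq_oscInv_iff.1 rfl).2.2

lemma oscInv_cosine : oscInv cosine = 0 := by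
  refine (eq_oscInv_iff.2 ⟨contDiff_const, fun x => ?_, map_zero _⟩).symm
  rw [coeff_cosine]
  change (0 : ℝ) + iteratedDeriv 2 (fun _ : ℝ => (0 : ℝ)) x = Real.cos x - 1 * Real.cos x
  simp

lemma screenedInv_cosine {m : ℝ} (hm : 0 < m) :
    screenedInv m cosine = (1 / (1 + m)) • cosine := by
  refine ((eq_screenedInv_iff hm).2 ⟨contDiff_const.mul Real.contDiff_cos, fun x => ?_⟩).symm
  have h := congr_fun (iteratedDeriv_two_const_mul Real.contDiff_cos (1 / (1 + m))) x
  refine h.trans ?_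
  simp
  field_simp
  ring

/-- Invert `1 + ∂ₓ²` twice: the cosine component of `v` stays free, and the price is solvability of
the outer equation, `coeff g = 0`. -/
lemma bilaplacian_iff {g v : EvenPer} :
    (ContDiff ℝ 4 v ∧ ∀ x, oscillator (oscillator v) x = g x) ↔
      coeff g = 0 ∧ v - coeff v • cosine = oscInv (oscInv g) := by
  have hcos : ∀ c : ℝ, ContDiff ℝ 2 fun x => c * Real.cos x := fun c =>
    contDiff_const.mul Real.contDiff_cos
  have hosc : ContDiff ℝ 2 v →
      oscillator (v - coeff v • cosine : EvenPer) = oscillator v := fun hv => by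
    refine (oscillator_sub hv (hcos (coeff v))).trans ?_
    rw [oscillator_const_mul Real.contDiff_cos, oscillator_cos]
    simp
  constructor
  · rintro ⟨hv, h⟩
    have hv2 : ContDiff ℝ 2 v := hv.of_le (by norm_num)
    have hy2 := oscillator_contDiff_two hv
    obtain ⟨y, hy⟩ := EvenPer.exists_eq hy2.continuous v.periodic.oscillator v.even.oscillator
    have hcg : coeff g = 0 := by
      rw [coeff_apply, ← show oscillator (oscillator v) = g from funext h]
      exact cosCoeff_oscillator hy2 v.periodic.oscillator
    have hcy : coeff y = 0 := by
      rw [coeff_apply, hy]; exact cosCoeff_oscillator hv2 v.periodic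
    have hyS : y = oscInv g := eq_oscInv_iff.2 ⟨hy ▸ hy2, fun x => by rw [hy, h, hcg]; simp, hcy⟩
    refine ⟨hcg, ?_⟩
    rw [← hyS]
    refine eq_oscInv_iff.2 ⟨hv2.sub (hcos _), fun x => ?_, by simp [coeff_cosine]⟩
    rw [hosc hv2, hcy, hy]; simp
  · rintro ⟨hcg, h⟩
    obtain ⟨h1, h2, -⟩ := eq_oscInv_iff.1 h
    obtain ⟨h3, h4, -⟩ := eq_oscInv_iff.1 (rfl : oscInv g = oscInv g)
    have hv2 : ContDiff ℝ 2 v := by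
      rw [show (v : ℝ → ℝ) = fun x => (v - coeff v • cosine : EvenPer) x + coeff v * Real.cos x from
        funext fun x => by simp]
      exact h1.add (hcos (coeff v))
    have hov : oscillator v = oscInv g := by
      rw [← hosc hv2]; funext x; rw [h2, coeff_oscInv]; simp
    refine ⟨contDiff_four_of_oscillator hv2 (hov ▸ h3), fun x => ?_⟩
    rw [hov, h4, hcg]; simp

/-- The state `(σ + p, v)`. -/
def profile (σ : ℝ) (p v : EvenPer) : ℝ → ℝ × ℝ := fun x => (σ + p x, v x)

/-- The right-hand side of the equation `m p - p'' = uForcing` for the first component. -/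
def uForcing (c₀ σ : ℝ) (p v : EvenPer) : EvenPer :=
  v - ((3 * σ - c₀) / 2) • p ^ 2 - (1 / 2 : ℝ) • p ^ 3

/-- The right-hand side of the equation `(1 + ∂ₓ²)² v = vForcing` for the second component. -/
def vForcing (σ α γ : ℝ) (p v : EvenPer) : EvenPer :=
  α • v - v ^ 3 + γ • (v * ((2 * σ) • p + p ^ 2))

variable {c₀ σ : ℝ}

lemma sq_eq_one_of_sign (hσ : σ = 1 ∨ σ = -1) : σ ^ 2 = 1 := by
  rcases hσ with rfl | rfl <;> norm_num

lemma one_sub_sign_mul_pos (hc₀ : 0 < c₀) (hc₀' : c₀ < 1) (hσ : σ = 1 ∨ σ = -1) :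
    0 < 1 - σ * c₀ := by
  rcases hσ with rfl | rfl <;> linarith

lemma iteratedDeriv_const_add' {n : ℕ} (hn : 0 < n) (σ : ℝ) (p : ℝ → ℝ) :
    iteratedDeriv n (fun y => σ + p y) = iteratedDeriv n p := by
  obtain ⟨k, rfl⟩ := Nat.exists_eq_succ_of_ne_zero hn.ne'
  rw [iteratedDeriv_succ', iteratedDeriv_succ']
  congr 1
  funext x
  exact deriv_const_add σ

lemma isEquilibrium_profile_iff (hσ : σ = 1 ∨ σ = -1) (hm : 0 < 1 - σ * c₀) {α γ : ℝ}
    {p v : EvenPer} : IsEquilibrium c₀ α γ (profile σ p v) ↔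
      p = screenedInv (1 - σ * c₀) (uForcing c₀ σ p v) ∧ coeff (vForcing σ α γ p v) = 0 ∧
        v - coeff v • cosine = oscInv (oscInv (vForcing σ α γ p v)) := by
  have hσ2 := sq_eq_one_of_sign hσ
  rw [eq_screenedInv_iff hm, ← bilaplacian_iff]
  have e1 : ContDiff ℝ 2 (fun x => (profile σ p v x).1) ↔ ContDiff ℝ 2 p := by
    constructor
    · intro h
      rw [show (p : ℝ → ℝ) = fun x => (profile σ p v x).1 - σ from funext fun x => by simp [profile]]
      exact h.sub contDiff_const
    · exact fun h => contDiff_const.add h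
  rw [IsEquilibrium, IsClassical, e1]
  have e2 : ContDiff ℝ 4 v → ((∀ x, diffOp (profile σ p v) x + reaction c₀ α γ (profile σ p v x) = 0) ↔
      (∀ x, iteratedDeriv 2 p x = (1 - σ * c₀) * p x - uForcing c₀ σ p v x) ∧
        ∀ x, oscillator (oscillator v) x = vForcing σ α γ p v x) := by
    intro hv
    rw [← forall_and]
    refine forall_congr' fun x => ?_
    rw [oscillator_oscillator hv, Prod.ext_iff]
    simp only [diffOp, reaction, profile, uForcing, vForcing, Prod.fst_add, Prod.snd_add,
      Prod.fst_zero, Prod.snd_zero, iteratedDeriv_const_add' two_pos, EvenPer.sub_apply,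
      EvenPer.add_apply, EvenPer.smul_apply, EvenPer.pow_apply, EvenPer.mul_apply, smul_eq_mul]
    refine and_congr ?_ ?_
    · rw [← sub_eq_zero (a := iteratedDeriv 2 _ x)]
      refine Eq.congr_left ?_
      linear_combination (-p x / 2 * 3 - 1 / 2 * (σ - c₀)) * hσ2
    · rw [← sub_eq_zero (a := v x + _ + _), ← neg_eq_zero (a := _ - _)]
      refine Eq.congr_left ?_
      linear_combination (γ * v x) * hσ2
  constructor
  · rintro ⟨⟨h1, h2⟩, h3⟩
    obtain ⟨h4, h5⟩ := (e2 h2).1 h3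
    exact ⟨⟨h1, h4⟩, h2, h5⟩
  · rintro ⟨⟨h1, h4⟩, h2, h5⟩
    exact ⟨⟨h1, h2⟩, (e2 h2).2 ⟨h4, h5⟩⟩

lemma exists_profile {W : ℝ → ℝ × ℝ} {α γ : ℝ} (hW : IsEquilibrium c₀ α γ W) (hp : IsPeriodic W)
    (he : IsEven W) : ∃ p v : EvenPer, W = profile σ p v := by
  obtain ⟨p, h1⟩ := EvenPer.exists_eq (f := fun x => (W x).1 - σ)
    (hW.1.1.continuous.sub continuous_const) (fun x => by simp only [hp x])
    fun x => by simp only [he x]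
  obtain ⟨v, h2⟩ := EvenPer.exists_eq (f := fun x => (W x).2)
    hW.1.2.continuous (fun x => by simp only [hp x]) fun x => by simp only [he x]
  refine ⟨p, v, funext fun x => ?_⟩
  simp [profile, h1, h2]

/-- The rescaled first component `q₀ + A q₁`, with `q₀ = cos / (2 - σ c₀)`. -/
def scaledU (c₀ σ A : ℝ) (q : EvenPer) : EvenPer := (1 / (2 - σ * c₀)) • cosine + A • q

/-- The rescaled second component `cos + A w₁`. -/
def scaledV (A : ℝ) (w : EvenPer) : EvenPer := cosine + A • w

/-- The forcing of the first rescaled correction. -/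
def uCorrection (c₀ σ A : ℝ) (q w : EvenPer) : EvenPer :=
  w - ((3 * σ - c₀) / 2) • scaledU c₀ σ A q ^ 2 - (A / 2) • scaledU c₀ σ A q ^ 3

/-- The forcing of the second rescaled correction. -/
def vCorrection (c₀ σ α γ A : ℝ) (q w : EvenPer) : EvenPer :=
  α • w - A • scaledV A w ^ 3 +
    γ • (scaledV A w * ((2 * σ) • scaledU c₀ σ A q + A • scaledU c₀ σ A q ^ 2))

/-- The function `Φ` in the reduced bifurcation equation `α = A² Φ`. -/
def bifurcation (c₀ σ γ A : ℝ) (q w : EvenPer) : ℝ :=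
  coeff (scaledV A w ^ 3) - 2 * σ * γ * coeff (w * scaledU c₀ σ A q + cosine * q) -
    γ * coeff (scaledV A w * scaledU c₀ σ A q ^ 2)

/-- The rescaled equilibrium equations. -/
def ScaledSystem (c₀ σ α γ A : ℝ) (q w : EvenPer) : Prop :=
  q = screenedInv (1 - σ * c₀) (uCorrection c₀ σ A q w) ∧
    w = oscInv (oscInv (vCorrection c₀ σ α γ A q w)) ∧ α = A ^ 2 * bifurcation c₀ σ γ A q w

lemma uForcing_scaled (A : ℝ) (q w : EvenPer) :
    uForcing c₀ σ (A • scaledU c₀ σ A q) (A • scaledV A w) =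
      A • cosine + A ^ 2 • uCorrection c₀ σ A q w := by
  ext x; simp [uForcing, uCorrection, scaledV]; ring

lemma vForcing_scaled (α γ A : ℝ) (q w : EvenPer) :
    vForcing σ α γ (A • scaledU c₀ σ A q) (A • scaledV A w) =
      (α * A) • cosine + A ^ 2 • vCorrection c₀ σ α γ A q w := by
  ext x; simp [vForcing, vCorrection, scaledV]; ring

/-- The only contribution of order `A²` is a multiple of `cos²`, whose cosine coefficient is zero.
Hence no linear term in `A` enters the reduced equation and the bifurcation is a pitchfork. -/
lemma coeff_vForcing_scaled {α γ A : ℝ} {q w : EvenPer} (hw : coeff w = 0) :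
    coeff (vForcing σ α γ (A • scaledU c₀ σ A q) (A • scaledV A w)) =
      A * (α - A ^ 2 * bifurcation c₀ σ γ A q w) := by
  have h1 : scaledV A w * ((2 * σ) • scaledU c₀ σ A q + A • scaledU c₀ σ A q ^ 2) =
      (2 * σ / (2 - σ * c₀)) • cosine ^ 2 +
        (2 * σ * A) • (w * scaledU c₀ σ A q + cosine * q) +
        A • (scaledV A w * scaledU c₀ σ A q ^ 2) := by
    ext x; simp [scaledU, scaledV]; ring
  rw [vForcing_scaled, vCorrection, h1, bifurcation]
  simp only [map_add, map_sub, map_smul, smul_eq_mul, hw, coeff_cosine, coeff_cosine_sq]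
  ring

/-- The terms linear in `A` match, because `screenedInv` maps `cos` to `cos / (2 - σ c₀)` and
`oscInv` annihilates it; what remains in the two function equations is divisible by `A²`. -/
lemma isEquilibrium_scaled_iff (hσ : σ = 1 ∨ σ = -1) (hm : 0 < 1 - σ * c₀) {α γ A : ℝ}
    (hA : A ≠ 0) {q w : EvenPer} (hw : coeff w = 0) :
    IsEquilibrium c₀ α γ (profile σ (A • scaledU c₀ σ A q) (A • scaledV A w)) ↔
      ScaledSystem c₀ σ α γ A q w := by
  rw [isEquilibrium_profile_iff hσ hm, ScaledSystem, coeff_vForcing_scaled hw, uForcing_scaled,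
    vForcing_scaled]
  have hA2 : A ^ 2 ≠ 0 := pow_ne_zero _ hA
  have e1 : coeff (A • scaledV A w) = A := by simp [scaledV, coeff_cosine, hw]
  have e2 : A • scaledV A w - A • cosine = A ^ 2 • w := by ext x; simp [scaledV]; ring
  have e3 : A • scaledU c₀ σ A q = A • (1 / (1 + (1 - σ * c₀))) • cosine + A ^ 2 • q := by
    rw [scaledU, show 1 + (1 - σ * c₀) = 2 - σ * c₀ by ring]; ext x; simp; ring
  have e4 : oscInv (oscInv ((α * A) • cosine + A ^ 2 • vCorrection c₀ σ α γ A q w)) =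
      A ^ 2 • oscInv (oscInv (vCorrection c₀ σ α γ A q w)) := by simp [oscInv_cosine]
  rw [e1, e2, e4, map_add, map_smul, map_smul, screenedInv_cosine hm, e3, add_right_inj,
    smul_right_inj hA2, smul_right_inj hA2]
  simp only [mul_eq_zero, hA, false_or, sub_eq_zero]
  tauto

lemma ScaledSystem.coeff_eq_zero {α γ A : ℝ} {q w : EvenPer} (h : ScaledSystem c₀ σ α γ A q w) :
    coeff w = 0 := by
  rw [h.2.1, coeff_oscInv]

end Reduction

/-! ### The branch from the implicit function theorem in `(ε, γ)`. -/

section Branch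

open EvenPer Filter Topology

variable {c₀ σ : ℝ}

/-- The rescaled equilibrium equations with `α = ε²` and `A = ε b` as a map, whose zeros
`((ε, γ), (b, q, w))` are sought near `ε = γ = 0`. -/
def branchMap (c₀ σ : ℝ) (x : (ℝ × ℝ) × (ℝ × EvenPer × EvenPer)) : ℝ × EvenPer × EvenPer :=
  (1 - x.2.1 ^ 2 * bifurcation c₀ σ x.1.2 (x.1.1 * x.2.1) x.2.2.1 x.2.2.2,
    x.2.2.1 - screenedInv (1 - σ * c₀) (uCorrection c₀ σ (x.1.1 * x.2.1) x.2.2.1 x.2.2.2),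
    x.2.2.2 - oscInv (oscInv
      (vCorrection c₀ σ (x.1.1 ^ 2) x.1.2 (x.1.1 * x.2.1) x.2.2.1 x.2.2.2)))

/-- The zero of the rescaled equations at `ε = γ = 0`. -/
def branchBase (c₀ σ : ℝ) : ℝ × EvenPer × EvenPer :=
  (2 / √3, screenedInv (1 - σ * c₀) (uCorrection c₀ σ 0 0 0), 0)

/-- The reduced equation has been divided by `ε²` to stay nondegenerate at `ε = 0`; for `ε ≠ 0`
nothing is lost. -/
lemma branchMap_eq_zero_iff {ε γ b : ℝ} {q w : EvenPer} (hε : ε ≠ 0) :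
    branchMap c₀ σ ((ε, γ), (b, q, w)) = 0 ↔ ScaledSystem c₀ σ (ε ^ 2) γ (ε * b) q w := by
  simp only [branchMap, ScaledSystem, Prod.mk_eq_zero, sub_eq_zero]
  have : (1 = b ^ 2 * bifurcation c₀ σ γ (ε * b) q w) ↔
      ε ^ 2 = (ε * b) ^ 2 * bifurcation c₀ σ γ (ε * b) q w := by
    rw [mul_pow, mul_assoc]
    exact (mul_right_eq_self₀.trans (by simp [hε, eq_comm])).symm |>.trans eq_comm
  rw [this]; tauto

lemma contDiff_branchMap : ContDiff ℝ 1 (branchMap c₀ σ) := by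
  unfold branchMap bifurcation uCorrection vCorrection scaledU scaledV
  fun_prop

/-- At `ε = γ = 0` the system decouples: the scalar equation sees only `b`, through `cosCoeff (cos³)
= 3/4`, and the function equations are affine and triangular. -/
lemma branchMap_zero_param (y : ℝ × EvenPer × EvenPer) : branchMap c₀ σ ((0, 0), y) =
    (1 - 3 / 4 * y.1 ^ 2, y.2.1 - screenedInv (1 - σ * c₀) y.2.2
      - screenedInv (1 - σ * c₀) (uCorrection c₀ σ 0 0 0), y.2.2) := by
  have h1 : uCorrection c₀ σ 0 y.2.1 y.2.2 = y.2.2 + uCorrection c₀ σ 0 0 0 := by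
    simp [uCorrection, scaledU, sub_eq_add_neg]
  simp only [branchMap, zero_mul, h1, map_add]
  refine Prod.ext ?_ (Prod.ext ?_ ?_)
  · simp [bifurcation, scaledV, coeff_cosine_cube]; ring
  · simp only; abel
  · simp [vCorrection]

lemma branchMap_base : branchMap c₀ σ ((0, 0), branchBase c₀ σ) = 0 := by
  rw [branchMap_zero_param]
  simp [branchBase, div_pow]
  norm_num

/-- The partial derivative of `branchMap` at the base point. -/
def branchDeriv (c₀ σ : ℝ) : (ℝ × EvenPer × EvenPer) ≃L[ℝ] ℝ × EvenPer × EvenPer :=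
  ContinuousLinearEquiv.equivOfInverse
    ((-√3 • ContinuousLinearMap.id ℝ ℝ).prodMap
      ((ContinuousLinearMap.fst ℝ EvenPer EvenPer
        - (screenedInv (1 - σ * c₀)).comp (ContinuousLinearMap.snd ℝ EvenPer EvenPer)).prod
        (ContinuousLinearMap.snd ℝ EvenPer EvenPer)))
    ((-(1 / √3) • ContinuousLinearMap.id ℝ ℝ).prodMap
      ((ContinuousLinearMap.fst ℝ EvenPer EvenPer
        + (screenedInv (1 - σ * c₀)).comp (ContinuousLinearMap.snd ℝ EvenPer EvenPer)).prod
        (ContinuousLinearMap.snd ℝ EvenPer EvenPer)))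
    (fun ⟨b, q, w⟩ => by simp [Prod.map])
    (fun ⟨b, q, w⟩ => by simp [Prod.map])

lemma hasFDerivAt_branchMap_zero_param :
    HasFDerivAt (fun y => branchMap c₀ σ ((0, 0), y))
      (branchDeriv c₀ σ : (ℝ × EvenPer × EvenPer) →L[ℝ] ℝ × EvenPer × EvenPer)
      (branchBase c₀ σ) := by
  simp only [branchMap_zero_param]
  have h1 : HasFDerivAt (fun b : ℝ => 1 - 3 / 4 * b ^ 2) (-√3 • ContinuousLinearMap.id ℝ ℝ)
      (branchBase c₀ σ).1 := by
    -- The derivative at `2/√3` is `-(3/2)(2/√3) = -√3`, nonzero: this is the nondegeneracy of the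
    -- pitchfork.
    have h : HasDerivAt (fun b : ℝ => 1 - 3 / 4 * b ^ 2) (-√3) (2 / √3) := by
      refine (((hasDerivAt_pow 2 _).const_mul (3 / 4)).const_sub 1).congr_deriv ?_
      have h3 : √3 * √3 = 3 := Real.mul_self_sqrt (by norm_num)
      have h4 : √3 ≠ 0 := by positivity
      rw [neg_inj]
      norm_num
      field_simp
      nlinarith
    refine h.hasFDerivAt.congr_fderiv ?_
    ext; simp
  have h2 : HasFDerivAt (fun y : EvenPer × EvenPer => (y.1 - screenedInv (1 - σ * c₀) y.2
      - screenedInv (1 - σ * c₀) (uCorrection c₀ σ 0 0 0), y.2))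
      ((ContinuousLinearMap.fst ℝ EvenPer EvenPer
        - (screenedInv (1 - σ * c₀)).comp (ContinuousLinearMap.snd ℝ EvenPer EvenPer)).prod
        (ContinuousLinearMap.snd ℝ EvenPer EvenPer)) (branchBase c₀ σ).2 :=
    ((ContinuousLinearMap.hasFDerivAt (ContinuousLinearMap.fst ℝ EvenPer EvenPer
        - (screenedInv (1 - σ * c₀)).comp (ContinuousLinearMap.snd ℝ EvenPer EvenPer))).sub_const
      _).prodMk hasFDerivAt_snd
  exact h1.prodMap _ h2

/-- Treating `ε` and `γ` as joint parameters gives neighbourhoods uniform in `γ`. The Lipschitz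
bound is what later yields both `|a - 2/√3| ≤ C γ` and the `O(ε²)` error of the profile. -/
lemma exists_branch (c₀ σ : ℝ) : ∃ ψ : ℝ × ℝ → ℝ × EvenPer × EvenPer,
    Tendsto ψ (𝓝 0) (𝓝 (branchBase c₀ σ)) ∧
    (∀ᶠ x in 𝓝 (0 : ℝ × ℝ), x.1 ≠ 0 →
      ScaledSystem c₀ σ (x.1 ^ 2) x.2 (x.1 * (ψ x).1) (ψ x).2.1 (ψ x).2.2) ∧
    (∀ᶠ v in 𝓝 ((0 : ℝ × ℝ), branchBase c₀ σ), v.1.1 ≠ 0 →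
      ScaledSystem c₀ σ (v.1.1 ^ 2) v.1.2 (v.1.1 * v.2.1) v.2.2.1 v.2.2.2 → v.2 = ψ v.1) ∧
    ∃ C : ℝ, ∃ s ∈ 𝓝 (0 : ℝ × ℝ), ∀ x ∈ s, ∀ y ∈ s, ‖ψ x - ψ y‖ ≤ C * ‖x - y‖ := by
  obtain ⟨u, hu⟩ : ∃ u : (ℝ × ℝ) × (ℝ × EvenPer × EvenPer), u = ((0, 0), branchBase c₀ σ) :=
    ⟨_, rfl⟩
  have hG : HasStrictFDerivAt (branchMap c₀ σ) (fderiv ℝ (branchMap c₀ σ) u) u :=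
    contDiff_branchMap.contDiffAt.hasStrictFDerivAt (by norm_num)
  have hpart : fderiv ℝ (branchMap c₀ σ) u ∘L .inr ℝ (ℝ × ℝ) (ℝ × EvenPer × EvenPer) =
      branchDeriv c₀ σ := by
    refine HasFDerivAt.unique ?_ hasFDerivAt_branchMap_zero_param
    have h2 : HasFDerivAt (fun y : ℝ × EvenPer × EvenPer => ((((0, 0) : ℝ × ℝ)), y))
        (.inr ℝ (ℝ × ℝ) (ℝ × EvenPer × EvenPer)) (branchBase c₀ σ) :=
      hasFDerivAt_prodMk_right _ _
    rw [hu] at hG ⊢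
    exact hG.hasFDerivAt.comp _ h2
  have hinv : (fderiv ℝ (branchMap c₀ σ) u ∘L
      .inr ℝ (ℝ × ℝ) (ℝ × EvenPer × EvenPer)).IsInvertible := ⟨branchDeriv c₀ σ, hpart.symm⟩
  have hu0 : branchMap c₀ σ u = 0 := hu ▸ branchMap_base
  refine ⟨hG.implicitFunctionOfProdDomain hinv, ?_, ?_, ?_, ?_⟩
  · have := hG.tendsto_implicitFunctionOfProdDomain hinv
    simp only [hu] at this ⊢
    exact this
  · have := hG.eventually_apply_implicitFunctionOfProdDomain hinv
    rw [hu0] at this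
    simp only [hu] at this ⊢
    filter_upwards [this] with x hx h0
    exact (branchMap_eq_zero_iff h0).1 hx
  · have := hG.eventually_apply_eq_iff_implicitFunctionOfProdDomain hinv
    rw [hu0] at this
    simp only [hu] at this ⊢
    filter_upwards [this] with x hx h0 h1
    exact (hx.1 ((branchMap_eq_zero_iff h0).2 h1)).symm
  · obtain ⟨K, s, hs, hK⟩ :=
      (hG.hasStrictFDerivAt_implicitFunctionOfProdDomain hinv).exists_lipschitzOnWith
    refine ⟨K, s, by simp only [hu] at hs; exact hs, fun x hx y hy => ?_⟩
    have := hK.dist_le_mul x hx y hy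
    rwa [dist_eq_norm, dist_eq_norm] at this

end Branch

/-! ### A priori estimates: small equilibria rescale to the base point. -/

section Smallness

open EvenPer Filter Topology

variable {c₀ σ : ℝ}

/-- The parameters `(α, γ)` together with the deviation `(p, v)` of an equilibrium. -/
abbrev State : Type := ℝ × ℝ × EvenPer × EvenPer

/-- The filter of equilibria tending to the homogeneous state, with `(α, γ)` tending to `0`. -/
def smallEquilibria (c₀ σ : ℝ) : Filter State :=
  𝓝 0 ⊓ 𝓟 {X | IsEquilibrium c₀ X.1 X.2.1 (profile σ X.2.2.1 X.2.2.2)}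

lemma smallEquilibria_le : smallEquilibria c₀ σ ≤ 𝓝 0 := inf_le_left

lemma tendsto_smallEquilibria {f : State → ℝ} (hf : Continuous f) (h0 : f 0 = 0) :
    Tendsto f (smallEquilibria c₀ σ) (𝓝 0) := by
  have := hf.tendsto 0
  rw [h0] at this
  exact this.mono_left smallEquilibria_le

lemma norm_smul_cosine_le (c : ℝ) : ‖c • cosine‖ ≤ |c| := by
  rw [norm_smul]
  exact mul_le_of_le_one_right (norm_nonneg _) norm_cosine_le

lemma norm_cubic_le (n : ℝ) (p : EvenPer) :
    ‖n • p ^ 2 + (1 / 2 : ℝ) • p ^ 3‖ ≤ (|n| + ‖p‖) * ‖p‖ ^ 2 := by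
  have h2 : ‖p ^ 2‖ ≤ ‖p‖ ^ 2 := norm_pow_le' p (by norm_num)
  have h3 : ‖p ^ 3‖ ≤ ‖p‖ ^ 3 := norm_pow_le' p (by norm_num)
  calc _ ≤ ‖n • p ^ 2‖ + ‖(1 / 2 : ℝ) • p ^ 3‖ := norm_add_le _ _
    _ ≤ |n| * ‖p‖ ^ 2 + 1 * ‖p‖ ^ 3 := by
        rw [norm_smul, norm_smul, Real.norm_eq_abs]
        gcongr
        norm_num
    _ = _ := by ring

/-- In the equation for `p` the quadratic and cubic terms are at most half of `‖p‖` when `p` is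
small, and are absorbed on the left. -/
lemma eventually_norm_fst_le (hσ : σ = 1 ∨ σ = -1) (hm : 0 < 1 - σ * c₀) :
    ∀ᶠ X in smallEquilibria c₀ σ, ‖X.2.2.1‖ ≤ 2 * ‖screenedInv (1 - σ * c₀)‖ * ‖X.2.2.2‖ := by
  have ht := tendsto_smallEquilibria (c₀ := c₀) (σ := σ) (f := fun X : State =>
    ‖screenedInv (1 - σ * c₀)‖ * ((|(3 * σ - c₀) / 2| + ‖X.2.2.1‖) * ‖X.2.2.1‖))
    (by fun_prop) (by simp)
  filter_upwards [ht.eventually (gt_mem_nhds (show (0 : ℝ) < 1 / 2 by norm_num)),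
    mem_inf_of_right (mem_principal_self _)] with X h1 hX
  obtain ⟨α, γ, p, v⟩ := X
  simp only at h1 ⊢
  have h2 := ((isEquilibrium_profile_iff hσ hm).1 hX).1
  set K := screenedInv (1 - σ * c₀)
  have h3 := norm_cubic_le ((3 * σ - c₀) / 2) p
  have h4 : ‖p‖ ≤ ‖K‖ * (‖v‖ + (|(3 * σ - c₀) / 2| + ‖p‖) * ‖p‖ ^ 2) := by
    conv_lhs => rw [show p = _ from h2]
    refine (K.le_opNorm _).trans ?_
    gcongr
    rw [uForcing, sub_sub]
    exact (norm_sub_le _ _).trans (by gcongr)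
  have h5 : 0 ≤ ‖p‖ := norm_nonneg p
  nlinarith

/-- Since `oscInv` kills `cos`, the linear term `α v` acts only on the remainder, where it can be
absorbed for small `α`. -/
lemma oscInv_oscInv_vForcing {α γ A : ℝ} {p v : EvenPer} :
    oscInv (oscInv (vForcing σ α γ p v)) = oscInv (oscInv
      (α • (v - A • cosine) + (γ • (v * ((2 * σ) • p + p ^ 2)) - v ^ 3))) := by
  have : vForcing σ α γ p v =
      α • (v - A • cosine) + (γ • (v * ((2 * σ) • p + p ^ 2)) - v ^ 3) + (α * A) • cosine := by
    ext x; simp [vForcing]; ring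
  rw [this]; simp [oscInv_cosine]

/-- The remainder of the second component is quadratic in the amplitude, with a small constant. -/
lemma exists_remainder_bound (hσ : σ = 1 ∨ σ = -1) (hm : 0 < 1 - σ * c₀) :
    ∃ θ : State → ℝ, Tendsto θ (smallEquilibria c₀ σ) (𝓝 0) ∧
      ∀ᶠ X in smallEquilibria c₀ σ, ‖X.2.2.2‖ ≤ 2 * |coeff X.2.2.2| ∧
        ‖X.2.2.2 - coeff X.2.2.2 • cosine‖ ≤ θ X * coeff X.2.2.2 ^ 2 := by
  set k₁ := ‖screenedInv (1 - σ * c₀)‖ with hk₁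
  set k₂ := ‖oscInv‖ ^ 2 with hk₂
  have ht := tendsto_smallEquilibria (c₀ := c₀) (σ := σ) (f := fun X : State =>
    k₂ * (‖X.2.2.2‖ + |X.2.1| * (2 * k₁ * (2 + ‖X.2.2.1‖)))) (by fun_prop) (by simp)
  have ht2 := tendsto_smallEquilibria (c₀ := c₀) (σ := σ) (f := fun X : State => k₂ * |X.1|)
    (by fun_prop) (by simp)
  have ht3 := tendsto_smallEquilibria (c₀ := c₀) (σ := σ) (f := fun X : State =>
    k₂ * (‖X.2.2.2‖ + |X.2.1| * (2 * k₁ * (2 + ‖X.2.2.1‖))) * ‖X.2.2.2‖) (by fun_prop) (by simp)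
  -- The factor `8` comes from `‖z‖ ≤ 2 B ‖v‖²` and `‖v‖ ≤ 2 |A|`, with `B` the bracketed quantity,
  -- which tends to `0`.
  refine ⟨fun X => 8 * (k₂ * (‖X.2.2.2‖ + |X.2.1| * (2 * k₁ * (2 + ‖X.2.2.1‖)))),
    by simpa using ht.const_mul 8, ?_⟩
  filter_upwards [ht2.eventually (gt_mem_nhds (show (0 : ℝ) < 1 / 2 by norm_num)),
    ht3.eventually (gt_mem_nhds (show (0 : ℝ) < 1 / 4 by norm_num)),
    eventually_norm_fst_le hσ hm, mem_inf_of_right (mem_principal_self _)] with X h1 h2 h3 hX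
  obtain ⟨α, γ, p, v⟩ := X
  simp only at h1 h2 h3 ⊢
  have h4 := ((isEquilibrium_profile_iff hσ hm).1 hX).2.2
  set A := coeff v
  obtain ⟨z, hz⟩ : ∃ z, z = v - A • cosine := ⟨_, rfl⟩
  rw [oscInv_oscInv_vForcing (A := A), ← hz] at h4
  rw [← hz]
  set B := k₂ * (‖v‖ + |γ| * (2 * k₁ * (2 + ‖p‖))) with hB
  have hk1 : 0 ≤ k₁ := norm_nonneg _
  have hB0 : 0 ≤ B := by positivity
  have h5 : ‖γ • (v * ((2 * σ) • p + p ^ 2)) - v ^ 3‖ ≤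
      |γ| * (‖v‖ * (2 * ‖p‖ + ‖p‖ ^ 2)) + ‖v‖ ^ 3 := by
    refine (norm_sub_le _ _).trans (add_le_add ?_ (norm_pow_le' v (by norm_num)))
    rw [norm_smul, Real.norm_eq_abs]
    gcongr
    refine (norm_mul_le _ _).trans ?_
    gcongr
    refine (norm_add_le _ _).trans (add_le_add ?_ (norm_pow_le' p (by norm_num)))
    rw [norm_smul]
    gcongr
    rcases hσ with rfl | rfl <;> norm_num
  have h6 : ‖z‖ ≤ k₂ * (|α| * ‖z‖ + (|γ| * (‖v‖ * (2 * ‖p‖ + ‖p‖ ^ 2)) + ‖v‖ ^ 3)) := by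
    conv_lhs => rw [h4]
    refine (oscInv.le_opNorm _).trans ?_
    rw [hk₂, pow_two ‖oscInv‖, mul_assoc]
    gcongr
    refine (oscInv.le_opNorm _).trans ?_
    gcongr
    refine (norm_add_le _ _).trans (add_le_add ?_ h5)
    rw [norm_smul, Real.norm_eq_abs]
  have hv0 : 0 ≤ ‖v‖ := norm_nonneg v
  have h7 : |γ| * (‖v‖ * (2 * ‖p‖ + ‖p‖ ^ 2)) ≤ |γ| * (2 * k₁ * (2 + ‖p‖)) * ‖v‖ ^ 2 := by
    calc |γ| * (‖v‖ * (2 * ‖p‖ + ‖p‖ ^ 2)) = |γ| * (‖v‖ * ((2 + ‖p‖) * ‖p‖)) := by ring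
      _ ≤ |γ| * (‖v‖ * ((2 + ‖p‖) * (2 * k₁ * ‖v‖))) := by gcongr
      _ = _ := by ring
  have hk20 : 0 ≤ k₂ := by positivity
  have h8 : ‖z‖ ≤ 2 * B * ‖v‖ ^ 2 := by
    have h9 : k₂ * (|γ| * (‖v‖ * (2 * ‖p‖ + ‖p‖ ^ 2)) + ‖v‖ ^ 3) ≤ B * ‖v‖ ^ 2 := by
      calc _ ≤ k₂ * (|γ| * (2 * k₁ * (2 + ‖p‖)) * ‖v‖ ^ 2 + ‖v‖ ^ 3) := by gcongr
        _ = _ := by rw [hB]; ring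
    have h10 : k₂ * |α| * ‖z‖ ≤ 1 / 2 * ‖z‖ := by gcongr
    nlinarith
  have h9 : ‖v‖ ≤ |A| + ‖z‖ := by
    calc ‖v‖ = ‖A • cosine + z‖ := by rw [hz]; simp
      _ ≤ _ := (norm_add_le _ _).trans (by gcongr; exact norm_smul_cosine_le A)
  -- From `‖v‖ ≤ |A| + 2 B ‖v‖²` and `B ‖v‖ < 1/4`.
  have h10 : ‖v‖ ≤ 2 * |A| := by nlinarith
  refine ⟨h10, h8.trans ?_⟩
  calc 2 * B * ‖v‖ ^ 2 ≤ 2 * B * (2 * |A|) ^ 2 := by gcongr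
    _ = _ := by rw [mul_pow, sq_abs]; ring

/-- The first rescaled correction of an equilibrium. -/
def corrU (c₀ σ : ℝ) (X : State) : EvenPer :=
  (coeff X.2.2.2)⁻¹ • ((coeff X.2.2.2)⁻¹ • X.2.2.1 - (1 / (2 - σ * c₀)) • cosine)

/-- The second rescaled correction of an equilibrium. -/
def corrV (X : State) : EvenPer :=
  ((coeff X.2.2.2) ^ 2)⁻¹ • (X.2.2.2 - coeff X.2.2.2 • cosine)

lemma coeff_corrV (X : State) : coeff (corrV X) = 0 := by simp [corrV, coeff_cosine]

lemma smul_scaledU_corrU {X : State} (h : coeff X.2.2.2 ≠ 0) :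
    coeff X.2.2.2 • scaledU c₀ σ (coeff X.2.2.2) (corrU c₀ σ X) = X.2.2.1 := by
  rw [scaledU, corrU, smul_inv_smul₀ h, add_sub_cancel, smul_inv_smul₀ h]

lemma smul_scaledV_corrV {X : State} (h : coeff X.2.2.2 ≠ 0) :
    coeff X.2.2.2 • scaledV (coeff X.2.2.2) (corrV X) = X.2.2.2 := by
  rw [scaledV, corrV, smul_add, smul_smul, ← pow_two, smul_inv_smul₀ (pow_ne_zero _ h)]
  abel

/-- The filter of nontrivial equilibria tending to the homogeneous state. -/
def nontrivialEquilibria (c₀ σ : ℝ) : Filter State :=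
  smallEquilibria c₀ σ ⊓ 𝓟 {X | coeff X.2.2.2 ≠ 0}

lemma eventually_ne : ∀ᶠ X in nontrivialEquilibria c₀ σ, coeff X.2.2.2 ≠ 0 :=
  mem_inf_of_right (mem_principal_self _)

lemma nontrivialEquilibria_le : nontrivialEquilibria c₀ σ ≤ smallEquilibria c₀ σ := inf_le_left

lemma eventually_scaledSystem (hσ : σ = 1 ∨ σ = -1) (hm : 0 < 1 - σ * c₀) :
    ∀ᶠ X in nontrivialEquilibria c₀ σ,
      ScaledSystem c₀ σ X.1 X.2.1 (coeff X.2.2.2) (corrU c₀ σ X) (corrV X) := by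
  filter_upwards [eventually_ne, nontrivialEquilibria_le (mem_inf_of_right (mem_principal_self _))]
    with X h hX
  rw [← isEquilibrium_scaled_iff hσ hm h (coeff_corrV X), smul_scaledU_corrU h,
    smul_scaledV_corrV h]
  exact hX

lemma tendsto_corrV (hσ : σ = 1 ∨ σ = -1) (hm : 0 < 1 - σ * c₀) :
    Tendsto corrV (nontrivialEquilibria c₀ σ) (𝓝 0) := by
  obtain ⟨θ, hθ, h⟩ := exists_remainder_bound (c₀ := c₀) hσ hm
  refine squeeze_zero_norm' ?_ (hθ.mono_left nontrivialEquilibria_le)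
  filter_upwards [eventually_ne, nontrivialEquilibria_le h] with X hX h
  rw [corrV, norm_smul, norm_inv, Real.norm_of_nonneg (sq_nonneg _), inv_mul_le_iff₀ (by positivity)]
  exact h.2.trans_eq (mul_comm _ _)

lemma tendsto_coeff : Tendsto (fun X : State => coeff X.2.2.2) (nontrivialEquilibria c₀ σ) (𝓝 0) :=
  (tendsto_smallEquilibria (by fun_prop) (by simp)).mono_left nontrivialEquilibria_le

/-- Insert `v = A cos + O(A²)` and `p = O(A)` into the fixed-point equation for `p`: its leading
part is `A cos / (2 - σ c₀)` and the error is `O(A²)`, so division by `A` leaves a factor `|A|`. -/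
lemma tendsto_scaledU (hσ : σ = 1 ∨ σ = -1) (hm : 0 < 1 - σ * c₀) :
    Tendsto (fun X : State => scaledU c₀ σ (coeff X.2.2.2) (corrU c₀ σ X))
      (nontrivialEquilibria c₀ σ) (𝓝 ((1 / (2 - σ * c₀)) • cosine)) := by
  obtain ⟨θ, hθ, h⟩ := exists_remainder_bound (c₀ := c₀) hσ hm
  rw [tendsto_iff_norm_sub_tendsto_zero]
  set K := screenedInv (1 - σ * c₀) with hK
  set n := (3 * σ - c₀) / 2 with hn
  have hlim : Tendsto (fun X : State => ‖K‖ * (θ X + (|n| + ‖X.2.2.1‖) * (4 * ‖K‖) ^ 2) *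
      |coeff X.2.2.2|) (nontrivialEquilibria c₀ σ) (𝓝 0) := by
    have h1 : Tendsto (fun X : State => ‖X.2.2.1‖) (nontrivialEquilibria c₀ σ) (𝓝 0) :=
      (tendsto_smallEquilibria (by fun_prop) (by simp)).mono_left nontrivialEquilibria_le
    have h2 := ((((hθ.mono_left nontrivialEquilibria_le).add
      ((h1.const_add |n|).mul_const ((4 * ‖K‖) ^ 2))).const_mul ‖K‖).mul tendsto_coeff.abs)
    simpa using h2
  refine squeeze_zero' (Eventually.of_forall fun X => norm_nonneg _) ?_ hlim
  filter_upwards [eventually_ne, nontrivialEquilibria_le h, nontrivialEquilibria_le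
    (eventually_norm_fst_le hσ hm), nontrivialEquilibria_le
      (mem_inf_of_right (mem_principal_self _))] with X hA h1 h2 hX
  have h3 := ((isEquilibrium_profile_iff hσ hm).1 hX).1
  obtain ⟨α, γ, p, v⟩ := X
  simp only [scaledU, corrU] at *
  set A := coeff v with hAdef
  rw [smul_inv_smul₀ hA, add_sub_cancel, ← hK] at *
  have h4 : p - A • (1 / (2 - σ * c₀)) • cosine =
      K ((v - A • cosine) - (n • p ^ 2 + (1 / 2 : ℝ) • p ^ 3)) := by
    have : (v - A • cosine) - (n • p ^ 2 + (1 / 2 : ℝ) • p ^ 3) =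
      uForcing c₀ σ p v - A • cosine := by rw [uForcing]; abel
    rw [this, map_sub, ← h3, map_smul, hK, screenedInv_cosine hm]
    congr 4; ring
  have h5 : ‖p - A • (1 / (2 - σ * c₀)) • cosine‖ ≤
      ‖K‖ * (θ (α, γ, p, v) + (|n| + ‖p‖) * (4 * ‖K‖) ^ 2) * A ^ 2 := by
    rw [h4]
    refine (K.le_opNorm _).trans ?_
    rw [mul_assoc]
    gcongr
    refine (norm_sub_le _ _).trans ?_
    rw [add_mul]
    refine add_le_add h1.2 ((norm_cubic_le n p).trans ?_)
    rw [mul_assoc, ← sq_abs A, ← mul_pow]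
    gcongr
    calc ‖p‖ ≤ 2 * ‖K‖ * ‖v‖ := h2
      _ ≤ 2 * ‖K‖ * (2 * |A|) := by gcongr; exact h1.1
      _ = _ := by ring
  have h6 : A⁻¹ • p - (1 / (2 - σ * c₀)) • cosine =
      A⁻¹ • (p - A • (1 / (2 - σ * c₀)) • cosine) := by
    rw [smul_sub, inv_smul_smul₀ hA]
  rw [h6, norm_smul, norm_inv, Real.norm_eq_abs, inv_mul_le_iff₀ (abs_pos.2 hA)]
  refine h5.trans_eq ?_
  rw [← sq_abs A]; ring

/-- The previous estimates only bound `q`, which carries a division by `A²`. Convergence comes from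
the equation: its forcing depends on `q` only through `scaledU`, which already converges. -/
lemma tendsto_corrU (hσ : σ = 1 ∨ σ = -1) (hm : 0 < 1 - σ * c₀) :
    Tendsto (corrU c₀ σ) (nontrivialEquilibria c₀ σ) (𝓝 (branchBase c₀ σ).2.1) := by
  have hU := tendsto_scaledU hσ hm
  have h1 : Tendsto (fun X : State => screenedInv (1 - σ * c₀)
      (uCorrection c₀ σ (coeff X.2.2.2) (corrU c₀ σ X) (corrV X)))
      (nontrivialEquilibria c₀ σ) (𝓝 (branchBase c₀ σ).2.1) := by
    refine ((screenedInv (1 - σ * c₀)).continuous.tendsto _).comp ?_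
    have h2 := (((tendsto_corrV hσ hm).sub ((hU.pow 2).const_smul ((3 * σ - c₀) / 2))).sub
      ((tendsto_coeff.div_const 2).smul (hU.pow 3)))
    simpa [uCorrection, scaledU] using h2
  refine h1.congr' ?_
  filter_upwards [eventually_scaledSystem hσ hm] with X hX using hX.1.symm

lemma tendsto_bifurcation (hσ : σ = 1 ∨ σ = -1) (hm : 0 < 1 - σ * c₀) :
    Tendsto (fun X : State => bifurcation c₀ σ X.2.1 (coeff X.2.2.2) (corrU c₀ σ X) (corrV X))
      (nontrivialEquilibria c₀ σ) (𝓝 (3 / 4)) := by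
  have hU := tendsto_scaledU hσ hm
  have hγ : Tendsto (fun X : State => X.2.1) (nontrivialEquilibria c₀ σ) (𝓝 0) :=
    (tendsto_smallEquilibria (by fun_prop) (by simp)).mono_left nontrivialEquilibria_le
  have hV : Tendsto (fun X : State => scaledV (coeff X.2.2.2) (corrV X))
      (nontrivialEquilibria c₀ σ) (𝓝 cosine) := by
    simpa [scaledV] using (tendsto_coeff.smul (tendsto_corrV hσ hm)).const_add cosine
  have hc := fun a => (coeff.continuous.tendsto a)
  have h1 := (hc _).comp (hV.pow 3)
  have h2 := (hc _).comp (((tendsto_corrV hσ hm).mul hU).add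
    ((tendsto_corrU hσ hm).const_mul cosine))
  have h3 := (hc _).comp (hV.mul (hU.pow 2))
  have h4 := (h1.sub ((hγ.const_mul (2 * σ)).mul h2)).sub (hγ.mul h3)
  rw [coeff_cosine_cube] at h4
  simpa [bifurcation] using h4

/-- Small equilibria are trivial, or have `α > 0` and lie, after rescaling, near the base point of
the branch. -/
lemma exists_smallness (hσ : σ = 1 ∨ σ = -1) (hm : 0 < 1 - σ * c₀)
    {N : Set (ℝ × EvenPer × EvenPer)} (hN : N ∈ 𝓝 (branchBase c₀ σ)) :
    ∃ δ > 0, ∀ (α γ : ℝ) (p v : EvenPer), |α| < δ → |γ| < δ → ‖p‖ < δ → ‖v‖ < δ →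
      IsEquilibrium c₀ α γ (profile σ p v) → (p = 0 ∧ v = 0) ∨ ∃ q w : EvenPer,
        coeff v ≠ 0 ∧ p = coeff v • scaledU c₀ σ (coeff v) q ∧ v = coeff v • scaledV (coeff v) w ∧
        ScaledSystem c₀ σ α γ (coeff v) q w ∧ 0 < α ∧ (|coeff v| / √α, q, w) ∈ N := by
  have h1 : ∀ᶠ X in smallEquilibria c₀ σ, coeff X.2.2.2 = 0 → X.2.2.1 = 0 ∧ X.2.2.2 = 0 := by
    obtain ⟨θ, -, h⟩ := exists_remainder_bound (c₀ := c₀) hσ hm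
    filter_upwards [h, eventually_norm_fst_le hσ hm] with X h1 h2 h0
    have h3 : X.2.2.2 = 0 := by
      have := h1.1
      rwa [h0, abs_zero, mul_zero, norm_le_zero_iff] at this
    rw [h3, norm_zero, mul_zero, norm_le_zero_iff] at h2
    exact ⟨h2, h3⟩
  have hb := tendsto_bifurcation hσ hm
  have h2 : Tendsto (fun X : State =>
      (1 / √(bifurcation c₀ σ X.2.1 (coeff X.2.2.2) (corrU c₀ σ X) (corrV X)),
        corrU c₀ σ X, corrV X)) (nontrivialEquilibria c₀ σ) (𝓝 (branchBase c₀ σ)) := by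
    refine Tendsto.prodMk_nhds ?_ ((tendsto_corrU hσ hm).prodMk_nhds (tendsto_corrV hσ hm))
    have h3 := (tendsto_const_nhds (x := (1 : ℝ))).div hb.sqrt (by positivity)
    have h4 : (1 : ℝ) / √(3 / 4) = 2 / √3 := by
      rw [Real.sqrt_div (by norm_num), show (4 : ℝ) = 2 ^ 2 by norm_num, Real.sqrt_sq (by norm_num)]
      field_simp
    rw [h4] at h3
    exact h3
  have h3 : ∀ᶠ X in nontrivialEquilibria c₀ σ, 0 < X.1 ∧
      (|coeff X.2.2.2| / √X.1, corrU c₀ σ X, corrV X) ∈ N := by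
    filter_upwards [h2.eventually hN, hb.eventually (lt_mem_nhds (show (0 : ℝ) < 3 / 4 by norm_num)),
      eventually_scaledSystem hσ hm, eventually_ne] with X hX hpos hS hA
    have h4 := hS.2.2
    refine ⟨by rw [h4]; positivity, ?_⟩
    -- By `α = A² Φ`, the ratio `|A| / √α` equals `1 / √Φ`, which tends to `2/√3`; the sign of `A`
    -- is lost, hence the absolute value.
    have h5 : |coeff X.2.2.2| / √X.1 =
        1 / √(bifurcation c₀ σ X.2.1 (coeff X.2.2.2) (corrU c₀ σ X) (corrV X)) := by
      conv_lhs => rw [h4]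
      rw [Real.sqrt_mul (sq_nonneg _), Real.sqrt_sq_eq_abs]
      have : |coeff X.2.2.2| ≠ 0 := abs_ne_zero.2 hA
      field_simp
    rw [h5]; exact hX
  have h4 : ∀ᶠ X in smallEquilibria c₀ σ, coeff X.2.2.2 ≠ 0 → (0 < X.1 ∧
      (|coeff X.2.2.2| / √X.1, corrU c₀ σ X, corrV X) ∈ N) ∧
      ScaledSystem c₀ σ X.1 X.2.1 (coeff X.2.2.2) (corrU c₀ σ X) (corrV X) :=
    eventually_inf_principal.1 (h3.and (eventually_scaledSystem hσ hm))
  obtain ⟨δ, hδ, h⟩ := Metric.eventually_nhds_iff.1 (eventually_inf_principal.1 (h1.and h4))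
  refine ⟨δ, hδ, fun α γ p v hα hγ hp hv hE => ?_⟩
  obtain ⟨h5, h6⟩ := @h (α, γ, p, v) (by
    rw [dist_zero_right]
    simp only [Prod.norm_mk, Real.norm_eq_abs, max_lt_iff]
    exact ⟨hα, hγ, hp, hv⟩) hE
  by_cases hA : coeff v = 0
  · exact Or.inl (h5 hA)
  · obtain ⟨⟨h7, h8⟩, h9⟩ := h6 hA
    exact Or.inr ⟨_, _, hA, (smul_scaledU_corrU (X := (α, γ, p, v)) hA).symm,
      (smul_scaledV_corrV (X := (α, γ, p, v)) hA).symm, h9, h7, h8⟩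

end Smallness

/-! ### Energy and sup-norm estimates for complex eigenvalue problems. -/

section ComplexLinear

variable {χ ψ φ h : ℝ → ℂ} {z : ℂ}

/-- Cauchy-Schwarz, as nonnegativity of the variance of `‖g‖` about its mean `t`. -/
lemma sq_integral_norm_le {g : ℝ → ℂ} (hg : Continuous g) :
    (∫ s in (0 : ℝ)..2 * Real.pi, ‖g s‖) ^ 2 ≤
      2 * Real.pi * ∫ s in (0 : ℝ)..2 * Real.pi, ‖g s‖ ^ 2 := by
  set I := ∫ s in (0 : ℝ)..2 * Real.pi, ‖g s‖
  have hpi := Real.pi_pos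
  obtain ⟨t, ht⟩ : ∃ t, t = I / (2 * Real.pi) := ⟨_, rfl⟩
  have h0 : 0 ≤ ∫ s in (0 : ℝ)..2 * Real.pi, (‖g s‖ - t) ^ 2 :=
    intervalIntegral.integral_nonneg Real.two_pi_pos.le fun s _ => sq_nonneg _
  have h1 : ∫ s in (0 : ℝ)..2 * Real.pi, (‖g s‖ - t) ^ 2 =
      (∫ s in (0 : ℝ)..2 * Real.pi, ‖g s‖ ^ 2) - 2 * t * I + 2 * Real.pi * t ^ 2 := by
    have e : ∀ s, (‖g s‖ - t) ^ 2 = ‖g s‖ ^ 2 - 2 * t * ‖g s‖ + t ^ 2 := fun s => by ring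
    simp only [e]
    rw [intervalIntegral.integral_add, intervalIntegral.integral_sub,
      intervalIntegral.integral_const_mul, intervalIntegral.integral_const]
    · simp [I]
    all_goals exact Continuous.intervalIntegrable (by fun_prop) _ _
  rw [h1, ht] at h0
  have h2 : 2 * (I / (2 * Real.pi)) * I = I ^ 2 / Real.pi := by field_simp
  have h3 : 2 * Real.pi * (I / (2 * Real.pi)) ^ 2 = I ^ 2 / (2 * Real.pi) := by field_simp
  have h4 : I ^ 2 / Real.pi = 2 * (I ^ 2 / (2 * Real.pi)) := by field_simp
  rw [h2, h3, h4] at h0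
  have h5 : I ^ 2 = 2 * Real.pi * (I ^ 2 / (2 * Real.pi)) := by field_simp
  rw [h5]
  gcongr
  linarith

/-- Integrals of squared norms over a period. -/
def energy (g : ℝ → ℂ) : ℝ := ∫ s in (0 : ℝ)..2 * Real.pi, ‖g s‖ ^ 2

lemma energy_nonneg (g : ℝ → ℂ) : 0 ≤ energy g :=
  intervalIntegral.integral_nonneg Real.two_pi_pos.le fun _ _ => sq_nonneg _

lemma sq_norm_le_energy (hχ : ContDiff ℝ 2 χ) (hp : IsPeriodic χ) (he : IsEven χ)
    (h0 : cosCoeff χ = 0) (x : ℝ) : ‖χ x‖ ^ 2 ≤ 72 * Real.pi * energy (oscillator χ) := by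
  have h1 := norm_le_integral_norm_oscillator hχ hp he h0 x
  have h2 := sq_integral_norm_le (continuous_oscillator hχ)
  calc ‖χ x‖ ^ 2 ≤ (6 * ∫ s in (0 : ℝ)..2 * Real.pi, ‖oscillator χ s‖) ^ 2 := by gcongr
    _ = 36 * (∫ s in (0 : ℝ)..2 * Real.pi, ‖oscillator χ s‖) ^ 2 := by ring
    _ ≤ 36 * (2 * Real.pi * energy (oscillator χ)) := by gcongr; exact h2
    _ = _ := by ring

lemma energy_oscillator (hχ : ContDiff ℝ 4 χ) (hp : IsPeriodic χ) :
    energy (oscillator χ) =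
      ∫ s in (0 : ℝ)..2 * Real.pi, inner ℝ (oscillator (oscillator χ) s) (χ s) := by
  rw [integral_inner_oscillator (oscillator_contDiff_two hχ) (hχ.of_le (by norm_num))
    hp.oscillator hp]
  simp only [real_inner_self_eq_norm_sq, energy]

lemma integral_inner_cos_smul (hχ : Continuous χ) (h0 : cosCoeff χ = 0) (c : ℂ) :
    ∫ s in (0 : ℝ)..2 * Real.pi, inner ℝ (Real.cos s • c) (χ s) = 0 := by
  have h1 : ∫ s in (0 : ℝ)..2 * Real.pi, Real.cos s • χ s = 0 := by
    simpa [cosCoeff, Real.pi_ne_zero] using h0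
  have h2 : ∫ s in (0 : ℝ)..2 * Real.pi, innerSL ℝ c (Real.cos s • χ s) = 0 := by
    rw [ContinuousLinearMap.intervalIntegral_comp_comm _
      ((continuous_cos_smul hχ).intervalIntegrable _ _), h1, map_zero]
  have h3 : ∀ s, inner ℝ (Real.cos s • c) (χ s) = innerSL ℝ c (Real.cos s • χ s) := fun s => by
    rw [innerSL_apply_apply, real_inner_smul_left, real_inner_smul_right]
  simp only [h3, h2]

lemma inner_mul_self (z w : ℂ) : inner ℝ (z * w) w = z.re * ‖w‖ ^ 2 := by
  rw [Complex.inner, Complex.sq_norm, Complex.normSq_apply]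
  simp
  ring

lemma contDiff_cos_smul {n : ℕ∞ω} (c : ℂ) : ContDiff ℝ n fun x => Real.cos x • c :=
  Real.contDiff_cos.smul contDiff_const

lemma iteratedDeriv_two_cos_smul (c : ℂ) :
    iteratedDeriv 2 (fun x => Real.cos x • c) = fun x => -(Real.cos x • c) :=
  (iteratedDeriv_two_of_hasDerivAt (fun x => (Real.hasDerivAt_cos x).smul_const c)
    fun x => (Real.hasDerivAt_sin x).neg.smul_const c).trans (by funext x; simp)

lemma oscillator_cos_smul (c : ℂ) : oscillator (fun x => Real.cos x • c) = 0 := by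
  funext x; simp only [oscillator]; rw [iteratedDeriv_two_cos_smul]; simp

lemma cosCoeff_cos_smul (c : ℂ) : cosCoeff (fun x => Real.cos x • c) = c := by
  rw [cosCoeff_smul_const, cosCoeff_cos, one_smul]

/-- The part of `ψ` orthogonal to the cosine. -/
def remainder (ψ : ℝ → ℂ) (x : ℝ) : ℂ := ψ x - Real.cos x • cosCoeff ψ

lemma contDiff_remainder {n : ℕ∞ω} (hψ : ContDiff ℝ n ψ) : ContDiff ℝ n (remainder ψ) :=
  hψ.sub (contDiff_cos_smul _)

lemma IsPeriodic.remainder (hp : IsPeriodic ψ) : IsPeriodic (remainder ψ) := fun x => by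
  simp [TuringPattern.remainder, hp x]

lemma IsEven.remainder (he : IsEven ψ) : IsEven (remainder ψ) := fun x => by
  simp [TuringPattern.remainder, he x]

lemma cosCoeff_remainder (hψ : Continuous ψ) : cosCoeff (remainder ψ) = 0 := by
  unfold remainder
  rw [cosCoeff_sub hψ (contDiff_cos_smul (n := 0) _).continuous, cosCoeff_cos_smul, sub_self]

lemma oscillator_remainder (hψ : ContDiff ℝ 2 ψ) : oscillator (remainder ψ) = oscillator ψ := by
  unfold remainder
  rw [oscillator_sub hψ (contDiff_cos_smul _), oscillator_cos_smul]
  simp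

/-- Pairing with `cos` removes the differential operator, leaving a scalar equation for the
eigenvalue. -/
lemma mul_cosCoeff_eq (hψ : ContDiff ℝ 4 ψ) (hp : IsPeriodic ψ) (hc : Continuous h)
    (heq : ∀ x, oscillator (oscillator ψ) x = h x - z * ψ x) :
    z * cosCoeff ψ = cosCoeff h := by
  have h1 := cosCoeff_oscillator (oscillator_contDiff_two hψ) hp.oscillator
  rw [show oscillator (oscillator ψ) = fun x => h x - z • ψ x from funext heq,
    cosCoeff_sub hc (show Continuous fun x => z • ψ x from hψ.continuous.const_smul z), cosCoeff_smul, sub_eq_zero] at h1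
  exact h1.symm

/-- Test the equation with the remainder itself; the cosine part of `z ψ` drops out by
orthogonality. -/
lemma energy_remainder_eq (hψ : ContDiff ℝ 4 ψ) (hp : IsPeriodic ψ) (hc : Continuous h)
    (heq : ∀ x, oscillator (oscillator ψ) x = h x - z * ψ x) :
    energy (oscillator (remainder ψ)) =
      (∫ s in (0 : ℝ)..2 * Real.pi, inner ℝ (h s) (remainder ψ s)) -
        z.re * energy (remainder ψ) := by
  have hψ2 : ContDiff ℝ 2 ψ := hψ.of_le (by norm_num)
  have hr := (contDiff_remainder hψ).continuous
  rw [energy_oscillator (contDiff_remainder hψ) hp.remainder, oscillator_remainder hψ2, energy,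
    ← intervalIntegral.integral_const_mul]
  have h1 : ∀ s, inner ℝ (oscillator (oscillator ψ) s) (remainder ψ s) =
      inner ℝ (h s) (remainder ψ s) - z.re * ‖remainder ψ s‖ ^ 2 -
        inner ℝ (Real.cos s • (z * cosCoeff ψ)) (remainder ψ s) := fun s => by
    rw [heq, ← inner_mul_self, ← inner_sub_left, ← inner_sub_left]
    congr 1
    simp only [remainder, Complex.real_smul]; ring
  simp only [h1]
  have c1 : Continuous fun s => inner ℝ (h s) (remainder ψ s) := hc.inner hr
  have c2 : Continuous fun s => z.re * ‖remainder ψ s‖ ^ 2 := by fun_prop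
  have c3 : Continuous fun s => inner ℝ (Real.cos s • (z * cosCoeff ψ)) (remainder ψ s) :=
    (contDiff_cos_smul (n := 0) _).continuous.inner hr
  rw [intervalIntegral.integral_sub ((show Continuous fun s =>
      inner ℝ (h s) (remainder ψ s) - z.re * ‖remainder ψ s‖ ^ 2 from c1.sub c2).intervalIntegrable _ _)
      (c3.intervalIntegrable _ _), intervalIntegral.integral_sub (c1.intervalIntegrable _ _)
      (c2.intervalIntegrable _ _),
    integral_inner_cos_smul hr (cosCoeff_remainder hψ.continuous), sub_zero]

/-- A spectral gap: `energy r ≤ 144 π² energy (r + r'')`, the constant being `72 π` times the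
period, so the energy identity excludes nonzero remainders for `z` to the right of minus its
inverse. -/
lemma remainder_eq_zero (hψ : ContDiff ℝ 4 ψ) (hp : IsPeriodic ψ) (he : IsEven ψ)
    (hz : -(1 / (144 * Real.pi ^ 2)) < z.re)
    (heq : ∀ x, oscillator (oscillator ψ) x = -(z * ψ x)) (x : ℝ) : remainder ψ x = 0 := by
  have hpi := Real.pi_pos
  have h1 := energy_remainder_eq (h := fun _ => 0) hψ hp continuous_const
    (fun x => by rw [heq]; ring)
  simp only [inner_zero_left, intervalIntegral.integral_zero, zero_sub] at h1
  have hr2 : ContDiff ℝ 2 (remainder ψ) := contDiff_remainder (hψ.of_le (by norm_num))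
  have h2 := sq_norm_le_energy hr2 hp.remainder he.remainder (cosCoeff_remainder hψ.continuous)
  set D := energy (oscillator (remainder ψ)) with hD
  have hD0 : 0 ≤ D := energy_nonneg _
  have h3 : energy (remainder ψ) ≤ 144 * Real.pi ^ 2 * D := by
    have h4 : ∫ s in (0 : ℝ)..2 * Real.pi, ‖remainder ψ s‖ ^ 2 ≤
        ∫ s in (0 : ℝ)..2 * Real.pi, 72 * Real.pi * D := by
      have hc := hr2.continuous
      exact intervalIntegral.integral_mono_on Real.two_pi_pos.le
        (Continuous.intervalIntegrable (by fun_prop) _ _)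
        (continuous_const.intervalIntegrable _ _) fun s _ => h2 s
    rw [intervalIntegral.integral_const, smul_eq_mul, sub_zero] at h4
    rw [energy]; linarith
  have hDz : D = 0 := by
    by_contra hne
    have hDp : 0 < D := lt_of_le_of_ne hD0 (Ne.symm hne)
    have h5 : 0 < energy (remainder ψ) := by
      refine lt_of_le_of_ne (energy_nonneg _) fun h => ?_
      rw [← h, mul_zero, neg_zero] at h1
      exact hne h1
    have h6 : D < 1 / (144 * Real.pi ^ 2) * energy (remainder ψ) := by
      rw [h1, ← neg_mul]
      exact mul_lt_mul_of_pos_right (by linarith) h5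
    have h7 : 1 / (144 * Real.pi ^ 2) * energy (remainder ψ) ≤ D := by
      rw [one_div, inv_mul_le_iff₀ (by positivity)]; exact h3
    linarith
  have h8 := h2 x
  rw [hDz, mul_zero] at h8
  have h9 : ‖remainder ψ x‖ = 0 := by
    have := norm_nonneg (remainder ψ x)
    nlinarith
  exact norm_eq_zero.1 h9

lemma norm_remainder_le (hψ : ContDiff ℝ 4 ψ) (hp : IsPeriodic ψ) (he : IsEven ψ)
    (hz : 0 ≤ z.re) (hc : Continuous h) {H : ℝ} (hH : ∀ x, ‖h x‖ ≤ H)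
    (heq : ∀ x, oscillator (oscillator ψ) x = h x - z * ψ x) (x : ℝ) :
    ‖remainder ψ x‖ ≤ 144 * Real.pi ^ 2 * H := by
  have hpi := Real.pi_pos
  have hH0 : 0 ≤ H := (norm_nonneg _).trans (hH 0)
  have hr2 : ContDiff ℝ 2 (remainder ψ) := contDiff_remainder (hψ.of_le (by norm_num))
  have h1 := energy_remainder_eq hψ hp hc heq
  have h2 := sq_norm_le_energy hr2 hp.remainder he.remainder (cosCoeff_remainder hψ.continuous)
  obtain ⟨x₀, -, hx₀⟩ := (isCompact_Icc (a := (0 : ℝ)) (b := 2 * Real.pi)).exists_isMaxOn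
    (Set.nonempty_Icc.2 Real.two_pi_pos.le) hr2.continuous.norm.continuousOn
  have hmax : ∀ x, ‖remainder ψ x‖ ≤ ‖remainder ψ x₀‖ := fun x => by
    obtain ⟨t, ht, hxt⟩ := hp.remainder.exists_mem_Icc x
    rw [hxt]; exact hx₀ ht
  refine (hmax x).trans ?_
  set X := ‖remainder ψ x₀‖
  have h3 : ∫ s in (0 : ℝ)..2 * Real.pi, inner ℝ (h s) (remainder ψ s) ≤
      ∫ s in (0 : ℝ)..2 * Real.pi, H * X := by
    refine intervalIntegral.integral_mono_on Real.two_pi_pos.le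
      ((hc.inner hr2.continuous).intervalIntegrable _ _)
      (continuous_const.intervalIntegrable _ _) fun s _ => ?_
    exact (real_inner_le_norm _ _).trans (mul_le_mul (hH s) (hmax s) (norm_nonneg _) hH0)
  rw [intervalIntegral.integral_const, smul_eq_mul, sub_zero] at h3
  have h4 : 0 ≤ z.re * energy (remainder ψ) := mul_nonneg hz (energy_nonneg _)
  have h5 : X ^ 2 ≤ 72 * Real.pi * (2 * Real.pi * (H * X)) :=
    (h2 x₀).trans (by gcongr; linarith)
  rcases (norm_nonneg (remainder ψ x₀)).eq_or_lt with h0 | h0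
  · rw [show X = 0 from h0.symm]; positivity
  · have h6 : X * X ≤ 144 * Real.pi ^ 2 * H * X := by linarith
    exact le_of_mul_le_mul_right h6 h0

/-- The maximum principle for `φ'' = k φ - f` with complex-valued functions. -/
lemma norm_le_of_iteratedDeriv_two_eq {k f : ℝ → ℂ} {k₀ M : ℝ} (hk₀ : 0 < k₀) (hM : 0 ≤ M)
    (hφ : ContDiff ℝ 2 φ) (hp : IsPeriodic φ) (hk : ∀ x, k₀ ≤ (k x).re) (hf : ∀ x, ‖f x‖ ≤ M)
    (heq : ∀ x, iteratedDeriv 2 φ x = k x * φ x - f x) (x : ℝ) : ‖φ x‖ ≤ M / k₀ := by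
  refine norm_le_of_inner_iteratedDeriv_two hk₀ hM hφ hp (fun x => ?_) x
  rw [heq, inner_sub_left, inner_mul_self]
  have h1 := (real_inner_le_norm (f x) (φ x)).trans
    (mul_le_mul_of_nonneg_right (hf x) (norm_nonneg _))
  have h2 := mul_le_mul_of_nonneg_right (hk x) (sq_nonneg ‖φ x‖)
  linarith

end ComplexLinear

/-! ### Spectrum at the homogeneous state. -/

section Homogeneous

variable {c₀ σ : ℝ}

lemma linearization_apply (c₀ α γ : ℝ) (U : ℝ → ℝ × ℝ) {W : ℝ → ℂ × ℂ} (hW : IsClassical W)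
    (x : ℝ) : linearization c₀ α γ U W x =
      (iteratedDeriv 2 (fun y => (W y).1) x + ((1 / 2 * (1 + 2 * c₀ * (U x).1 - 3 * (U x).1 ^ 2) : ℝ) : ℂ)
          * (W x).1 + (W x).2,
        -oscillator (oscillator fun y => (W y).2) x + (((2 * γ * (U x).1 * (U x).2 : ℝ) : ℂ) * (W x).1
      + (((α - 3 * (U x).2 ^ 2 - γ * (1 - (U x).1 ^ 2) : ℝ)) : ℂ) * (W x).2)) := by
  rw [oscillator_oscillator hW.2]
  simp only [linearization, diffOp, reactionDeriv, Prod.mk_add_mk]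
  ext
  · simp; ring
  · simp

lemma linearization_homState (hσ : σ = 1 ∨ σ = -1) (α γ : ℝ) {W : ℝ → ℂ × ℂ} (hW : IsClassical W)
    (x : ℝ) : linearization c₀ α γ (homState σ) W x =
      (iteratedDeriv 2 (fun y => (W y).1) x - ((1 - σ * c₀ : ℝ) : ℂ) * (W x).1 + (W x).2,
        -oscillator (oscillator fun y => (W y).2) x + (α : ℂ) * (W x).2) := by
  have h2 := sq_eq_one_of_sign hσ
  rw [linearization_apply c₀ α γ _ hW]
  simp only [homState, h2]
  ext
  · push_cast; ring
  · simp

lemma isPeriodic_fst {W : ℝ → ℂ × ℂ} (h : IsPeriodic W) : IsPeriodic fun x => (W x).1 :=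
  fun x => by simp only [h x]

lemma isPeriodic_snd {W : ℝ → ℂ × ℂ} (h : IsPeriodic W) : IsPeriodic fun x => (W x).2 :=
  fun x => by simp only [h x]

lemma isEven_snd {W : ℝ → ℂ × ℂ} (h : IsEven W) : IsEven fun x => (W x).2 :=
  fun x => by simp only [h x]

/-- The linearization is triangular. In the autonomous equation for the second component, `z ≠ α`
removes the cosine part and the spectral gap the rest; the first component then vanishes by the
maximum principle. -/
lemma re_le_of_isEigenvalue_homState (hσ : σ = 1 ∨ σ = -1) {α γ κ : ℝ}
    (hκ : κ < 1 - σ * c₀) (hκ' : κ + |α| < 1 / (144 * Real.pi ^ 2)) {z : ℂ}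
    (hz : IsEigenvalue c₀ α γ (homState σ) z) (hne : z ≠ α) : z.re ≤ -κ := by
  by_contra! hlt
  obtain ⟨W, hW, hp, he, hW0, heq⟩ := hz
  simp only [linearization_homState hσ α γ hW, Prod.ext_iff, Prod.smul_fst, Prod.smul_snd,
    smul_eq_mul] at heq
  have hα := abs_le.1 (le_refl |α|)
  have hosc : ∀ x, oscillator (oscillator fun y => (W y).2) x = -((z - α) * (W x).2) := fun x => by
    linear_combination -(heq x).2
  have hB : cosCoeff (fun y => (W y).2) = 0 := by
    have h1 := mul_cosCoeff_eq (h := fun _ => 0) (z := z - α) hW.2 (isPeriodic_snd hp)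
      continuous_const (fun x => by rw [hosc]; ring)
    rw [show cosCoeff (fun _ : ℝ => (0 : ℂ)) = 0 by simp [cosCoeff]] at h1
    exact (mul_eq_zero.1 h1).resolve_left (sub_ne_zero.2 hne)
  have hψ : ∀ x, (W x).2 = 0 := fun x => by
    have h1 := remainder_eq_zero (z := z - α) hW.2 (isPeriodic_snd hp) (isEven_snd he)
      (by simp only [Complex.sub_re, Complex.ofReal_re]; linarith) hosc x
    simpa [remainder, hB] using h1
  have hφ : ∀ x, (W x).1 = 0 := fun x => by
    have h1 := norm_le_of_iteratedDeriv_two_eq (k := fun _ => z + ((1 - σ * c₀ : ℝ) : ℂ))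
      (f := fun _ => 0) (k₀ := 1 - σ * c₀ - κ) (M := 0) (by linarith) le_rfl hW.1
      (isPeriodic_fst hp) (fun x => by
        simp only [Complex.add_re, Complex.ofReal_re]; linarith) (fun x => by simp)
      (fun x => by
        have := (heq x).1
        rw [hψ x] at this
        linear_combination this) x
    rw [zero_div, norm_le_zero_iff] at h1
    exact h1
  exact hW0 (funext fun x => Prod.ext (hφ x) (hψ x))

lemma criticalMode_eq (c₀ α σ : ℝ) : criticalMode c₀ α σ = fun x =>
    (Real.cos x • ((2 - σ * c₀ + α : ℝ) : ℂ)⁻¹, Real.cos x • (1 : ℂ)) := by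
  funext x
  simp [criticalMode, div_eq_mul_inv]

lemma isClassical_criticalMode (c₀ α σ : ℝ) : IsClassical (criticalMode c₀ α σ) := by
  rw [criticalMode_eq]
  exact ⟨contDiff_cos_smul _, contDiff_cos_smul _⟩

/-- Pairing the second equation with `cos` gives `s = 0`, which excludes Jordan chains. The gap then
makes the second component a multiple of `cos`, and the maximum principle determines the first. -/
lemma isSimpleEigenvalue_homState (hσ : σ = 1 ∨ σ = -1) {α γ : ℝ} (hα : 0 < 1 - σ * c₀ + α) :
    IsSimpleEigenvalue c₀ α γ (homState σ) (α : ℂ) (criticalMode c₀ α σ) := by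
  have hk : ((2 - σ * c₀ + α : ℝ) : ℂ) ≠ 0 := by
    rw [Complex.ofReal_ne_zero]; linarith
  have hzero : ∀ x, oscillator (0 : ℝ → ℂ) x = 0 := fun x => by
    simp [oscillator]
  refine ⟨⟨isClassical_criticalMode _ _ _, fun x => ?_, fun x => ?_, fun h => ?_, fun x => ?_⟩,
    fun W s hW hp he heq => ?_⟩
  · simp [criticalMode_eq]
  · simp [criticalMode_eq]
  · have := congr_fun h 0
    simp [criticalMode_eq] at this
  · rw [linearization_homState hσ α γ (isClassical_criticalMode _ _ _)]
    simp only [criticalMode_eq]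
    rw [iteratedDeriv_two_cos_smul, oscillator_cos_smul, hzero]
    ext
    · simp only [Prod.smul_fst, Complex.real_smul, smul_eq_mul]
      field_simp
      push_cast; ring
    · simp
  · simp only [linearization_homState hσ α γ hW, Prod.ext_iff, Prod.smul_fst, Prod.smul_snd,
      smul_eq_mul, criticalMode_eq, Prod.fst_sub, Prod.snd_sub] at heq
    have hosc : ∀ x, oscillator (oscillator fun y => (W y).2) x = Real.cos x • (-s) - 0 * (W x).2 :=
      fun x => by
        have := (heq x).2
        simp only [Complex.real_smul, mul_one] at this ⊢
        linear_combination -this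
    have hs : s = 0 := by
      have h1 := mul_cosCoeff_eq hW.2 (isPeriodic_snd hp)
        (contDiff_cos_smul (n := 0) (-s)).continuous hosc
      rw [cosCoeff_cos_smul, zero_mul] at h1
      simpa using h1.symm
    subst hs
    refine ⟨rfl, cosCoeff (fun y => (W y).2), ?_⟩
    set B := cosCoeff (fun y => (W y).2)
    have hψ : ∀ x, (W x).2 = Real.cos x • B := fun x => by
      have h1 := remainder_eq_zero (z := 0) hW.2 (isPeriodic_snd hp) (isEven_snd he)
        (by simp only [Complex.zero_re, Left.neg_neg_iff]; positivity)
        (fun x => by rw [hosc]; simp) x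
      exact sub_eq_zero.1 h1
    have hφ : ∀ x, (W x).1 - Real.cos x • (((2 - σ * c₀ + α : ℝ) : ℂ)⁻¹ * B) = 0 := fun x => by
      have hd : ∀ x, iteratedDeriv 2
          (fun x => (W x).1 - Real.cos x • (((2 - σ * c₀ + α : ℝ) : ℂ)⁻¹ * B)) x =
          iteratedDeriv 2 (fun x => (W x).1) x +
            Real.cos x • (((2 - σ * c₀ + α : ℝ) : ℂ)⁻¹ * B) := fun x => by
        rw [iteratedDeriv_fun_sub hW.1.contDiffAt (contDiff_cos_smul _).contDiffAt,
          iteratedDeriv_two_cos_smul]; simp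
      have h1 := norm_le_of_iteratedDeriv_two_eq (k := fun _ => ((1 - σ * c₀ + α : ℝ) : ℂ))
        (φ := fun x => (W x).1 - Real.cos x • (((2 - σ * c₀ + α : ℝ) : ℂ)⁻¹ * B))
        (f := fun _ => 0) (k₀ := 1 - σ * c₀ + α) (M := 0) hα le_rfl
        (hW.1.sub (contDiff_cos_smul _)) (fun x => by simp [hp x]) (fun x => by simp)
        (fun x => by simp) (fun x => by
          have := (heq x).1
          rw [hψ x] at this
          rw [hd]
          simp only [Complex.real_smul] at this ⊢
          have hkk : ((2 - σ * c₀ + α : ℝ) : ℂ) * ((2 - σ * c₀ + α : ℝ) : ℂ)⁻¹ = 1 :=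
            mul_inv_cancel₀ hk
          push_cast [Complex.ofReal_cos] at this hkk ⊢
          linear_combination this + Complex.cos x * B * hkk) x
      rw [zero_div, norm_le_zero_iff] at h1
      exact h1
    funext x
    refine Prod.ext ?_ ?_
    · rw [sub_eq_zero.1 (hφ x)]
      simp only [criticalMode_eq, Pi.smul_apply, Prod.smul_fst, Complex.real_smul, smul_eq_mul]; ring
    · rw [hψ x]
      simp only [criticalMode_eq, Pi.smul_apply, Prod.smul_snd, Complex.real_smul, smul_eq_mul]; ring

end Homogeneous

/-! ### Linear stability of the bifurcating equilibria. -/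

section Stability

/-- Bounds for an unstable mode of a small perturbation of the critical linearization. -/
lemma exists_unstable_mode_bounds {m : ℝ} (hm : 0 < m) : ∃ L : ℝ, 1 ≤ L ∧ ∀ E : ℝ, 0 ≤ E →
    L * E ≤ 1 → ∀ (e k₁ k₂ : ℝ → ℝ) (φ ψ : ℝ → ℂ) (z : ℂ), Continuous k₁ → Continuous k₂ →
    (∀ x, |e x| ≤ E) → (∀ x, |k₁ x| ≤ E) → (∀ x, |k₂ x| ≤ E) → ContDiff ℝ 2 φ → ContDiff ℝ 4 ψ →
    IsPeriodic φ → IsPeriodic ψ → IsEven ψ → 0 ≤ z.re →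
    (∀ x, iteratedDeriv 2 φ x = (z + m + e x) * φ x - ψ x) →
    (∀ x, oscillator (oscillator ψ) x = (k₁ x * ψ x + k₂ x * φ x) - z * ψ x) →
    (∀ x, ‖ψ x‖ ≤ L * ‖cosCoeff ψ‖) ∧ (∀ x, ‖φ x‖ ≤ L * ‖cosCoeff ψ‖) ∧
    (∀ x, ‖remainder ψ x‖ ≤ L * E * ‖cosCoeff ψ‖) ∧
    ∀ x, ‖φ x - Real.cos x * cosCoeff ψ / (1 + m)‖ ≤ L * E * ‖cosCoeff ψ‖ := by
  have hpi := Real.pi_pos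
  obtain ⟨T, hT⟩ : ∃ T, T = 1 + 2 / m := ⟨_, rfl⟩
  have hm2 : 0 < 2 / m := by positivity
  have hT0 : 0 < T := by rw [hT]; positivity
  obtain ⟨K, hK⟩ : ∃ K, K = ((4 * T + 1) * (4 / m) + 288 * Real.pi ^ 2 * T) / m := ⟨_, rfl⟩
  have hK0 : 0 < K := by rw [hK]; positivity
  have hpT : 0 < 288 * Real.pi ^ 2 * T := by positivity
  -- The sum dominates every constant needed below; `L E ≤ 1` also gives `E ≤ m/2`, keeping the
  -- potential above `m/2`, and makes the remainder at most half of `sup ‖ψ‖`.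
  refine ⟨2 + 4 / m + 288 * Real.pi ^ 2 * T + K + 2 / m, by linarith [show 0 < 4 / m by positivity],
    fun E hE hLE e k₁ k₂ φ ψ z hk₁ hk₂ heE hk₁E hk₂E hφ hψ hpφ hpψ heψ hz h₁ h₂ => ?_⟩
  have hm4 : 0 < 4 / m := by positivity
  have hmE : 2 / m * E ≤ 1 := by nlinarith
  have hE1 : E ≤ m / 2 := by
    rw [div_mul_eq_mul_div, div_le_one hm] at hmE; linarith
  have hE2 : 144 * Real.pi ^ 2 * (T * E) ≤ 1 / 2 := by nlinarith
  obtain ⟨x₀, -, hx₀⟩ := (isCompact_Icc (a := (0 : ℝ)) (b := 2 * Real.pi)).exists_isMaxOn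
    (Set.nonempty_Icc.2 Real.two_pi_pos.le) hψ.continuous.norm.continuousOn
  obtain ⟨s, hs⟩ : ∃ s, s = ‖ψ x₀‖ := ⟨_, rfl⟩
  have hs0 : 0 ≤ s := hs ▸ norm_nonneg _
  have hψs : ∀ x, ‖ψ x‖ ≤ s := fun x => by
    obtain ⟨t, ht, hxt⟩ := hpψ.exists_mem_Icc x
    rw [hxt, hs]; exact hx₀ ht
  have hφs : ∀ x, ‖φ x‖ ≤ 2 / m * s := fun x => by
    have := norm_le_of_iteratedDeriv_two_eq (k := fun x => z + m + e x) (half_pos hm) hs0 hφ hpφ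
      (fun x => by
        have := (abs_le.1 (heE x)).1
        simp only [Complex.add_re, Complex.ofReal_re]; linarith) hψs h₁ x
    refine this.trans_eq ?_
    field_simp
  have hh : ∀ x, ‖(k₁ x : ℂ) * ψ x + k₂ x * φ x‖ ≤ T * E * s := fun x => by
    calc _ ≤ |k₁ x| * ‖ψ x‖ + |k₂ x| * ‖φ x‖ := by
          refine (norm_add_le _ _).trans_eq ?_
          simp
      _ ≤ E * s + E * (2 / m * s) := by
          gcongr
          exacts [hk₁E x, hψs x, hk₂E x, hφs x]
      _ = _ := by rw [hT]; ring
  have hhc : Continuous fun x => (k₁ x : ℂ) * ψ x + k₂ x * φ x := by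
    have := hψ.continuous
    have := hφ.continuous
    fun_prop
  obtain ⟨B, hB⟩ : ∃ B, B = cosCoeff ψ := ⟨_, rfl⟩
  have hχ := norm_remainder_le hψ hpψ heψ hz hhc hh h₂
  have hzB := mul_cosCoeff_eq hψ hpψ hhc h₂
  rw [← hB] at hzB ⊢
  have hsB : s ≤ 2 * ‖B‖ := by
    have h3 : ψ x₀ = remainder ψ x₀ + Real.cos x₀ • B := by rw [remainder, hB]; abel
    have h4 : s ≤ 144 * Real.pi ^ 2 * (T * E * s) + ‖B‖ := by
      rw [hs, h3]
      refine (norm_add_le _ _).trans (add_le_add (h3 ▸ hs ▸ hχ x₀) ?_)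
      rw [norm_smul]
      exact mul_le_of_le_one_left (norm_nonneg _) (Real.abs_cos_le_one _)
    nlinarith
  have hβ : 0 ≤ ‖B‖ := norm_nonneg B
  have hφB : ∀ x, ‖φ x‖ ≤ 4 / m * ‖B‖ := fun x => by
    calc _ ≤ 2 / m * (2 * ‖B‖) := (hφs x).trans (by gcongr)
      _ = _ := by ring
  have hχB : ∀ x, ‖remainder ψ x‖ ≤ 288 * Real.pi ^ 2 * T * E * ‖B‖ := fun x => by
    calc _ ≤ 144 * Real.pi ^ 2 * (T * E * (2 * ‖B‖)) := (hχ x).trans (by gcongr)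
      _ = _ := by ring
  -- No upper bound on `z` is assumed; the cosine projection supplies `‖z‖ ‖B‖ = O(E ‖B‖)`, so `z φ`
  -- is a small source term.
  have hzφ : ∀ x, ‖z * φ x‖ ≤ 4 * T * E * (4 / m * ‖B‖) := fun x => by
    have h3 : ‖z‖ * ‖B‖ ≤ 4 * T * E * ‖B‖ := by
      rw [← norm_mul, hzB]
      refine (norm_cosCoeff_le fun x _ => hh x).trans ?_
      calc 2 * (T * E * s) ≤ 2 * (T * E * (2 * ‖B‖)) := by gcongr
        _ = _ := by ring
    rw [norm_mul]
    calc ‖z‖ * ‖φ x‖ ≤ ‖z‖ * (4 / m * ‖B‖) := by gcongr; exact hφB x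
      _ = 4 / m * (‖z‖ * ‖B‖) := by ring
      _ ≤ 4 / m * (4 * T * E * ‖B‖) := by gcongr
      _ = _ := by ring
  have hm1 : (1 + m : ℂ) ≠ 0 := by
    have : ((1 + m : ℝ) : ℂ) ≠ 0 := by rw [Complex.ofReal_ne_zero]; positivity
    simpa using this
  -- The subtracted multiple of `cos` solves the limit equation `φ'' = m φ - B cos` exactly, so the
  -- difference has only small sources.
  have hθ : ∀ x, ‖φ x - Real.cos x • (B / (1 + m))‖ ≤ K * E * ‖B‖ := fun x => by
    have hd : ∀ x, iteratedDeriv 2 (fun x => φ x - Real.cos x • (B / (1 + m))) x =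
        iteratedDeriv 2 φ x + Real.cos x • (B / (1 + m)) := fun x => by
      rw [iteratedDeriv_fun_sub hφ.contDiffAt (contDiff_cos_smul _).contDiffAt,
        iteratedDeriv_two_cos_smul]; simp
    have h3 := norm_le_of_iteratedDeriv_two_eq (k := fun _ => (m : ℂ)) (k₀ := m)
      (φ := fun x => φ x - Real.cos x • (B / (1 + m)))
      (f := fun x => remainder ψ x - z * φ x - e x * φ x)
      (M := (288 * Real.pi ^ 2 * T + (4 * T + 1) * (4 / m)) * E * ‖B‖) hm (by positivity)
      (hφ.sub (contDiff_cos_smul _)) (fun x => by simp [hpφ x]) (fun x => by simp)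
      (fun x => by
        have h4 : ‖(e x : ℂ) * φ x‖ ≤ E * (4 / m * ‖B‖) := by
          rw [norm_mul, Complex.norm_real, Real.norm_eq_abs]
          gcongr
          exacts [heE x, hφB x]
        have h5 := norm_sub_le (remainder ψ x - z * φ x) (e x * φ x)
        have h6 := norm_sub_le (remainder ψ x) (z * φ x)
        have h7 := hzφ x
        have h8 := hχB x
        calc _ ≤ 288 * Real.pi ^ 2 * T * E * ‖B‖ + 4 * T * E * (4 / m * ‖B‖) +
              E * (4 / m * ‖B‖) := by linarith
          _ = _ := by ring)
      (fun x => by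
        rw [hd, h₁, remainder, ← hB]
        simp only [Complex.real_smul]
        field_simp
        ring) x
    refine h3.trans_eq ?_
    rw [hK]; ring
  have hEB : 0 ≤ E * ‖B‖ := by positivity
  refine ⟨fun x => (hψs x).trans (hsB.trans ?_), fun x => (hφB x).trans ?_,
    fun x => (hχB x).trans ?_, fun x => ?_⟩
  · gcongr; linarith
  · gcongr; linarith
  · gcongr; linarith
  · have h3 := hθ x
    rw [Complex.real_smul, ← mul_div_assoc] at h3
    refine h3.trans ?_
    gcongr; linarith

variable {c₀ σ : ℝ}

/-- The amplitude expansion of the states on the branch. -/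
structure IsNearMode (c₀ σ ε A M : ℝ) (p v : ℝ → ℝ) : Prop where
  cont_fst : Continuous p
  cont_snd : Continuous v
  amplitude_le : |A| ≤ M * ε
  fst_le : ∀ x, |p x - A * Real.cos x / (2 - σ * c₀)| ≤ M * ε ^ 2
  snd_le : ∀ x, |v x - A * Real.cos x| ≤ M * ε ^ 2

lemma IsNearMode.abs_fst_le {ε A M : ℝ} {p v : ℝ → ℝ} (h : IsNearMode c₀ σ ε A M p v)
    (hm : 0 < 1 - σ * c₀) (hε : 0 < ε) (hε1 : ε ≤ 1) (hM : 1 ≤ M) (x : ℝ) :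
    |A * Real.cos x / (2 - σ * c₀)| ≤ M * ε ∧ |p x| ≤ 2 * M * ε := by
  have h1 : |A * Real.cos x / (2 - σ * c₀)| ≤ M * ε := by
    rw [abs_div, abs_mul, abs_of_pos (show 0 < 2 - σ * c₀ by linarith), div_le_iff₀ (by linarith)]
    calc |A| * |Real.cos x| ≤ M * ε * 1 :=
          mul_le_mul h.amplitude_le (Real.abs_cos_le_one x) (abs_nonneg _) (by positivity)
      _ ≤ M * ε * (2 - σ * c₀) := by gcongr; linarith
  have h2 : M * ε ^ 2 ≤ M * ε := by gcongr; nlinarith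
  refine ⟨h1, ?_⟩
  have := abs_sub_abs_le_abs_sub (p x) (A * Real.cos x / (2 - σ * c₀))
  linarith [h.fst_le x]

lemma IsNearMode.abs_snd_le {ε A M : ℝ} {p v : ℝ → ℝ} (h : IsNearMode c₀ σ ε A M p v)
    (hε : 0 < ε) (hε1 : ε ≤ 1) (hM : 1 ≤ M) (x : ℝ) :
    |A * Real.cos x| ≤ M * ε ∧ |v x| ≤ 2 * M * ε := by
  have h1 : |A * Real.cos x| ≤ M * ε := by
    rw [abs_mul]
    calc |A| * |Real.cos x| ≤ M * ε * 1 :=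
          mul_le_mul h.amplitude_le (Real.abs_cos_le_one x) (abs_nonneg _) (by positivity)
      _ = M * ε := mul_one _
  have h2 : M * ε ^ 2 ≤ M * ε := by gcongr; nlinarith
  refine ⟨h1, ?_⟩
  have := abs_sub_abs_le_abs_sub (v x) (A * Real.cos x)
  linarith [h.snd_le x]

/-- The second coefficient is the largest: `21 = 1 + 12 + 8`, from `ε²`, `3 v²` and the `γ` term. -/
lemma IsNearMode.abs_coefficients_le {ε A M γ : ℝ} {p v : ℝ → ℝ} (h : IsNearMode c₀ σ ε A M p v)
    (hσ : σ = 1 ∨ σ = -1) (hc₀ : 0 < c₀) (hc₀' : c₀ < 1) (hε : 0 < ε) (hε1 : ε ≤ 1) (hM : 1 ≤ M)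
    (hγ : 0 < γ) (hγ1 : γ ≤ 1) (x : ℝ) :
    |(3 * σ - c₀) * p x + 3 / 2 * p x ^ 2| ≤ 21 * M ^ 2 * ε ∧
    |ε ^ 2 - 3 * v x ^ 2 + γ * (2 * σ * p x + p x ^ 2)| ≤ 21 * M ^ 2 * ε ∧
    |2 * γ * (σ + p x) * v x| ≤ 21 * M ^ 2 * ε := by
  have hp := (h.abs_fst_le (one_sub_sign_mul_pos hc₀ hc₀' hσ) hε hε1 hM x).2
  have hv := (h.abs_snd_le hε hε1 hM x).2
  have hσ1 : |σ| = 1 := by rcases hσ with rfl | rfl <;> norm_num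
  have hε2 : ε ^ 2 ≤ ε := by nlinarith
  have hM2 : M ≤ M ^ 2 := by nlinarith
  have hM1 : 1 ≤ M ^ 2 := by nlinarith
  have hMε : M * ε ≤ M ^ 2 * ε := by gcongr
  have hεM : ε ≤ M ^ 2 * ε := by nlinarith
  have hsq : ∀ {t : ℝ}, |t| ≤ 2 * M * ε → t ^ 2 ≤ 4 * (M ^ 2 * ε) := fun {t} ht => by
    calc t ^ 2 = |t| ^ 2 := (sq_abs t).symm
      _ ≤ (2 * M * ε) ^ 2 := by gcongr
      _ = 4 * (M ^ 2 * ε ^ 2) := by ring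
      _ ≤ _ := by gcongr
  have hp2 := hsq hp
  have hv2 := hsq hv
  have hp0 := sq_nonneg (p x)
  have hv0 := sq_nonneg (v x)
  refine ⟨?_, ?_, ?_⟩
  · have h1 : |(3 * σ - c₀) * p x| ≤ 4 * (2 * M * ε) := by
      rw [abs_mul]
      gcongr
      rw [abs_le]
      rcases hσ with rfl | rfl <;> constructor <;> linarith
    refine (abs_add_le _ _).trans ?_
    rw [abs_of_nonneg (show 0 ≤ 3 / 2 * p x ^ 2 by positivity)]
    linarith
  · have h1 : |2 * σ * p x + p x ^ 2| ≤ 8 * (M ^ 2 * ε) := by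
      refine (abs_add_le _ _).trans ?_
      rw [abs_mul, abs_mul, hσ1, abs_of_nonneg hp0, abs_two]
      linarith
    have h2 : |γ * (2 * σ * p x + p x ^ 2)| ≤ 8 * (M ^ 2 * ε) := by
      rw [abs_mul, abs_of_pos hγ]
      exact (mul_le_of_le_one_left (abs_nonneg _) hγ1).trans h1
    obtain ⟨h3, h4⟩ := abs_le.1 h2
    have := sq_nonneg ε
    rw [abs_le]
    constructor <;> linarith
  · have h1 : |σ + p x| ≤ 3 * M := by
      refine (abs_add_le _ _).trans ?_
      rw [hσ1]
      have : M * ε ≤ M := mul_le_of_le_one_right (by linarith) hε1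
      linarith
    rw [abs_mul, abs_mul, abs_of_pos (show 0 < 2 * γ by positivity)]
    calc 2 * γ * |σ + p x| * |v x| ≤ 2 * 1 * (3 * M) * (2 * M * ε) := by gcongr
      _ ≤ _ := by nlinarith

/-- An unstable eigenvalue would be close to `ε² - 9 A² / 4`. -/
lemma exists_eigenvalue_expansion (hσ : σ = 1 ∨ σ = -1) (hc₀ : 0 < c₀) (hc₀' : c₀ < 1) {M : ℝ}
    (hM : 1 ≤ M) : ∃ C : ℝ, 1 ≤ C ∧ ∀ (ε γ A : ℝ) (p v : ℝ → ℝ), 0 < ε → C * ε ≤ 1 → 0 < γ →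
      γ ≤ 1 → IsNearMode c₀ σ ε A M p v → ∀ z : ℂ,
      IsEigenvalue c₀ (ε ^ 2) γ (fun x => (σ + p x, v x)) z → 0 ≤ z.re →
      ‖z - (ε ^ 2 - 9 / 4 * A ^ 2 : ℝ)‖ ≤ C * (ε + γ) * ε ^ 2 := by
  have hm := one_sub_sign_mul_pos hc₀ hc₀' hσ
  obtain ⟨L, hL1, hL⟩ := exists_unstable_mode_bounds hm
  refine ⟨200 * M ^ 4 * L, by nlinarith [one_le_pow₀ hM (n := 4)],
    fun ε γ A p v hε hCε hγ hγ1 hN z hz hz0 => ?_⟩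
  obtain ⟨W, hW, hper, heven, hW0, heq⟩ := hz
  have hM4 : 1 ≤ M ^ 4 := one_le_pow₀ hM
  have hM2 : 1 ≤ M ^ 2 := one_le_pow₀ hM
  have hM24 : M ^ 2 ≤ M ^ 4 := pow_le_pow_right₀ hM (by norm_num)
  have hLM : 1 ≤ L * M ^ 4 := by nlinarith
  have hε1 : ε ≤ 1 := by nlinarith
  obtain ⟨E, hE⟩ : ∃ E, E = 21 * M ^ 2 * ε := ⟨_, rfl⟩
  have hE0 : 0 ≤ E := by rw [hE]; positivity
  have hLE : L * E ≤ 1 := by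
    calc L * E = 21 * (M ^ 2) * (L * ε) := by rw [hE]; ring
      _ ≤ 200 * (M ^ 4) * (L * ε) := by gcongr; norm_num
      _ = 200 * M ^ 4 * L * ε := by ring
      _ ≤ 1 := hCε
  have hcoef := hN.abs_coefficients_le hσ hc₀ hc₀' hε hε1 hM hγ hγ1
  rw [← hE] at hcoef
  have hσ2 := sq_eq_one_of_sign hσ
  have hσ1 : |σ| = 1 := by rcases hσ with rfl | rfl <;> norm_num
  simp only [linearization_apply c₀ (ε ^ 2) γ _ hW, Prod.ext_iff, Prod.smul_fst, Prod.smul_snd,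
    smul_eq_mul] at heq
  have hpc := hN.cont_fst
  have hvc := hN.cont_snd
  have hσ2' : (σ : ℂ) ^ 2 = 1 := by exact_mod_cast hσ2
  obtain ⟨φ, hφ⟩ : ∃ φ : ℝ → ℂ, φ = fun x => (W x).1 := ⟨_, rfl⟩
  obtain ⟨ψ, hψ⟩ : ∃ ψ : ℝ → ℂ, ψ = fun x => (W x).2 := ⟨_, rfl⟩
  have hφx : ∀ x, (W x).1 = φ x := fun x => by rw [hφ]
  have hψx : ∀ x, (W x).2 = ψ x := fun x => by rw [hψ]
  rw [← hφ, ← hψ] at heq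
  simp only [hφx, hψx] at heq
  have hψ4 : ContDiff ℝ 4 ψ := hψ ▸ hW.2
  have hφ2 : ContDiff ℝ 2 φ := hφ ▸ hW.1
  have hpψ : IsPeriodic ψ := hψ ▸ isPeriodic_snd hper
  have h₂ : ∀ x, oscillator (oscillator ψ) x =
      (((ε ^ 2 - 3 * v x ^ 2 + γ * (2 * σ * p x + p x ^ 2) : ℝ) : ℂ) * ψ x +
        ((2 * γ * (σ + p x) * v x : ℝ) : ℂ) * φ x) - z * ψ x := fun x => by
    have := (heq x).2
    push_cast at this ⊢
    linear_combination -this + γ * ψ x * hσ2'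
  obtain ⟨hb₁, hb₂, hb₃, hb₄⟩ := hL E hE0 hLE
    (fun x => (3 * σ - c₀) * p x + 3 / 2 * p x ^ 2)
    (fun x => ε ^ 2 - 3 * v x ^ 2 + γ * (2 * σ * p x + p x ^ 2))
    (fun x => 2 * γ * (σ + p x) * v x) φ ψ z (by fun_prop) (by fun_prop)
    (fun x => (hcoef x).1) (fun x => (hcoef x).2.1) (fun x => (hcoef x).2.2) hφ2 hψ4
    (hφ ▸ isPeriodic_fst hper) hpψ (hψ ▸ isEven_snd heven) hz0
    (fun x => by
      have := (heq x).1
      push_cast at this ⊢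
      linear_combination this + 3 / 2 * φ x * hσ2') h₂
  have hzB := mul_cosCoeff_eq hψ4 hpψ (by
    have := hψ4.continuous
    have := hφ2.continuous
    fun_prop) h₂
  obtain ⟨B, hB⟩ : ∃ B, B = cosCoeff ψ := ⟨_, rfl⟩
  rw [← hB] at hb₁ hb₂ hb₃ hb₄ hzB
  have hB0 : 0 < ‖B‖ := by
    refine lt_of_le_of_ne (norm_nonneg _) fun h => hW0 (funext fun x => ?_)
    have h1 := hb₁ x
    have h2 := hb₂ x
    rw [← h, mul_zero, norm_le_zero_iff] at h1 h2
    exact Prod.ext ((hφx x).trans h2) ((hψx x).trans h1)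
  have hd1 : 1 ≤ 2 - σ * c₀ := by linarith
  have hd0 : ((2 - σ * c₀ : ℝ) : ℂ) ≠ 0 := by rw [Complex.ofReal_ne_zero]; linarith
  have hd : (1 + ((1 - σ * c₀ : ℝ) : ℂ)) = ((2 - σ * c₀ : ℝ) : ℂ) := by push_cast; ring
  rw [hd] at hb₄
  -- The error of replacing the state and the eigenfunction by their leading cosine modes.
  obtain ⟨r, hr⟩ : ∃ r : ℝ → ℂ, r = fun x =>
      -3 * (((v x ^ 2 - (A * Real.cos x) ^ 2 : ℝ) : ℂ) * ψ x +
        (((A * Real.cos x) ^ 2 : ℝ) : ℂ) * remainder ψ x) +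
      ((2 * γ * σ : ℝ) : ℂ) * (((p x - A * Real.cos x / (2 - σ * c₀) : ℝ) : ℂ) * ψ x +
        ((A * Real.cos x / (2 - σ * c₀) : ℝ) : ℂ) * remainder ψ x +
        ((v x - A * Real.cos x : ℝ) : ℂ) * φ x +
        ((A * Real.cos x : ℝ) : ℂ) * (φ x - Real.cos x * B / ((2 - σ * c₀ : ℝ) : ℂ))) +
      ((γ : ℝ) : ℂ) * (((p x ^ 2 : ℝ) : ℂ) * ψ x + ((2 * p x * v x : ℝ) : ℂ) * φ x) := ⟨_, rfl⟩
  -- Of the leading part, the `cos³` term contributes `-(9/4) A² B` to the cosine coefficient, while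
  -- the `γ` coupling is a multiple of `cos²` and contributes nothing.
  have hsplit : (fun x => ((ε ^ 2 - 3 * v x ^ 2 + γ * (2 * σ * p x + p x ^ 2) : ℝ) : ℂ) * ψ x +
        ((2 * γ * (σ + p x) * v x : ℝ) : ℂ) * φ x) = fun x =>
      ((((ε ^ 2 : ℝ) : ℂ) • ψ x + (Real.cos x ^ 3) • (((-3 * A ^ 2 : ℝ) : ℂ) * B)) +
        (Real.cos x ^ 2) • (((4 * γ * σ * A / (2 - σ * c₀) : ℝ) : ℂ) * B)) + r x := by
    funext x
    simp only [hr, remainder, ← hB, Complex.real_smul, smul_eq_mul]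
    push_cast at hd0 ⊢
    field_simp
    ring
  have hrc : Continuous r := by
    have h1 := hψ4.continuous
    have h2 := hφ2.continuous
    have h3 := (contDiff_remainder (n := 0) (contDiff_zero.2 h1)).continuous
    rw [hr]
    fun_prop
  have hψc := hψ4.continuous
  have hcoeffs : (z - (ε ^ 2 - 9 / 4 * A ^ 2 : ℝ)) * B = cosCoeff r := by
    rw [hsplit, cosCoeff_add (by fun_prop) hrc, cosCoeff_add (by fun_prop) (by fun_prop),
      cosCoeff_add (by fun_prop) (by fun_prop), cosCoeff_smul, cosCoeff_smul_const,
      cosCoeff_smul_const, cosCoeff_cos_cube, cosCoeff_cos_sq, ← hB] at hzB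
    simp only [smul_eq_mul, Complex.real_smul] at hzB
    push_cast at hzB ⊢
    linear_combination hzB
  have hrb : ∀ x, ‖r x‖ ≤ 100 * M ^ 4 * L * (ε + γ) * ε ^ 2 * ‖B‖ := fun x => by
    obtain ⟨hA1, hp⟩ := hN.abs_fst_le hm hε hε1 hM x
    obtain ⟨hA2, hv⟩ := hN.abs_snd_le hε hε1 hM x
    have hfst := hN.fst_le x
    have hsnd := hN.snd_le x
    have hψb := hb₁ x
    have hφb := hb₂ x
    have hχb := hb₃ x
    have hθb := hb₄ x
    have hM0 : 0 ≤ M := by linarith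
    have hL0 : 0 ≤ L := by linarith
    have hv2 : |v x ^ 2 - (A * Real.cos x) ^ 2| ≤ M * ε ^ 2 * (3 * M * ε) := by
      rw [sq_sub_sq, mul_comm, abs_mul]
      gcongr
      exact (abs_add_le _ _).trans (by linarith)
    have hA22 : |(A * Real.cos x) ^ 2| ≤ (M * ε) ^ 2 := by
      rw [abs_pow]; gcongr
    have hp2 : |p x ^ 2| ≤ (2 * M * ε) ^ 2 := by
      rw [abs_pow]; gcongr
    have hpv : |2 * p x * v x| ≤ 2 * (2 * M * ε) * (2 * M * ε) := by
      rw [abs_mul, abs_mul, abs_two]; gcongr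
    have hprod : ∀ {a : ℝ} {w : ℂ} {s t : ℝ}, |a| ≤ s → ‖w‖ ≤ t → ‖(a : ℂ) * w‖ ≤ s * t :=
      fun {a w s t} h1 h2 => by
        rw [norm_mul, Complex.norm_real, Real.norm_eq_abs]
        exact mul_le_mul h1 h2 (norm_nonneg _) ((abs_nonneg _).trans h1)
    have t1 : ‖(-3 : ℂ) * (((v x ^ 2 - (A * Real.cos x) ^ 2 : ℝ) : ℂ) * ψ x +
        (((A * Real.cos x) ^ 2 : ℝ) : ℂ) * remainder ψ x)‖ ≤
        3 * (M * ε ^ 2 * (3 * M * ε) * (L * ‖B‖) + (M * ε) ^ 2 * (L * E * ‖B‖)) := by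
      rw [norm_mul, norm_neg, Complex.norm_ofNat]
      gcongr
      exact (norm_add_le _ _).trans (add_le_add (hprod hv2 hψb) (hprod hA22 hχb))
    have t2 : ‖((2 * γ * σ : ℝ) : ℂ) * (((p x - A * Real.cos x / (2 - σ * c₀) : ℝ) : ℂ) * ψ x +
        ((A * Real.cos x / (2 - σ * c₀) : ℝ) : ℂ) * remainder ψ x +
        ((v x - A * Real.cos x : ℝ) : ℂ) * φ x +
        ((A * Real.cos x : ℝ) : ℂ) * (φ x - Real.cos x * B / ((2 - σ * c₀ : ℝ) : ℂ)))‖ ≤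
        2 * γ * (M * ε ^ 2 * (L * ‖B‖) + M * ε * (L * E * ‖B‖) + M * ε ^ 2 * (L * ‖B‖) +
          M * ε * (L * E * ‖B‖)) := by
      refine hprod (by rw [abs_mul, hσ1, mul_one, abs_of_pos (by positivity)]) ?_
      exact (norm_add_le _ _).trans (add_le_add ((norm_add_le _ _).trans (add_le_add
        ((norm_add_le _ _).trans (add_le_add (hprod hfst hψb) (hprod hA1 hχb)))
        (hprod hsnd hφb))) (hprod hA2 hθb))
    have t3 : ‖((γ : ℝ) : ℂ) * (((p x ^ 2 : ℝ) : ℂ) * ψ x + ((2 * p x * v x : ℝ) : ℂ) * φ x)‖ ≤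
        γ * ((2 * M * ε) ^ 2 * (L * ‖B‖) + 2 * (2 * M * ε) * (2 * M * ε) * (L * ‖B‖)) := by
      refine hprod (abs_of_pos hγ).le ?_
      exact (norm_add_le _ _).trans (add_le_add (hprod hp2 hψb) (hprod hpv hφb))
    have hM3 : M ^ 3 ≤ M ^ 4 := pow_le_pow_right₀ hM (by norm_num)
    have hM14 : M ≤ M ^ 4 := by simpa using pow_le_pow_right₀ hM (show 1 ≤ 4 by norm_num)
    rw [hr]
    calc _ ≤ 3 * (M * ε ^ 2 * (3 * M * ε) * (L * ‖B‖) + (M * ε) ^ 2 * (L * E * ‖B‖)) +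
          2 * γ * (M * ε ^ 2 * (L * ‖B‖) + M * ε * (L * E * ‖B‖) + M * ε ^ 2 * (L * ‖B‖) +
          M * ε * (L * E * ‖B‖)) +
          γ * ((2 * M * ε) ^ 2 * (L * ‖B‖) + 2 * (2 * M * ε) * (2 * M * ε) * (L * ‖B‖)) :=
          (norm_add_le _ _).trans (add_le_add ((norm_add_le _ _).trans (add_le_add t1 t2)) t3)
      _ = ((9 * M ^ 2 + 63 * M ^ 4) * ε + (4 * M + 84 * M ^ 3 + 12 * M ^ 2) * γ) *
            (L * ε ^ 2 * ‖B‖) := by rw [hE]; ring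
      _ ≤ (100 * M ^ 4 * ε + 100 * M ^ 4 * γ) * (L * ε ^ 2 * ‖B‖) := by
          gcongr <;> linarith
      _ = _ := by ring
  have hfin := norm_cosCoeff_le fun x (_ : x ∈ Set.Icc (0 : ℝ) (2 * Real.pi)) => hrb x
  rw [← hcoeffs, norm_mul] at hfin
  refine le_of_mul_le_mul_right (hfin.trans_eq ?_) hB0
  ring

/-- From `A² ≥ ε²` the leading term is at most `-(5/4) ε²`, and `ε, γ < 1/(2C)` keeps the error
below `(5/4) ε²`, so the real part cannot be nonnegative. -/
lemma exists_stability (hσ : σ = 1 ∨ σ = -1) (hc₀ : 0 < c₀) (hc₀' : c₀ < 1) {M : ℝ}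
    (hM : 1 ≤ M) : ∃ r > 0, ∀ (ε γ A : ℝ) (p v : ℝ → ℝ), 0 < ε → ε < r → 0 < γ → γ < r →
      IsNearMode c₀ σ ε A M p v → ε ^ 2 ≤ A ^ 2 →
      IsLinearlyStable c₀ (ε ^ 2) γ (fun x => (σ + p x, v x)) := by
  obtain ⟨C, hC1, hC⟩ := exists_eigenvalue_expansion hσ hc₀ hc₀' hM
  have hC0 : 0 < C := by linarith
  refine ⟨1 / (2 * C), by positivity, fun ε γ A p v hε hεr hγ hγr hN hA z hz => ?_⟩
  rw [lt_div_iff₀ (by positivity)] at hεr hγr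
  by_contra! hre
  have h1 := hC ε γ A p v hε (by nlinarith) hγ (by nlinarith) hN z hz hre
  have h2 := (Complex.abs_re_le_norm _).trans h1
  rw [Complex.sub_re, Complex.ofReal_re] at h2
  have h3 := (abs_le.1 h2).2
  have h4 : C * (ε + γ) * ε ^ 2 < 5 / 4 * ε ^ 2 := by
    have : 0 < ε ^ 2 := by positivity
    gcongr
    nlinarith
  nlinarith

end Stability

/-! ### Symmetries, smoothness and assembly of the branch. -/

section Equilibria

open EvenPer Filter Topology

variable {c₀ σ α γ : ℝ}

lemma diffOp_translate {K : Type} [RCLike K] (U : ℝ → K × K) (x₀ x : ℝ) :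
    diffOp (fun x => U (x - x₀)) x = diffOp U (x - x₀) := by
  simp only [diffOp]
  rw [iteratedDeriv_comp_sub_const (f := fun y => (U y).1),
    iteratedDeriv_comp_sub_const (f := fun y => (U y).2),
    iteratedDeriv_comp_sub_const (f := fun y => (U y).2)]

lemma IsClassical.translate {K : Type} [RCLike K] {U : ℝ → K × K} (h : IsClassical U) (x₀ : ℝ) :
    IsClassical fun x => U (x - x₀) :=
  ⟨h.1.comp (contDiff_id.sub contDiff_const), h.2.comp (contDiff_id.sub contDiff_const)⟩

lemma IsPeriodic.translate {E : Type} {U : ℝ → E} (h : IsPeriodic U) (x₀ : ℝ) :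
    IsPeriodic fun x => U (x - x₀) := fun x => by
  simp only
  rw [add_sub_right_comm, h]

lemma IsEquilibrium.translate {U : ℝ → ℝ × ℝ} (h : IsEquilibrium c₀ α γ U) (x₀ : ℝ) :
    IsEquilibrium c₀ α γ fun x => U (x - x₀) :=
  ⟨h.1.translate x₀, fun x => by rw [diffOp_translate]; exact h.2 (x - x₀)⟩

lemma IsPeriodic.add_pi {E : Type} {U : ℝ → E} (h : IsPeriodic U) :
    (fun x => U (x + Real.pi)) = fun x => U (x - Real.pi) := by
  funext x
  rw [← h (x - Real.pi)]
  congr 1; ring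

lemma IsEven.add_pi {E : Type} {U : ℝ → E} (he : IsEven U) (hp : IsPeriodic U) :
    IsEven fun x => U (x + Real.pi) := fun x => by
  simp only
  rw [show -x + Real.pi = -(x - Real.pi) by ring, he]
  exact (congr_fun hp.add_pi x).symm

/-- Translation by `π` preserves even `2π`-periodic functions and conjugates the two linearizations.
-/
lemma IsLinearlyStable.add_pi {U : ℝ → ℝ × ℝ} (h : IsLinearlyStable c₀ α γ U) :
    IsLinearlyStable c₀ α γ fun x => U (x + Real.pi) := by
  rintro z ⟨W, hW, hp, he, h0, heq⟩
  refine h z ⟨fun x => W (x - Real.pi), hW.translate _, hp.translate _, ?_, fun hz => h0 ?_,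
    fun x => ?_⟩
  · rw [← hp.add_pi]; exact he.add_pi hp
  · funext x
    have := congr_fun hz (x + Real.pi)
    simpa using this
  · have := heq (x - Real.pi)
    simp only [linearization, sub_add_cancel] at this
    simp only [linearization, diffOp_translate]
    exact this

lemma isEquilibrium_homState (hσ : σ = 1 ∨ σ = -1) : IsEquilibrium c₀ α γ (homState σ) := by
  refine ⟨⟨contDiff_const, contDiff_const⟩, fun x => ?_⟩
  simp [diffOp, homState, reaction, sq_eq_one_of_sign hσ, iteratedDeriv_succ]

/-- Equilibria are smooth. -/
lemma IsEquilibrium.contDiff {U : ℝ → ℝ × ℝ} (h : IsEquilibrium c₀ α γ U) : ContDiff ℝ ∞ U := by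
  obtain ⟨⟨hu, hv⟩, heq⟩ := h
  obtain ⟨u, hu'⟩ : ∃ u : ℝ → ℝ, u = fun x => (U x).1 := ⟨_, rfl⟩
  obtain ⟨v, hv'⟩ : ∃ v : ℝ → ℝ, v = fun x => (U x).2 := ⟨_, rfl⟩
  have hux : ∀ x, (U x).1 = u x := fun x => by rw [hu']
  have hvx : ∀ x, (U x).2 = v x := fun x => by rw [hv']
  rw [← hu'] at hu
  rw [← hv'] at hv
  simp only [diffOp, reaction, hux, hvx, Prod.ext_iff, Prod.fst_add, Prod.snd_add,
    Prod.fst_zero, Prod.snd_zero] at heq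
  have h1 : iteratedDeriv 2 u = fun x => -(1 / 2 * (u x - c₀) * (1 - u x ^ 2) + v x) :=
    funext fun x => by linear_combination (heq x).1
  have h2 : iteratedDeriv 2 v = fun x => oscillator v x - v x := funext fun x => by
    simp [oscillator]
  have h3 : iteratedDeriv 2 (oscillator v) = fun x =>
      α * v x - v x ^ 3 - γ * v x * (1 - u x ^ 2) - oscillator v x := funext fun x => by
    have h4 := oscillator_oscillator hv x
    have h5 : oscillator (oscillator v) x = oscillator v x + iteratedDeriv 2 (oscillator v) x := rfl
    rw [smul_eq_mul] at h4
    linear_combination -(heq x).2 + h4 - h5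
  have hy := oscillator_contDiff_two hv
  have hv2 : ContDiff ℝ 2 v := hv.of_le (by norm_num)
  -- With `v + v''` as a third unknown the equations form a second-order system, so each round of
  -- the bootstrap gains regularity for all three functions.
  have key : ∀ n : ℕ, ContDiff ℝ n u ∧ ContDiff ℝ n v ∧ ContDiff ℝ n (oscillator v) := by
    intro n
    induction n with
    | zero => exact ⟨hu.of_le (by simp), hv2.of_le (by simp), hy.of_le (by simp)⟩
    | succ n ih =>
      obtain ⟨iu, iv, iy⟩ := ih
      have hle : ((n + 1 : ℕ) : ℕ∞ω) ≤ (n + 2 : ℕ) := by exact_mod_cast Nat.le_succ (n + 1)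
      refine ⟨(contDiff_add_two_of_iteratedDeriv hu ?_).of_le hle,
        (contDiff_add_two_of_iteratedDeriv hv2 ?_).of_le hle,
        (contDiff_add_two_of_iteratedDeriv hy ?_).of_le hle⟩
      · rw [h1]; fun_prop
      · rw [h2]; fun_prop
      · rw [h3]; fun_prop
  have : U = fun x => (u x, v x) := funext fun x => Prod.ext (hux x) (hvx x)
  rw [this]
  exact (contDiff_infty.2 fun n => (key n).1).prodMk (contDiff_infty.2 fun n => (key n).2.1)

/-- The bifurcating branch of periodic equilibria at `U_σ`: uniqueness up to the shift by `π` in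
the `δ`-neighbourhood, expansion, and stability, for `ε, γ < r`. -/
def HasBranch (c₀ σ δ r C : ℝ) (a : ℝ → ℝ) : Prop :=
  ∀ γ, 0 < γ → γ < r → |a γ - 2 / √3| ≤ C * γ ∧
    (∀ α, -r ^ 2 < α → α ≤ 0 → ∀ W, IsNearbyEvenEquilibrium c₀ α γ σ δ W → W = homState σ) ∧
    ∀ ε, 0 < ε → ε < r → ∃ U : ℝ → ℝ × ℝ, IsEquilibrium c₀ (ε ^ 2) γ U ∧ IsPeriodic U ∧ IsEven U ∧
      (∀ x, ‖U x - (σ + ε * a γ / (2 - σ * c₀) * Real.cos x, ε * a γ * Real.cos x)‖ ≤ C * ε ^ 2) ∧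
      (∀ x, ‖U x - homState σ x‖ ≤ C * ε) ∧
      (∀ W, IsNearbyEvenEquilibrium c₀ (ε ^ 2) γ σ δ W →
        W = homState σ ∨ W = U ∨ W = fun x => U (x + Real.pi)) ∧
      U ≠ homState σ ∧ U ≠ (fun x => U (x + Real.pi)) ∧ IsLinearlyStable c₀ (ε ^ 2) γ U

lemma norm_sub_homState (p v : EvenPer) (x : ℝ) :
    ‖profile σ p v x - homState σ x‖ = max |p x| |v x| := by
  simp [profile, homState, Prod.norm_def]

lemma exists_profile_of_nearby {δ : ℝ} (hδ : 0 ≤ δ) {W : ℝ → ℝ × ℝ}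
    (hW : IsNearbyEvenEquilibrium c₀ α γ σ δ W) :
    ∃ p v : EvenPer, W = profile σ p v ∧ ‖p‖ ≤ δ ∧ ‖v‖ ≤ δ := by
  obtain ⟨p, v, rfl⟩ := exists_profile (σ := σ) hW.1 hW.2.1 hW.2.2.1
  have h := hW.2.2.2
  simp only [norm_sub_homState] at h
  exact ⟨p, v, rfl, norm_le_of_forall hδ fun x => (le_max_left _ _).trans (h x).le,
    norm_le_of_forall hδ fun x => (le_max_right _ _).trans (h x).le⟩

lemma IsNearbyEvenEquilibrium.add_pi {δ : ℝ} {W : ℝ → ℝ × ℝ}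
    (hW : IsNearbyEvenEquilibrium c₀ α γ σ δ W) :
    IsNearbyEvenEquilibrium c₀ α γ σ δ fun x => W (x + Real.pi) := by
  obtain ⟨h1, h2, h3, h4⟩ := hW
  refine ⟨?_, ?_, h3.add_pi h2, fun x => h4 (x + Real.pi)⟩
  · rw [h2.add_pi]; exact h1.translate _
  · rw [h2.add_pi]; exact h2.translate _

lemma isNearMode_scaled {ε A R : ℝ} {q w : EvenPer} (hA : |A| ≤ R * ε)
    (hq : ‖q‖ ≤ R) (hw : ‖w‖ ≤ R) (hR : 1 ≤ R) :
    (∀ x, (A • scaledU c₀ σ A q) x = A * Real.cos x / (2 - σ * c₀) + A ^ 2 * q x) ∧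
    (∀ x, (A • scaledV A w) x = A * Real.cos x + A ^ 2 * w x) ∧
    (∀ x, |A ^ 2 * q x| ≤ R ^ 3 * ε ^ 2) ∧ (∀ x, |A ^ 2 * w x| ≤ R ^ 3 * ε ^ 2) ∧
    (0 < ε → IsNearMode c₀ σ ε A (R ^ 3) (A • scaledU c₀ σ A q : EvenPer)
      (A • scaledV A w : EvenPer)) := by
  have h1 : ∀ x, (A • scaledU c₀ σ A q) x = A * Real.cos x / (2 - σ * c₀) + A ^ 2 * q x :=
    fun x => by simp [scaledU]; ring
  have h2 : ∀ x, (A • scaledV A w) x = A * Real.cos x + A ^ 2 * w x :=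
    fun x => by simp [scaledV]; ring
  have hb : ∀ {f : EvenPer}, ‖f‖ ≤ R → ∀ x, |A ^ 2 * f x| ≤ R ^ 3 * ε ^ 2 := fun {f} hf x => by
    rw [abs_mul, abs_pow]
    calc |A| ^ 2 * |f x| ≤ (R * ε) ^ 2 * R := by
          gcongr
          exact (f.abs_apply_le x).trans hf
      _ = _ := by ring
  refine ⟨h1, h2, hb hq, hb hw, fun hε => ⟨EvenPer.continuous _, EvenPer.continuous _, ?_,
    fun x => ?_, fun x => ?_⟩⟩
  · refine hA.trans ?_
    gcongr
    exact le_self_pow₀ hR (by norm_num)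
  · rw [h1, add_sub_cancel_left]; exact hb hq x
  · rw [h2, add_sub_cancel_left]; exact hb hw x

/-- The amplitude is `a γ = (ψ (0, γ)).1`; the branch has `A = ε (ψ (ε, γ)).1`, so Lipschitz
continuity makes `A - ε a` of order `ε²`. -/
lemma exists_hasBranch (hσ : σ = 1 ∨ σ = -1) (hc₀ : 0 < c₀) (hc₀' : c₀ < 1) :
    ∃ δ > 0, ∃ r > 0, ∃ C > 0, ∃ a : ℝ → ℝ, HasBranch c₀ σ δ r C a := by
  have hm := one_sub_sign_mul_pos hc₀ hc₀' hσ
  obtain ⟨ψ, hlim, hsol, huniq, C₀, s, hs, hlip⟩ := exists_branch c₀ σ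
  obtain ⟨s₁, hs₁, N, hN, hsN⟩ := mem_nhds_prod_iff.1 huniq
  obtain ⟨δ₀, hδ₀, hsmall⟩ := exists_smallness hσ hm hN
  obtain ⟨R, hR⟩ : ∃ R, R = ‖branchBase c₀ σ‖ + 1 := ⟨_, rfl⟩
  have hR1 : 1 ≤ R := by rw [hR]; linarith [norm_nonneg (branchBase c₀ σ)]
  -- `R³` suffices because the corrections are `A² q` and `A² w` with `|A| ≤ R ε` and `q`, `w`
  -- bounded by `R`.
  obtain ⟨r₀, hr₀, hstab⟩ := exists_stability hσ hc₀ hc₀' (M := R ^ 3) (one_le_pow₀ hR1)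
  have hbound : ∀ᶠ x in 𝓝 (0 : ℝ × ℝ), ‖ψ x‖ ≤ R := by
    have := (hlim.norm).eventually (gt_mem_nhds (show ‖branchBase c₀ σ‖ < R by rw [hR]; linarith))
    exact this.mono fun x hx => hx.le
  -- The limit `2/√3` exceeds `1`; this provides `A² ≥ ε²` for stability.
  have hone : ∀ᶠ x in 𝓝 (0 : ℝ × ℝ), 1 < (ψ x).1 := by
    have h1 : Tendsto (fun x => (ψ x).1) (𝓝 0) (𝓝 (2 / √3)) :=
      (continuous_fst.tendsto _).comp hlim
    refine h1.eventually (lt_mem_nhds ?_)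
    rw [one_lt_div (by positivity), Real.sqrt_lt' (by norm_num)]
    norm_num
  have hψ0 : ψ 0 = branchBase c₀ σ := eq_of_tendsto_nhds hlim
  obtain ⟨r₁, hr₁, hball⟩ := Metric.eventually_nhds_iff.1
    (((hsol.and hbound).and (hone.and hs)).and hs₁)
  obtain ⟨r, hr⟩ : ∃ r, r = min (min r₀ r₁) (min 1 δ₀) := ⟨_, rfl⟩
  have hrpos : 0 < r := by rw [hr]; positivity
  have hrr₀ : r ≤ r₀ := hr ▸ (min_le_left _ _).trans (min_le_left _ _)
  have hrr₁ : r ≤ r₁ := hr ▸ (min_le_left _ _).trans (min_le_right _ _)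
  have hr1 : r ≤ 1 := hr ▸ (min_le_right _ _).trans (min_le_left _ _)
  have hrδ : r ≤ δ₀ := hr ▸ (min_le_right _ _).trans (min_le_right _ _)
  have hmem : ∀ ε γ : ℝ, |ε| < r → |γ| < r → dist ((ε, γ) : ℝ × ℝ) 0 < r₁ := fun ε γ h1 h2 => by
    rw [dist_zero_right, Prod.norm_mk, max_lt_iff]
    exact ⟨h1.trans_le hrr₁, h2.trans_le hrr₁⟩
  have hr2 : r ^ 2 ≤ δ₀ := (by nlinarith : r ^ 2 ≤ r).trans hrδ
  -- Passing from pointwise strict bounds to norms gives only `≤`; halving restores the strict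
  -- inequality required by `hsmall`.
  refine ⟨δ₀ / 2, by positivity, r, hrpos, |C₀| + 2 * R ^ 3, by positivity, fun γ => (ψ (0, γ)).1,
    fun γ hγ hγr => ⟨?_, fun α hα hα0 W hW => ?_, fun ε hε hεr => ?_⟩⟩
  · have h1 := hball (hmem 0 γ (by simpa using hrpos) (by rwa [abs_of_pos hγ]))
    have h2 := hball (hmem 0 0 (by simpa using hrpos) (by simpa using hrpos))
    have h3 := hlip _ h1.1.2.2 _ h2.1.2.2
    rw [show ((0, 0) : ℝ × ℝ) = 0 from rfl, hψ0, sub_zero] at h3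
    have h4 : ‖((0, γ) : ℝ × ℝ)‖ = γ := by
      simp [Prod.norm_mk, abs_of_pos hγ, hγ.le]
    have h5 : |(ψ (0, γ)).1 - 2 / √3| ≤ ‖ψ (0, γ) - branchBase c₀ σ‖ :=
      norm_fst_le (ψ (0, γ) - branchBase c₀ σ)
    rw [h4] at h3
    have h6 : C₀ * γ ≤ |C₀| * γ := by gcongr; exact le_abs_self _
    have h7 : 0 ≤ 2 * R ^ 3 * γ := by positivity
    linarith
  · obtain ⟨p, v, rfl, hp, hv⟩ := exists_profile_of_nearby (by positivity) hW
    have hαδ : |α| < δ₀ := by rw [abs_lt]; constructor <;> linarith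
    rcases hsmall α γ p v hαδ (by rw [abs_of_pos hγ]; linarith) (by linarith) (by linarith) hW.1
      with ⟨rfl, rfl⟩ | ⟨q, w, -, -, -, -, hα', -⟩
    · funext x; simp [profile, homState]
    · exact absurd hα' hα0.not_gt
  · obtain ⟨⟨⟨h1, h2⟩, h3, h4⟩, h5⟩ := hball (hmem ε γ (by rwa [abs_of_pos hε])
      (by rwa [abs_of_pos hγ]))
    have h6 := hball (hmem 0 γ (by simpa using hrpos) (by rwa [abs_of_pos hγ]))
    have hdiff : |(ψ (ε, γ)).1 - (ψ (0, γ)).1| ≤ |C₀| * ε := by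
      have h7 := hlip _ h4 _ h6.1.2.2
      have h8 : ‖((ε, γ) : ℝ × ℝ) - (0, γ)‖ = ε := by
        simp [Prod.norm_mk, abs_of_pos hε, hε.le]
      rw [h8] at h7
      refine (norm_fst_le (ψ (ε, γ) - ψ (0, γ))).trans (h7.trans ?_)
      gcongr; exact le_abs_self _
    have hS := h1 hε.ne'
    obtain ⟨⟨b, q, w⟩, hbqw⟩ : ∃ y, y = ψ (ε, γ) := ⟨_, rfl⟩
    rw [← hbqw] at hS h2 h3 hdiff
    simp only at hS h3 hdiff
    simp only [Prod.norm_mk, max_le_iff] at h2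
    obtain ⟨hb, hq, hw⟩ := h2
    obtain ⟨A, hA⟩ : ∃ A, A = ε * b := ⟨_, rfl⟩
    have hA0 : 0 < A := by rw [hA]; positivity
    rw [← hA] at hS
    have hAR : |A| ≤ R * ε := by
      rw [hA, abs_mul, abs_of_pos hε, mul_comm]
      gcongr; exact hb
    have hw0 := hS.coeff_eq_zero
    have hE := (isEquilibrium_scaled_iff hσ hm hA0.ne' hw0).2 hS
    obtain ⟨f1, f2, f3, f4, f5⟩ := isNearMode_scaled (c₀ := c₀) (σ := σ) hAR hq hw hR1
    have hcv : coeff (A • scaledV A w) = A := by simp [scaledV, coeff_cosine, hw0]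
    obtain ⟨p, hp⟩ : ∃ p, p = A • scaledU c₀ σ A q := ⟨_, rfl⟩
    obtain ⟨v, hv⟩ : ∃ v, v = A • scaledV A w := ⟨_, rfl⟩
    have hNM := f5 hε
    rw [← hp] at hE f1 hNM
    rw [← hv] at hE f2 hNM hcv
    have hper : IsPeriodic (profile σ p v) := fun x => by
      simp only [profile, p.periodic x, v.periodic x]
    have heven : IsEven (profile σ p v) := fun x => by
      simp only [profile, p.even x, v.even x]
    have hcoeff : cosCoeff (fun x => (profile σ p v x).2) = A := hcv
    have hshift : cosCoeff (fun x => (profile σ p v (x + Real.pi)).2) = -A := by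
      rw [← hcoeff]
      exact cosCoeff_shift (f := fun x => (profile σ p v x).2) v.periodic
    -- For positive amplitude `|A|/ε = A/ε`, so the rescaled unknowns lie in the uniqueness
    -- neighbourhood and coincide with `ψ (ε, γ)`.
    have hpos : ∀ W, IsNearbyEvenEquilibrium c₀ (ε ^ 2) γ σ (δ₀ / 2) W → W = homState σ ∨
        cosCoeff (fun x => (W x).2) ≠ 0 ∧
        (0 < cosCoeff (fun x => (W x).2) → W = profile σ p v) := fun W hW => by
      obtain ⟨p', v', rfl, hp', hv'⟩ := exists_profile_of_nearby (by positivity) hW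
      have hαδ : |ε ^ 2| < δ₀ := by
        rw [abs_of_pos (by positivity)]; exact lt_of_lt_of_le (by gcongr) hr2
      rcases hsmall (ε ^ 2) γ p' v' hαδ (by rw [abs_of_pos hγ]; linarith) (by linarith)
        (by linarith) hW.1 with ⟨rfl, rfl⟩ | ⟨q', w', hne, hpe, hve, hS', -, hmemN⟩
      · left; funext x; simp [profile, homState]
      · refine Or.inr ⟨hne, fun hpos => ?_⟩
        have hpos' : 0 < coeff v' := hpos
        rw [Real.sqrt_sq hε.le, abs_of_pos hpos'] at hmemN
        have h7 := hsN (Set.mk_mem_prod h5 hmemN) hε.ne'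
        simp only [mul_div_cancel₀ _ hε.ne'] at h7
        have h8 := h7 hS'
        rw [← hbqw] at h8
        simp only [Prod.mk.injEq] at h8
        obtain ⟨e1, e2, e3⟩ := h8
        have e4 : coeff v' = A := by rw [hA, ← e1]; field_simp
        rw [e2, e4, ← hp] at hpe
        rw [e3, e4, ← hv] at hve
        rw [hpe, hve]
    refine ⟨profile σ p v, hE, hper, heven, fun x => ?_, fun x => ?_, fun W hW => ?_, fun h => ?_,
      fun h => ?_, ?_⟩
    · have hAa : |A - ε * (ψ (0, γ)).1| ≤ |C₀| * ε ^ 2 := by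
        rw [hA, ← mul_sub, abs_mul, abs_of_pos hε]
        calc ε * |b - (ψ (0, γ)).1| ≤ ε * (|C₀| * ε) := by gcongr
          _ = _ := by ring
      have hd : 1 ≤ 2 - σ * c₀ := by linarith
      have hcos := Real.abs_cos_le_one x
      have hR3 : 0 ≤ R ^ 3 * ε ^ 2 := by positivity
      have k1 : |(A - ε * (ψ (0, γ)).1) * Real.cos x| ≤ |C₀| * ε ^ 2 := by
        rw [abs_mul]; exact (mul_le_of_le_one_right (abs_nonneg _) hcos).trans hAa
      have k2 : |(A - ε * (ψ (0, γ)).1) * Real.cos x / (2 - σ * c₀)| ≤ |C₀| * ε ^ 2 := by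
        rw [abs_div, abs_of_pos (by linarith : 0 < 2 - σ * c₀)]
        exact (div_le_self (abs_nonneg _) hd).trans k1
      rw [Prod.norm_def, max_le_iff]
      constructor
      · rw [Real.norm_eq_abs, show (profile σ p v x - (σ + ε * (ψ (0, γ)).1 / (2 - σ * c₀) *
          Real.cos x, ε * (ψ (0, γ)).1 * Real.cos x)).1 =
          (A - ε * (ψ (0, γ)).1) * Real.cos x / (2 - σ * c₀) + A ^ 2 * q x by
            simp only [profile, Prod.fst_sub, f1]; ring]
        have := abs_add_le ((A - ε * (ψ (0, γ)).1) * Real.cos x / (2 - σ * c₀)) (A ^ 2 * q x)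
        linarith [f3 x]
      · rw [Real.norm_eq_abs, show (profile σ p v x - (σ + ε * (ψ (0, γ)).1 / (2 - σ * c₀) *
          Real.cos x, ε * (ψ (0, γ)).1 * Real.cos x)).2 =
          (A - ε * (ψ (0, γ)).1) * Real.cos x + A ^ 2 * w x by
            simp only [profile, Prod.snd_sub, f2]; ring]
        have := abs_add_le ((A - ε * (ψ (0, γ)).1) * Real.cos x) (A ^ 2 * w x)
        linarith [f4 x]
    · rw [norm_sub_homState, max_le_iff]
      have hε1 : ε ≤ 1 := hεr.le.trans hr1
      have hC₀ : 0 ≤ |C₀| * ε := by positivity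
      have g1 := (hNM.abs_fst_le hm hε hε1 (one_le_pow₀ hR1) x).2
      have g2 := (hNM.abs_snd_le hε hε1 (one_le_pow₀ hR1) x).2
      constructor <;> linarith
    · rcases hpos W hW with h7 | ⟨h7, h8⟩
      · exact Or.inl h7
      rcases lt_or_gt_of_ne h7 with h9 | h9
      -- Negative amplitude: the shift by `π` flips the sign of the cosine coefficient and reduces
      -- to the positive case.
      · have h10 := cosCoeff_shift (f := fun x => (W x).2) fun x => by simp only [hW.2.1 x]
        have hW' : (fun x => W (x + Real.pi)) = profile σ p v := by
          rcases hpos _ hW.add_pi with h11 | ⟨-, h12⟩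
          · exfalso
            have h13 : cosCoeff (fun x => (W (x + Real.pi)).2) = 0 := by
              simp only [fun x => congr_fun h11 x]
              simp [cosCoeff, homState]
            rw [h13] at h10
            linarith
          · exact h12 (by rw [h10]; linarith)
        refine Or.inr (Or.inr ?_)
        rw [← hW']
        funext x
        have := hW.2.1 x
        rw [← this]
        congr 1; ring
      · exact Or.inr (Or.inl (h8 h9))
    · rw [h] at hcoeff
      simp [cosCoeff, homState] at hcoeff
      linarith
    · rw [← show cosCoeff (fun x => (profile σ p v x).2) =
        cosCoeff (fun x => (profile σ p v (x + Real.pi)).2) from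
          congr_arg cosCoeff (funext fun x => congr_arg Prod.snd (congr_fun h x)), hcoeff] at hshift
      linarith
    · refine hstab ε γ A p v hε (by linarith) hγ (by linarith) hNM ?_
      rw [hA, mul_pow]
      have : 1 ≤ b ^ 2 := one_le_pow₀ h3.le
      nlinarith [sq_nonneg ε]

end Equilibria

end TuringPattern

end

/-- Here `σ = 1` and `σ = -1` give the upper and the lower sign. The constants `ε₀, γ₀, C, δ, κ`
depend only on `c₀`, and the amplitudes `a σ γ` only on `c₀`, the sign and `γ`. -/
theorem theorem2p3 (c₀ : ℝ) (hc₀ : 0 < c₀) (hc₀' : c₀ < 1) :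
    ∃ ε₀ > (0 : ℝ), ∃ γ₀ > (0 : ℝ), ∃ C > (0 : ℝ), ∃ δ > (0 : ℝ), ∃ κ > (0 : ℝ),
    ∃ a : ℝ → ℝ → ℝ,
      ∀ σ : ℝ, σ = 1 ∨ σ = -1 → ∀ γ : ℝ, 0 < γ → γ < γ₀ →
        -- the amplitude
        |a σ γ - 2 / √3| ≤ C * γ ∧
        -- the crossing of a simple eigenvalue at the homogeneous state
        (∀ α : ℝ, |α| < ε₀ ^ 2 →
          TuringPattern.IsSimpleEigenvalue c₀ α γ (TuringPattern.homState σ) (α : ℂ)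
            (TuringPattern.criticalMode c₀ α σ) ∧
          ∀ z : ℂ, TuringPattern.IsEigenvalue c₀ α γ (TuringPattern.homState σ) z →
            z ≠ (α : ℂ) → z.re ≤ -κ) ∧
        -- only the homogeneous state for `α ≤ 0`
        (∀ α : ℝ, -ε₀ ^ 2 < α → α ≤ 0 → ∀ W : ℝ → ℝ × ℝ,
          TuringPattern.IsNearbyEvenEquilibrium c₀ α γ σ δ W ↔ W = TuringPattern.homState σ) ∧
        -- the periodic equilibria for `α = ε²`
        ∀ ε : ℝ, 0 < ε → ε < ε₀ →
          ∃ U : ℝ → ℝ × ℝ,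
            ContDiff ℝ ∞ U ∧
            TuringPattern.IsPeriodic U ∧
            TuringPattern.IsEven U ∧
            (∀ x₀ : ℝ, TuringPattern.IsEquilibrium c₀ (ε ^ 2) γ (fun x => U (x - x₀))) ∧
            (∀ x : ℝ, ‖U x - (σ + ε * a σ γ / (2 - σ * c₀) * Real.cos x,
                ε * a σ γ * Real.cos x)‖ ≤ C * ε ^ 2) ∧
            -- exactly three nearby even equilibria: the homogeneous one and a stable pair
            (∀ W : ℝ → ℝ × ℝ,
              TuringPattern.IsNearbyEvenEquilibrium c₀ (ε ^ 2) γ σ δ W ↔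
                W = TuringPattern.homState σ ∨ W = U ∨ W = fun x => U (x + Real.pi)) ∧
            U ≠ TuringPattern.homState σ ∧
            U ≠ (fun x => U (x + Real.pi)) ∧
            TuringPattern.IsLinearlyStable c₀ (ε ^ 2) γ U ∧
            TuringPattern.IsLinearlyStable c₀ (ε ^ 2) γ (fun x => U (x + Real.pi)) := by
  obtain ⟨δ₁, hδ₁, r₁, hr₁, C₁, hC₁, a₁, h₁⟩ :=
    TuringPattern.exists_hasBranch (σ := 1) (Or.inl rfl) hc₀ hc₀'
  obtain ⟨δ₂, hδ₂, r₂, hr₂, C₂, hC₂, a₂, h₂⟩ :=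
    TuringPattern.exists_hasBranch (σ := -1) (Or.inr rfl) hc₀ hc₀'
  set δ := min δ₁ δ₂ with hδ
  set C := max C₁ C₂ with hC
  have hδ0 : 0 < δ := lt_min hδ₁ hδ₂
  have hC0 : 0 < C := lt_max_of_lt_left hC₁
  set a : ℝ → ℝ → ℝ := fun σ γ => if σ = 1 then a₁ γ else a₂ γ with ha
  -- Both `κ` and `|α|` are kept at most `ρ`, and `2ρ = 1/(300 π²)` lies below the spectral gap
  -- `1/(144 π²)`.
  obtain ⟨ρ, hρ⟩ : ∃ ρ, ρ = 1 / (600 * Real.pi ^ 2) := ⟨_, rfl⟩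
  have hρ0 : 0 < ρ := by rw [hρ]; positivity
  have hρ2 : ρ + ρ < 1 / (144 * Real.pi ^ 2) := by
    have : ρ + ρ = 1 / (300 * Real.pi ^ 2) := by rw [hρ]; field_simp; norm_num
    rw [this]
    have := Real.pi_pos
    gcongr
    norm_num
  -- `1 - c₀` keeps `1 - σ c₀ + α` positive, `ρ` controls `|α|`, and `δ / C` places the branches
  -- inside the common `δ`-neighbourhood, which may be smaller than the one of either sign.
  set ε₀ := min (min (min r₁ r₂) (min 1 (1 - c₀))) (min ρ (δ / C)) with hε₀
  have hε₀0 : 0 < ε₀ :=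
    lt_min (lt_min (lt_min hr₁ hr₂) (lt_min one_pos (by linarith))) (lt_min hρ0 (by positivity))
  have hε₀r₁ : ε₀ ≤ r₁ := (min_le_left _ _).trans ((min_le_left _ _).trans (min_le_left _ _))
  have hε₀r₂ : ε₀ ≤ r₂ := (min_le_left _ _).trans ((min_le_left _ _).trans (min_le_right _ _))
  have hε₀1 : ε₀ ≤ 1 := (min_le_left _ _).trans ((min_le_right _ _).trans (min_le_left _ _))
  have hε₀c : ε₀ ≤ 1 - c₀ := (min_le_left _ _).trans ((min_le_right _ _).trans (min_le_right _ _))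
  have hε₀ρ : ε₀ ≤ ρ := (min_le_right _ _).trans (min_le_left _ _)
  have hε₀δ : ε₀ ≤ δ / C := (min_le_right _ _).trans (min_le_right _ _)
  have hsq : ε₀ ^ 2 ≤ ε₀ := by nlinarith
  refine ⟨ε₀, hε₀0, ε₀, hε₀0, C, hC0, δ, hδ0, min ρ ((1 - c₀) / 2),
    lt_min hρ0 (by linarith), a, fun σ hσ γ hγ hγ₀ => ?_⟩
  obtain ⟨δ', r, C', hδδ', hr0, hrr, hCC', hB⟩ : ∃ δ' r C', δ ≤ δ' ∧ 0 < r ∧ ε₀ ≤ r ∧ C' ≤ C ∧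
      TuringPattern.HasBranch c₀ σ δ' r C' (a σ) := by
    rcases hσ with rfl | rfl
    · exact ⟨δ₁, r₁, C₁, min_le_left _ _, hr₁, hε₀r₁, le_max_left _ _, by simpa [ha] using h₁⟩
    · refine ⟨δ₂, r₂, C₂, min_le_right _ _, hr₂, hε₀r₂, le_max_right _ _, ?_⟩
      have : a (-1) = a₂ := by funext γ; simp only [ha]; norm_num
      rw [this]; exact h₂
  obtain ⟨hamp, hneg, hbranch⟩ := hB γ hγ (hγ₀.trans_le hrr)
  have hσc : 1 - c₀ ≤ 1 - σ * c₀ := by rcases hσ with rfl | rfl <;> linarith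
  have hmono : ∀ {α W}, TuringPattern.IsNearbyEvenEquilibrium c₀ α γ σ δ W →
      TuringPattern.IsNearbyEvenEquilibrium c₀ α γ σ δ' W := fun h =>
    ⟨h.1, h.2.1, h.2.2.1, fun x => (h.2.2.2 x).trans_le hδδ'⟩
  have hhom : ∀ {α}, TuringPattern.IsNearbyEvenEquilibrium c₀ α γ σ δ
      (TuringPattern.homState σ) :=
    ⟨TuringPattern.isEquilibrium_homState hσ, fun _ => rfl, fun _ => rfl,
      fun x => by rw [sub_self, norm_zero]; exact hδ0⟩
  refine ⟨hamp.trans (by gcongr), fun α hα => ⟨?_, fun z hz hne => ?_⟩, fun α hα hα0 W => ?_,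
    fun ε hε hε' => ?_⟩
  · refine TuringPattern.isSimpleEigenvalue_homState hσ ?_
    have := (abs_lt.1 hα).1
    linarith
  · refine TuringPattern.re_le_of_isEigenvalue_homState hσ ?_ ?_ hz hne
    · have := min_le_right ρ ((1 - c₀) / 2)
      linarith
    · have := min_le_left ρ ((1 - c₀) / 2)
      linarith
  · refine ⟨fun hW => hneg α ?_ hα0 W (hmono hW), fun hW => hW ▸ hhom⟩
    have : ε₀ ^ 2 ≤ r ^ 2 := by gcongr
    linarith
  · obtain ⟨U, hE, hp, he, happ, hclose, huniq, hne, hne', hst⟩ := hbranch ε hε (hε'.trans_le hrr)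
    have hU : TuringPattern.IsNearbyEvenEquilibrium c₀ (ε ^ 2) γ σ δ U := by
      refine ⟨hE, hp, he, fun x => (hclose x).trans_lt ?_⟩
      have h3 : ε < δ / C := hε'.trans_le hε₀δ
      rw [lt_div_iff₀ hC0] at h3
      have : C' * ε ≤ C * ε := by gcongr
      linarith
    refine ⟨U, hE.contDiff, hp, he, fun x₀ => hE.translate x₀,
      fun x => (happ x).trans (by gcongr), fun W => ⟨fun hW => huniq W (hmono hW), ?_⟩, hne, hne',
      hst, hst.add_pi⟩
    rintro (rfl | rfl | rfl)
    exacts [hhom, hU, hU.add_pi]
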